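/- **Conventions.** $(\mathcal M,\tau)$ denotes a von Neumann algebra with a normal faithful tracial state, $\|x\|_2=\tau(x^*x)^{1/2}$, and $\mathcal M_\infty=\mathcal M\overline\otimes B(\ell_2)$ carries the trace $\tau\otimes\mathrm{Tr}$, again denoted $\tau$; $\mathcal M$ is identified with the corner $\mathcal M\otimes e_{1,1}$, with unit $1_{\mathcal M}$. Let $\mathcal C$ be a class of such pairs $(\mathcal M,\tau)$, considered up to trace-preserving isomorphism, closed under von Neumann subalgebras (with the restricted trace) and under dilations: if $(\mathcal M,\tau)\in\mathcal C$, $P\in\mathcal M_\infty$ is a projection of finite trace and there is $w\in P\mathcal M_\infty 1_{\mathcal M}$ with $w^*w=1_{\mathcal M}$, then $(P\mathcal M_\infty P,\tau/\tau(P))\in\mathcal C$. Let $G$ be a countable group and $\mu$ a probability measure on $G$ whose support generates $G$. A map $\varphi:G\to\mathcal U(\mathcal M)$ is an $(\varepsilon,\mu)$-almost homomorphism if $\iint\|\varphi(gh)-\varphi(g)\varphi(h)\|_2^2\,d\mu(g)\,d\mu(h)\le\varepsilon$. The pair $(G,\mu)$ is $\mathcal C$-flexibly stable if there is a non-decreasing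 $\delta:[0,4]\to[0,4]$ with $\lim_{t\to0}\delta(t)=0$ such that for all $\varepsilon\in[0,4]$, all $(\mathcal M,\tau)\in\mathcal C$ and every $(\varepsilon,\mu)$-almost homomorphism $\varphi:G\to\mathcal U(\mathcal M)$, there are a projection $P\in\mathcal M_\infty$, a homomorphism $\pi:G\to\mathcal U(P\mathcal M_\infty P)$ and $w\in P\mathcal M_\infty1_{\mathcal M}$ with $w^*w=1_{\mathcal M}$ and $$\max\Big(\tau(P)-1,\ \int\|\varphi(g)-w^*\pi(g)w\|_2^2\,d\mu(g)\Big)\le\delta(\varepsilon).$$ If moreover $\delta$ is concave and $\delta(4)=4$, then $\delta$ is called a modulus of $\mathcal C$-flexible stability. Let $\kappa(\mu)\in[0,\infty]$ be the smallest constant $\kappa$ such that $\|\xi-P_{\mathcal H^\pi}\xi\|^2\le\frac\kappa2\int\|\pi(g)\xi-\xi\|^2d\mu(g)$ for every unitary representation $(\pi,\mathcal H)$ of $G$ and every $\xi\in\mathcal H$, where $P_{\mathcal H^\pi}$ is the orthogonal projection on the invariant vectors. **Theorem.** (1) There is a universal constant $K>0$ such that the following holds for every class $\mathcal C$ as above.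 Let $G_1,G_2$ be countable groups, let $\mu_1,\mu_2$ be probability measures with generating support on $G_1,G_2$, and suppose $\kappa(\mu_1)<\infty$. Put $\mu=\frac12(\mu_1\otimes\delta_1+\delta_1\otimes\mu_2)$ on $G_1\times G_2$ (here $\delta_1$ is the Dirac mass at the identity). If $(G_1,\mu_1)$ and $(G_2,\mu_2)$ are $\mathcal C$-flexibly stable, then so is $(G_1\times G_2,\mu)$. More precisely, if $G_1$ is nontrivial and $(G_i,\mu_i)$ has modulus of $\mathcal C$-flexible stability $\delta_i$ for $i=1,2$, then $(G_1\times G_2,\mu)$ has a modulus of $\mathcal C$-flexible stability $\delta$ with $$\delta(\varepsilon)\le K\,\delta_2\big(\min(4,\kappa(\mu_1)\,\delta_1(\varepsilon))\big)\qquad(0\le\varepsilon\le4).$$ (2) Let $G$ and $H$ be countable groups, at least one of which has Kazhdan's property (T). If $G$ and $H$ are flexibly Hilbert–Schmidt stable, then so is $G\times H$. Here a countable group $G$ is flexibly Hilbert–Schmidt stable if for all integers $d_n\ge1$ and maps $\varphi_n:G\to U(d_n)$ with $\|\varphi_n(gh)-\varphi_n(g)\varphi_n(h)\|_2\to0$ for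 all $g,h\in G$ there are integers $D_n$, homomorphisms $\pi_n:G\to U(D_n)$ and isometries $w_n:\mathbf C^{d_n}\to\mathbf C^{D_n}$ with $D_n/d_n\to1$ and $\|\varphi_n(g)-w_n^*\pi_n(g)w_n\|_2\to0$ for all $g\in G$, where $\|x\|_2^2=\frac1{d}\mathrm{Tr}(x^*x)$ on $M_{d}(\mathbf C)$. -/

import Mathlib

open MeasureTheory Filter Topology
open scoped ENNReal NNReal ComplexOrder

universe u v w

noncomputable section

/-! ### Tracial von Neumann algebras -/

/-- A von Neumann algebra acting on a complex Hilbert space, with a normal faithful tracial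
state.  Normality (weak-star continuity) is continuity for the ultraweak topology:
`τ x = ∑ₙ ⟪η n, x (ξ n)⟫` for square-summable sequences `ξ`, `η`. -/
structure TracialVN where
  Space : Type u
  [normedAddCommGroup : NormedAddCommGroup Space]
  [innerProductSpace : InnerProductSpace ℂ Space]
  [completeSpace : CompleteSpace Space]
  alg : VonNeumannAlgebra Space
  τ : alg.toStarSubalgebra →ₗ[ℂ] ℂ
  normal : ∃ ξ η : ℕ → Space, Summable (fun n => ‖ξ n‖ ^ 2) ∧ Summable (fun n => ‖η n‖ ^ 2) ∧
    ∀ x : alg.toStarSubalgebra,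
      HasSum (fun n => inner ℂ (η n) ((x : Space →L[ℂ] Space) (ξ n))) (τ x)
  nonneg : ∀ x, 0 ≤ τ (star x * x)
  map_one : τ 1 = 1
  faithful : ∀ x, τ (star x * x) = 0 → x = 0
  tracial : ∀ x y, τ (x * y) = τ (y * x)

attribute [instance] TracialVN.normedAddCommGroup TracialVN.innerProductSpace
  TracialVN.completeSpace

/-! ### The amplification `M ⊗ B(ℓ²)` -/

section Amplification

set_option linter.unusedSectionVars false

variable {H : Type u} [NormedAddCommGroup H] [InnerProductSpace ℂ H] [CompleteSpace H]

variable (H) in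
/-- The Hilbert space `H ⊗ ℓ²(ℕ) = ℓ²(ℕ, H)`. -/
abbrev AmpSpace : Type u := lp (fun _ : ℕ => H) 2

/-- The `(i, j)` matrix coefficient of an operator on `ℓ²(ℕ, H)`. -/
def matCoeff (T : AmpSpace H →L[ℂ] AmpSpace H) (i j : ℕ) : H →L[ℂ] H :=
  (lp.evalCLM ℂ (fun _ : ℕ => H) 2 i) ∘L T ∘L
    (lp.singleContinuousLinearMap ℂ (fun _ : ℕ => H) 2 j)

theorem matCoeff_apply (T : AmpSpace H →L[ℂ] AmpSpace H) (i j : ℕ) (x : H) :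
    matCoeff T i j x = T (lp.single 2 j x) i := rfl

/-- The operators `x ⊗ 1` on `ℓ²(ℕ, H)`, for `x` in the commutant of `M`. -/
def diagCommutant (M : VonNeumannAlgebra H) : Set (AmpSpace H →L[ℂ] AmpSpace H) :=
  {D | ∃ x ∈ M.commutant, ∀ f i, D f i = x (f i)}

theorem star_mem_diagCommutant (M : VonNeumannAlgebra H) {D : AmpSpace H →L[ℂ] AmpSpace H}
    (hD : D ∈ diagCommutant M) : star D ∈ diagCommutant M := by
  obtain ⟨x, hx, h⟩ := hD
  refine ⟨star x, star_mem hx, fun f i => ?_⟩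
  refine ext_inner_right ℂ fun v => ?_
  have h1 : D (lp.single 2 i v) = lp.single 2 i (x v) := by
    ext j
    rw [h]
    by_cases hj : j = i
    · subst hj; simp
    · rw [lp.single_apply_ne _ _ _ hj, lp.single_apply_ne _ _ _ hj, _root_.map_zero]
  rw [← lp.inner_single_right, ContinuousLinearMap.star_eq_adjoint,
    ContinuousLinearMap.adjoint_inner_left, h1, lp.inner_single_right,
    ContinuousLinearMap.star_eq_adjoint, ContinuousLinearMap.adjoint_inner_left]

theorem exists_diag (x : H →L[ℂ] H) :
    ∃ D : AmpSpace H →L[ℂ] AmpSpace H, ∀ f i, D f i = x (f i) := by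
  have hp : (0 : ℝ) < (2 : ℝ≥0∞).toReal := by norm_num
  have hm : ∀ f : AmpSpace H, Memℓp (fun i => x (f i)) 2 := fun f => by
    have := (lp.memℓp f).summable hp
    refine memℓp_gen ((this.mul_left (‖x‖ ^ (2 : ℝ≥0∞).toReal)).of_nonneg_of_le
      (fun i => by positivity) fun i => ?_)
    rw [← Real.mul_rpow (by positivity) (by positivity)]
    exact Real.rpow_le_rpow (by positivity) (x.le_opNorm _) hp.le
  let L : AmpSpace H →ₗ[ℂ] AmpSpace H :=
    { toFun := fun f => ⟨fun i => x (f i), hm f⟩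
      map_add' := fun f g => by ext i; exact x.map_add _ _
      map_smul' := fun c f => by ext i; exact x.map_smul _ _ }
  refine ⟨L.mkContinuous ‖x‖ fun f => ?_, fun f i => rfl⟩
  refine lp.norm_le_of_forall_sum_le hp (by positivity) fun s => ?_
  rw [Real.mul_rpow (by positivity) (by positivity), lp.norm_rpow_eq_tsum hp f, ← tsum_mul_left]
  refine le_trans (Finset.sum_le_sum fun i _ => ?_)
    ((((lp.memℓp f).summable hp).mul_left _).sum_le_tsum s fun i _ => by positivity)
  rw [← Real.mul_rpow (by positivity) (by positivity)]
  exact Real.rpow_le_rpow (by positivity) (x.le_opNorm _) hp.le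

theorem mem_centralizer_diag_iff (M : VonNeumannAlgebra H) (T : AmpSpace H →L[ℂ] AmpSpace H) :
    T ∈ StarSubalgebra.centralizer ℂ (diagCommutant M) ↔ ∀ i j, matCoeff T i j ∈ M := by
  have hsingle : ∀ (D : AmpSpace H →L[ℂ] AmpSpace H) (x : H →L[ℂ] H),
      (∀ f i, D f i = x (f i)) → ∀ j v, D (lp.single 2 j v) = lp.single 2 j (x v) := by
    intro D x h j v
    ext i
    rw [h]
    by_cases hj : i = j
    · subst hj; simp
    · rw [lp.single_apply_ne _ _ _ hj, lp.single_apply_ne _ _ _ hj, _root_.map_zero]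
  rw [StarSubalgebra.mem_centralizer_iff]
  constructor
  · intro hT i j
    rw [← VonNeumannAlgebra.commutant_commutant M, VonNeumannAlgebra.mem_commutant_iff]
    intro x hx
    obtain ⟨D, hD⟩ := exists_diag x
    have := (hT D ⟨x, hx, hD⟩).1
    ext v
    have h2 := congrArg (fun S : AmpSpace H →L[ℂ] AmpSpace H => S (lp.single 2 j v) i) this
    simp only [mul_apply_eq_comp] at h2 ⊢
    rw [hD, hsingle D x hD] at h2
    exact h2
  · intro hT
    have key : ∀ D ∈ diagCommutant M, D * T = T * D := by
      rintro D ⟨x, hx, hD⟩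
      refine lp.ext_continuousLinearMap (by simp) fun j => ?_
      ext v i
      have h3 := VonNeumannAlgebra.mem_commutant_iff.1 hx _ (hT i j)
      have h4 := congrArg (fun S : H →L[ℂ] H => S v) h3
      simp only [mul_apply_eq_comp] at h4
      change D (T (lp.single 2 j v)) i = T (D (lp.single 2 j v)) i
      rw [hD, hsingle D x hD]
      exact h4.symm
    exact fun D hD => ⟨key D hD, key _ (star_mem_diagCommutant M hD)⟩

/-- The von Neumann algebra `M ⊗ B(ℓ²)`: the operators on `ℓ²(ℕ, H)` all of whose matrix
coefficients lie in `M`. -/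
def amplification (M : VonNeumannAlgebra H) : VonNeumannAlgebra (AmpSpace H) where
  toStarSubalgebra := (StarSubalgebra.centralizer ℂ (diagCommutant M)).copy
    {T | ∀ i j, matCoeff T i j ∈ M}
    (Set.ext fun T => (mem_centralizer_diag_iff M T).symm)
  centralizer_centralizer' := by
    have h : ({T | ∀ i j, matCoeff T i j ∈ M} : Set (AmpSpace H →L[ℂ] AmpSpace H)) =
        (StarSubalgebra.centralizer ℂ (diagCommutant M) : Set _) :=
      Set.ext fun T => (mem_centralizer_diag_iff M T).symm
    change Set.centralizer (Set.centralizer {T | ∀ i j, matCoeff T i j ∈ M}) =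
      {T | ∀ i j, matCoeff T i j ∈ M}
    rw [h, StarSubalgebra.coe_centralizer, Set.centralizer_centralizer_centralizer]

theorem mem_amplification_iff (M : VonNeumannAlgebra H) (T : AmpSpace H →L[ℂ] AmpSpace H) :
    T ∈ (amplification M).toStarSubalgebra ↔ ∀ i j, matCoeff T i j ∈ M := Iff.rfl

end Amplification

namespace TracialVN

variable (A : TracialVN.{u})

/-- The elements of the von Neumann algebra `M`. -/
abbrev Elt : Type u := A.alg.toStarSubalgebra

/-- The elements of `M_∞ = M ⊗ B(ℓ²)`. -/
abbrev Amp : Type u := (amplification A.alg).toStarSubalgebra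

variable {A}

/-- The matrix coefficients, in `M`, of an element of `M_∞`. -/
def entry (T : A.Amp) (i j : ℕ) : A.Elt := ⟨matCoeff (T : _ →L[ℂ] _) i j, T.2 i j⟩

/-- `‖x‖₂² = τ(x* x)`. -/
def normSq (x : A.Elt) : ℝ := (A.τ (star x * x)).re

/-- The trace `τ ⊗ Tr` of a positive element of `M_∞`, with values in `[0, ∞]`. -/
def traceInf (T : A.Amp) : ℝ≥0∞ := ∑' i, ENNReal.ofReal (A.τ (entry T i i)).re

/-- The inclusion `x ↦ x ⊗ e₀₀` of `M` in `M_∞` as a corner; `corner 1` is the unit `1_M` of `M`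
seen as a projection of `M_∞`.  Its inverse `(corner 1) M_∞ (corner 1) → M` is `entry · 0 0`. -/
def corner (x : A.Elt) : A.Amp :=
  ⟨(lp.singleContinuousLinearMap ℂ (fun _ : ℕ => A.Space) 2 0) ∘L (x : A.Space →L[ℂ] A.Space) ∘L
    (lp.evalCLM ℂ (fun _ : ℕ => A.Space) 2 0), by
    rw [mem_amplification_iff]
    intro i j
    by_cases h : i = 0 ∧ j = 0
    · obtain ⟨rfl, rfl⟩ := h
      refine (congrArg (· ∈ A.alg) (?_ : _ = (x : A.Space →L[ℂ] A.Space))).mpr x.2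
      ext v
      change lp.single (E := fun _ : ℕ => A.Space) 2 0 ((x : A.Space →L[ℂ] A.Space) (lp.single (E := fun _ : ℕ => A.Space) 2 0 v 0)) 0 = _
      rw [lp.single_apply_self, lp.single_apply_self]
    · refine (congrArg (· ∈ A.alg) (?_ : _ = (0 : A.Space →L[ℂ] A.Space))).mpr
        (zero_mem A.alg)
      ext v
      change lp.single (E := fun _ : ℕ => A.Space) 2 0 ((x : A.Space →L[ℂ] A.Space) (lp.single (E := fun _ : ℕ => A.Space) 2 j v 0)) i = 0
      by_cases hi : i = 0
      · have hj : 0 ≠ j := fun h' => h ⟨hi, h'.symm⟩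
        rw [lp.single_apply_ne _ _ _ hj, _root_.map_zero, lp.single_zero]
        rfl
      · rw [lp.single_apply_ne _ _ _ hi]⟩

end TracialVN

/-! ### Classes of tracial von Neumann algebras -/

/-- `C` is closed under (trace-preserving isomorphism and) passing to a von Neumann subalgebra
with the restricted trace: whatever embeds in a member of `C` by a unital trace-preserving
`*`-homomorphism is in `C`. -/
def ClosedUnderSubalgebras (C : Set TracialVN.{u}) : Prop :=
  ∀ A ∈ C, ∀ N : TracialVN.{u}, ∀ θ : N.Elt →⋆ₐ[ℂ] A.Elt, (∀ x, A.τ (θ x) = N.τ x) → N ∈ C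

/-- `N` is (isomorphic to) a dilation `P M_∞ P` of `(M, τ)`, where `P` is a projection of finite
trace containing the range of an isometry `w ∈ P M_∞ 1_M`, with the normalized trace
`τ_∞ / τ_∞(P)`. -/
def IsFiniteDilation (A N : TracialVN.{u}) : Prop :=
  ∃ (P w : A.Amp) (θ : N.Elt →⋆ₙₐ[ℂ] A.Amp),
    IsStarProjection P ∧ TracialVN.traceInf P ≠ ∞ ∧
    star w * w = TracialVN.corner 1 ∧ P * w = w ∧
    Function.Injective θ ∧ Set.range θ = {T | P * T * P = T} ∧
    ∀ x, HasSum (fun i => A.τ (TracialVN.entry (θ x) i i))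
      (((TracialVN.traceInf P).toReal : ℂ) * N.τ x)

/-- `C` is closed under the dilations `M ⇝ P M_∞ P` of finite trace. -/
def ClosedUnderDilations (C : Set TracialVN.{u}) : Prop :=
  ∀ A ∈ C, ∀ N : TracialVN.{u}, IsFiniteDilation A N → N ∈ C

/-! ### Flexible stability -/

section Stability

variable {G : Type v} [Group G] [MeasurableSpace G]

/-- The support of `μ` generates the (discrete) group `G`. -/
def GeneratingSupport (μ : Measure G) : Prop := Subgroup.closure {g : G | μ {g} ≠ 0} = ⊤

/-- `(ε, μ)`-almost homomorphisms `G → U(M)`. -/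
def IsAlmostHom (μ : Measure G) {A : TracialVN.{u}} (ε : ℝ) (φ : G → unitary A.Elt) : Prop :=
  ∫ g, ∫ h, TracialVN.normSq ((φ (g * h) : A.Elt) - (φ g : A.Elt) * (φ h : A.Elt)) ∂μ ∂μ ≤ ε

/-- `φ` is `d`-close to a compression of a unitary representation in a small dilation of `M`:
there are a projection `P ∈ M_∞`, a homomorphism `π : G → U(P M_∞ P)` and an isometry
`w ∈ P M_∞ 1_M` with `max (τ(P) - 1, ∫ ‖φ(g) - w* π(g) w‖₂² dμ(g)) ≤ d`. -/
def IsFlexiblyClose (μ : Measure G) {A : TracialVN.{u}} (d : ℝ) (φ : G → unitary A.Elt) : Prop :=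
  ∃ (P w : A.Amp) (π : G → A.Amp),
    IsStarProjection P ∧
    (∀ g, P * π g * P = π g ∧ star (π g) * π g = P ∧ π g * star (π g) = P) ∧
    (∀ g h, π (g * h) = π g * π h) ∧
    star w * w = TracialVN.corner 1 ∧ P * w = w ∧
    TracialVN.traceInf P ≤ ENNReal.ofReal (1 + d) ∧
    ∫ g, TracialVN.normSq ((φ g : A.Elt) - TracialVN.entry (star w * π g * w) 0 0) ∂μ ≤ d

/-- The function `δ : [0,4] → [0,4]` witnesses the `C`-flexible stability of `(G, μ)`. -/
structure IsFlexibleControl (C : Set TracialVN.{u}) (μ : Measure G) (δ : ℝ → ℝ) : Prop where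
  mapsTo : Set.MapsTo δ (Set.Icc 0 4) (Set.Icc 0 4)
  monotoneOn : MonotoneOn δ (Set.Icc 0 4)
  tendsto : Tendsto δ (𝓝[>] 0) (𝓝 0)
  close : ∀ ε ∈ Set.Icc (0 : ℝ) 4, ∀ A ∈ C, ∀ φ : G → unitary A.Elt,
    IsAlmostHom μ ε φ → IsFlexiblyClose μ (δ ε) φ

/-- `(G, μ)` is `C`-flexibly stable. -/
def IsFlexiblyStable (C : Set TracialVN.{u}) (μ : Measure G) : Prop :=
  ∃ δ : ℝ → ℝ, IsFlexibleControl C μ δ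

/-- `δ` is a modulus of `C`-flexible stability of `(G, μ)`. -/
structure IsFlexibleModulus (C : Set TracialVN.{u}) (μ : Measure G) (δ : ℝ → ℝ) : Prop extends
    IsFlexibleControl C μ δ where
  concaveOn : ConcaveOn ℝ (Set.Icc 0 4) δ
  map_four : δ 4 = 4

/-- The measure `(μ₁ ⊗ δ_1 + δ_1 ⊗ μ₂) / 2` on `G₁ × G₂`. -/
def averagedMeasure {G₁ : Type v} {G₂ : Type w} [Group G₁] [Group G₂] [MeasurableSpace G₁]
    [MeasurableSpace G₂] (μ₁ : Measure G₁) (μ₂ : Measure G₂) : Measure (G₁ × G₂) :=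
  (2⁻¹ : ℝ≥0∞) • (μ₁.prod (Measure.dirac 1) + (Measure.dirac 1).prod μ₂)

end Stability

/-! ### Unitary representations, spectral gap, property (T) -/

section Representations

variable {G : Type v} [Group G]
  {H : Type u} [NormedAddCommGroup H] [InnerProductSpace ℂ H] [CompleteSpace H]

/-- The space of invariant vectors of a unitary representation. -/
def invariantVectors (π : G →* unitary (H →L[ℂ] H)) : Submodule ℂ H :=
  ⨅ g, LinearMap.ker (((π g : H →L[ℂ] H) - 1 : H →L[ℂ] H) : H →ₗ[ℂ] H)

theorem mem_invariantVectors (π : G →* unitary (H →L[ℂ] H)) (ξ : H) :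
    ξ ∈ invariantVectors π ↔ ∀ g, (π g : H →L[ℂ] H) ξ = ξ := by
  simp [invariantVectors, sub_eq_zero]

instance (π : G →* unitary (H →L[ℂ] H)) : CompleteSpace (invariantVectors π) := by
  refine IsClosed.completeSpace_coe (hs := ?_)
  have : (invariantVectors π : Set H) = ⋂ g, {ξ | (π g : H →L[ℂ] H) ξ = ξ} := by
    ext ξ; simp [mem_invariantVectors]
  rw [this]
  exact isClosed_iInter fun g => isClosed_eq (π g : H →L[ℂ] H).continuous continuous_id

/-- The Poincaré inequality with constant `κ` for all unitary representations of `G`. -/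
def PoincareInequality [MeasurableSpace G] (μ : Measure G) (κ : ℝ) : Prop :=
  ∀ (H : Type u) [NormedAddCommGroup H] [InnerProductSpace ℂ H] [CompleteSpace H]
    (π : G →* unitary (H →L[ℂ] H)) (ξ : H),
    ‖ξ - (invariantVectors π).starProjection ξ‖ ^ 2 ≤
      κ / 2 * ∫ g, ‖(π g : H →L[ℂ] H) ξ - ξ‖ ^ 2 ∂μ

/-- The inverse `κ(μ) ∈ [0, ∞]` of the spectral gap of `μ`: the smallest constant in the Poincaré
inequality, and `∞` if `μ` has no spectral gap. -/
def spectralGapConst [MeasurableSpace G] (μ : Measure G) : ℝ≥0∞ :=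
  ⨅ (κ : ℝ≥0) (_ : PoincareInequality.{u, v} μ κ), (κ : ℝ≥0∞)

/-- Kazhdan's property (T) of a discrete group: there are a finite set `Q` and `ε > 0` such that
every unitary representation with a nonzero `(Q, ε)`-invariant vector has a nonzero invariant
vector.  Hilbert spaces in the lowest universe suffice, as we only consider countable groups, whose
cyclic representations are separable. -/
def HasPropertyT (G : Type v) [Group G] : Prop :=
  ∃ (Q : Finset G) (ε : ℝ), 0 < ε ∧
    ∀ (H : Type) [NormedAddCommGroup H] [InnerProductSpace ℂ H] [CompleteSpace H]
      (π : G →* unitary (H →L[ℂ] H)),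
      (∃ ξ : H, ξ ≠ 0 ∧ ∀ g ∈ Q, ‖(π g : H →L[ℂ] H) ξ - ξ‖ < ε * ‖ξ‖) →
      ∃ η : H, η ≠ 0 ∧ ∀ g, (π g : H →L[ℂ] H) η = η

end Representations

/-! ### Flexible Hilbert-Schmidt stability -/

section HilbertSchmidt

open Matrix

/-- The square of the normalized Hilbert-Schmidt norm, `‖X‖₂² = (1/d) Tr(X* X)`. -/
def hsNormSq {d : ℕ} (X : Matrix (Fin d) (Fin d) ℂ) : ℝ := (Matrix.trace (Xᴴ * X)).re / d

/-- `G` is flexibly Hilbert-Schmidt stable: every sequence of maps `φₙ : G → U(dₙ)` that is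
asymptotically multiplicative for `‖·‖₂`, pointwise on `G × G`, is pointwise asymptotic to
compressions of homomorphisms `πₙ : G → U(Dₙ)`, by isometries `ℂ^{dₙ} → ℂ^{Dₙ}`, with
`Dₙ / dₙ → 1`. -/
def FlexiblyHSStable (G : Type v) [Group G] : Prop :=
  ∀ (d : ℕ → ℕ), (∀ n, 0 < d n) → ∀ φ : (n : ℕ) → G → unitaryGroup (Fin (d n)) ℂ,
    (∀ g h, Tendsto (fun n => hsNormSq
      ((φ n (g * h) : Matrix (Fin (d n)) (Fin (d n)) ℂ) -
        (φ n g : Matrix (Fin (d n)) (Fin (d n)) ℂ) *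
          (φ n h : Matrix (Fin (d n)) (Fin (d n)) ℂ))) atTop (𝓝 0)) →
    ∃ (D : ℕ → ℕ) (π : (n : ℕ) → G →* unitaryGroup (Fin (D n)) ℂ)
      (W : (n : ℕ) → Matrix (Fin (D n)) (Fin (d n)) ℂ),
      (∀ n, (W n)ᴴ * W n = 1) ∧
      Tendsto (fun n => (D n : ℝ) / d n) atTop (𝓝 1) ∧
      ∀ g, Tendsto (fun n => hsNormSq
        ((φ n g : Matrix (Fin (d n)) (Fin (d n)) ℂ) -
          (W n)ᴴ * (π n g : Matrix (Fin (D n)) (Fin (D n)) ℂ) * W n)) atTop (𝓝 0)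

end HilbertSchmidt

end

/-! Product stability is proved by correcting the two factors one after the other. Let `φ` be almost
multiplicative on `G₁ × G₂`, and put `p g = φ (g, 1)`, `q h = φ (1, h)`. Stability of `G₁` gives a
representation `π` in a dilation `P M_∞ P` and an isometry `w` with `p ≈ w* π w`. The elements `w
q(h) w*` are contractions of `P M_∞ P` of almost full normalized 2-norm. They almost commute with
`π` in mean square, because `p` and `q` almost commute and `P - w w*` has small trace.

The spectral gap of `G₁`, applied to the conjugation representation on `L²`, shows that `w q(h) w*`
is close to its projection on the relative commutant `N = π(G₁)' ∩ P M_∞ P`. This projection is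
again a contraction of almost full 2-norm, so it is close to a unitary `u h` of `N`
(`exists_unitary_relCommutant`). The map `u` is almost multiplicative, and `N` is in the class
because the class is closed under dilations and subalgebras. Stability of `G₂` therefore gives a
representation `σ` in a dilation of `N`. The latter consists of matrices over the commutant of `π`,
so `π ⊗ 1` commutes with `σ`, and the product of the two is a representation of `G₁ × G₂` in a
dilation of a dilation of `M`, which sits in `M_∞` (`exists_ampEmbedding`,
`exists_iterated_dilation`). The quantitative outcome is `isFlexiblyClose_averagedMeasure`. For
moduli, concavity moves numerical factors outside `δ₁` and `δ₂`, and `κ ≥ 1/2` for a nontrivial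
group absorbs the additive constants.

For Hilbert–Schmidt stability the same scheme runs along a sequence of matrix algebras, property (T)
being a spectral gap over a finite set. Here the hypothesis on `H` concerns only full matrix
algebras, whereas the commutant of a representation of `G` is a direct sum of blocks `M_k ⊗ 1_m`,
some of which may carry a large defect. The remedy is a bound that is linear in the defect and holds
for every map, without smallness assumption (`exists_linear_bound`): such a bound can be summed over
the blocks (`exists_commuting_of_projection`). -/

noncomputable section

open ContinuousLinearMap (adjoint)

/-! ### The GNS representation of a tracial von Neumann algebra. -/

namespace TracialVN

/-- Norm closedness of a bicommutant makes `A.Elt` a C*-algebra, so that the GNS construction and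
the continuous functional calculus are available. -/
theorem isClosed_vonNeumannAlgebra {H : Type u} [NormedAddCommGroup H] [InnerProductSpace ℂ H]
    [CompleteSpace H] (M : VonNeumannAlgebra H) :
    IsClosed (M.toStarSubalgebra : Set (H →L[ℂ] H)) := by
  rw [VonNeumannAlgebra.coe_toStarSubalgebra, ← VonNeumannAlgebra.centralizer_centralizer M]
  exact Set.isClosed_centralizer _

instance (A : TracialVN.{u}) : IsClosed (A.alg.toStarSubalgebra : Set (A.Space →L[ℂ] A.Space)) :=
  isClosed_vonNeumannAlgebra A.alg

variable (A : TracialVN.{u})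

theorem exists_gns : ∃ (L : Type u) (_ : NormedAddCommGroup L) (_ : InnerProductSpace ℂ L)
    (_ : CompleteSpace L) (e : A.Elt →ₗ[ℂ] L) (l : A.Elt →⋆ₐ[ℂ] (L →L[ℂ] L)),
    DenseRange e ∧ (∀ x y, inner ℂ (e x) (e y) = A.τ (star x * y)) ∧
      ∀ a x, l a (e x) = e (a * x) := by
  let : PartialOrder A.Elt := CStarAlgebra.spectralOrder _
  have : StarOrderedRing A.Elt := CStarAlgebra.spectralOrderedRing _
  let f : A.Elt →ₚ[ℂ] ℂ := PositiveLinearMap.mk₀ A.τ fun x hx => by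
    obtain ⟨y, rfl⟩ := CStarAlgebra.nonneg_iff_eq_star_mul_self.1 hx
    exact A.nonneg y
  refine ⟨f.GNS, inferInstance, inferInstance, inferInstance,
    (UniformSpace.Completion.toComplL (𝕜 := ℂ) (E := f.PreGNS)).toLinearMap ∘ₗ f.toPreGNS.toLinearMap,
    f.gnsStarAlgHom, ?_, ?_, ?_⟩
  · exact UniformSpace.Completion.denseRange_coe.comp f.toPreGNS.surjective.denseRange
      (UniformSpace.Completion.continuous_coe _)
  · intro x y
    exact UniformSpace.Completion.inner_coe _ _
  · intro a x
    exact f.gnsNonUnitalStarAlgHom_apply_coe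
end TracialVN

/-- Half of the polarization identity: the discarded term is `‖a - b‖² / 4`. It lets a functional
given by two vectors be dominated by one given by their midpoint. -/
theorem re_inner_le_norm_half_add_sq {E : Type*} [NormedAddCommGroup E] [InnerProductSpace ℂ E]
    (a b : E) : (inner ℂ a b).re ≤ ‖(2⁻¹ : ℂ) • (a + b)‖ ^ 2 := by
  have h1 := norm_add_sq (𝕜 := ℂ) a b
  have h2 := norm_sub_sq (𝕜 := ℂ) a b
  have h3 : (0 : ℝ) ≤ ‖a - b‖ ^ 2 := by positivity
  simp only [RCLike.re_to_complex] at h1 h2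
  rw [norm_smul, mul_pow, norm_inv, Complex.norm_ofNat]
  linarith

/-- The square root is a limit of polynomials in `V* V`, so it inherits its commutant. -/
theorem exists_sqrt {E F : Type*} [NormedAddCommGroup E] [InnerProductSpace ℂ E] [CompleteSpace E]
    [NormedAddCommGroup F] [InnerProductSpace ℂ F] [CompleteSpace F] (V : E →L[ℂ] F) :
    ∃ S : E →L[ℂ] E, star S = S ∧ S * S = ContinuousLinearMap.adjoint V ∘L V ∧
      ∀ D, Commute (ContinuousLinearMap.adjoint V ∘L V) D → Commute S D := by
  have hpos : 0 ≤ ContinuousLinearMap.adjoint V ∘L V := by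
    rw [ContinuousLinearMap.nonneg_iff_isPositive]
    exact ContinuousLinearMap.isPositive_adjoint_comp_self V
  exact ⟨CFC.sqrt (ContinuousLinearMap.adjoint V ∘L V), (CFC.sqrt_nonneg _).isSelfAdjoint,
    CFC.sqrt_mul_sqrt_self _ hpos, fun D hD => hD.cfcₙ_nnreal _⟩

/-! ### Diagonal operators on `ℓ²(ℕ, H)`. -/

section Diag

set_option linter.unusedSectionVars false

variable {H : Type u} [NormedAddCommGroup H] [InnerProductSpace ℂ H] [CompleteSpace H]

/-- The operator `x ⊗ 1` on `ℓ²(ℕ, H)`. -/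
def diagOp (x : H →L[ℂ] H) : AmpSpace H →L[ℂ] AmpSpace H := (exists_diag x).choose

theorem diagOp_apply (x : H →L[ℂ] H) (f : AmpSpace H) (i : ℕ) : diagOp x f i = x (f i) :=
  (exists_diag x).choose_spec f i

theorem diagOp_mul (x y : H →L[ℂ] H) : diagOp (x * y) = diagOp x * diagOp y := by
  ext f i
  simp only [diagOp_apply, mul_apply_eq_comp]

theorem star_diagOp (x : H →L[ℂ] H) : star (diagOp x) = diagOp (star x) := by
  rw [ContinuousLinearMap.star_eq_adjoint, eq_comm, ContinuousLinearMap.eq_adjoint_iff]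
  intro f g
  rw [lp.inner_eq_tsum, lp.inner_eq_tsum]
  refine tsum_congr fun i => ?_
  rw [diagOp_apply, diagOp_apply, ContinuousLinearMap.star_eq_adjoint,
    ContinuousLinearMap.adjoint_inner_left]

theorem memℓp_two_of_summable {ι : Type*} {ξ : ι → H} (h : Summable fun i => ‖ξ i‖ ^ 2) :
    Memℓp ξ 2 := memℓp_gen (by simpa using h)

theorem summable_norm_sq (f : AmpSpace H) : Summable fun i => ‖f i‖ ^ 2 := by
  simpa using (lp.memℓp f).summable (by norm_num)

end Diag

/-! ### Normal traces as sums of vector states. -/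

namespace TracialVN

variable (A : TracialVN.{u})

/-- A normal tracial state is a sum of vector states. -/
theorem exists_vectorStates : ∃ ξ : ℕ → A.Space, (Summable fun n => ‖ξ n‖ ^ 2) ∧
    ∀ x : A.Elt, HasSum (fun n => inner ℂ (ξ n) ((x : A.Space →L[ℂ] A.Space) (ξ n))) (A.τ x) := by
  obtain ⟨ξ, η, hξ, hη, h⟩ := A.normal
  obtain ⟨L, _, _, _, e, l, hd, he, hl⟩ := A.exists_gns
  let ξ' : AmpSpace A.Space := ⟨ξ, memℓp_two_of_summable hξ⟩
  let η' : AmpSpace A.Space := ⟨η, memℓp_two_of_summable hη⟩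
  have hτ : ∀ x : A.Elt, A.τ x = inner ℂ η' (diagOp (x : A.Space →L[ℂ] A.Space) ξ') := fun x => by
    refine (h x).unique ?_
    have := lp.hasSum_inner (𝕜 := ℂ) η' (diagOp (x : A.Space →L[ℂ] A.Space) ξ')
    simp only [diagOp_apply] at this
    exact this
  -- Positivity of `τ` and polarization give `τ(x* x) = Re ⟨x η', x ξ'⟩ ≤ ‖x ζ‖²`, so the vector
  -- functional of the midpoint dominates `τ`.
  let ζ : AmpSpace A.Space := (2⁻¹ : ℂ) • (η' + ξ')
  let R : A.Elt →ₗ[ℂ] AmpSpace A.Space :=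
    { toFun := fun x => diagOp (x : A.Space →L[ℂ] A.Space) ζ
      map_add' := fun x y => by ext i; simp [diagOp_apply]
      map_smul' := fun c x => by ext i; simp [diagOp_apply] }
  have hR : ∀ x y : A.Elt, R (x * y) = diagOp (x : A.Space →L[ℂ] A.Space) (R y) := fun x y => by
    ext i; simp [R, diagOp_apply]
  have hb : ∀ x, ‖e x‖ ≤ 1 * ‖R x‖ := fun x => by
    rw [one_mul]
    refine (sq_le_sq₀ (norm_nonneg _) (norm_nonneg _)).1 ?_
    have h1 : ‖e x‖ ^ 2 = (A.τ (star x * x)).re := by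
      rw [← he, ← inner_self_eq_norm_sq (𝕜 := ℂ)]; rfl
    have h2 : R x = (2⁻¹ : ℂ) • (diagOp (x : A.Space →L[ℂ] A.Space) η' +
        diagOp (x : A.Space →L[ℂ] A.Space) ξ') := by
      simp [R, ζ]
    rw [h1, hτ, h2]
    refine le_of_eq_of_le ?_ (re_inner_le_norm_half_add_sq _ _)
    have : ((star x * x : A.Elt) : A.Space →L[ℂ] A.Space) =
      star (x : A.Space →L[ℂ] A.Space) * (x : A.Space →L[ℂ] A.Space) := rfl
    rw [this, diagOp_mul, ← star_diagOp, mul_apply_eq_comp, ContinuousLinearMap.star_eq_adjoint,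
      ContinuousLinearMap.adjoint_inner_right]
  -- By `hb`, `x ζ ↦ e x` extends to a contraction of the closed subspace generated by `ζ`. This
  -- subspace and its orthogonal complement are both invariant under `M ⊗ 1`, so extending by zero
  -- preserves the intertwining property.
  obtain ⟨V, hV, hcomm⟩ : ∃ V : AmpSpace A.Space →L[ℂ] L, (∀ x, V (R x) = e x) ∧
      ∀ a : A.Elt, V ∘L diagOp (a : A.Space →L[ℂ] A.Space) = l a ∘L V := by
    let K₀ : Submodule ℂ (AmpSpace A.Space) := (LinearMap.range R).topologicalClosure
    have hRK : ∀ x, R x ∈ K₀ := fun x =>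
      Submodule.le_topologicalClosure _ (LinearMap.mem_range_self R x)
    have : CompleteSpace K₀ := (Submodule.isClosed_topologicalClosure _).completeSpace_coe
    let R₀ : A.Elt →ₗ[ℂ] K₀ := R.codRestrict K₀ hRK
    have hR₀ : DenseRange R₀ := by
      intro x
      rw [closure_subtype]
      refine closure_mono ?_ x.2
      rintro _ ⟨y, rfl⟩
      exact ⟨R₀ y, ⟨y, rfl⟩, rfl⟩
    let V₀ : K₀ →L[ℂ] L := e.extendOfNorm R₀
    have hV₀ : ∀ x, V₀ (R₀ x) = e x := LinearMap.extendOfNorm_eq hR₀ ⟨1, hb⟩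
    let V : AmpSpace A.Space →L[ℂ] L := V₀ ∘L K₀.orthogonalProjectionOnto
    have hV : ∀ x, V (R x) = e x := fun x => by
      rw [← hV₀]
      exact congrArg V₀ (Submodule.orthogonalProjectionOnto_mem_subspace_eq_self (R₀ x))
    have hV' : ∀ k ∈ K₀ᗮ, V k = 0 := fun k hk => by
      change V₀ (K₀.orthogonalProjectionOnto k) = 0
      rw [Submodule.orthogonalProjectionOnto_eq_zero_iff.2 hk, _root_.map_zero]
    have hinv : ∀ a : A.Elt, ∀ k ∈ K₀, diagOp (a : A.Space →L[ℂ] A.Space) k ∈ K₀ := by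
      intro a k hk
      refine map_mem_closure (diagOp (a : A.Space →L[ℂ] A.Space)).continuous hk ?_
      rintro _ ⟨y, rfl⟩
      exact ⟨a * y, hR a y⟩
    have hinv' : ∀ a : A.Elt, ∀ k ∈ K₀ᗮ, diagOp (a : A.Space →L[ℂ] A.Space) k ∈ K₀ᗮ := by
      intro a k hk
      rw [Submodule.mem_orthogonal] at hk ⊢
      intro m hm
      have := hk _ (hinv (star a) m hm)
      change inner ℂ (diagOp (star (a : A.Space →L[ℂ] A.Space)) m) k = 0 at this
      rwa [← star_diagOp, ContinuousLinearMap.star_eq_adjoint,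
        ContinuousLinearMap.adjoint_inner_left] at this
    have hcomm : ∀ a : A.Elt, V ∘L diagOp (a : A.Space →L[ℂ] A.Space) = l a ∘L V := by
      intro a
      have hK : ∀ k ∈ K₀, V (diagOp (a : A.Space →L[ℂ] A.Space) k) = l a (V k) := by
        intro k hk
        refine closure_minimal (s := (LinearMap.range R : Set (AmpSpace A.Space)))
          (t := {k | V (diagOp (a : A.Space →L[ℂ] A.Space) k) = l a (V k)}) ?_
          (isClosed_eq (by fun_prop) (by fun_prop)) hk
        rintro _ ⟨y, rfl⟩
        change V (diagOp (a : A.Space →L[ℂ] A.Space) (R y)) = l a (V (R y))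
        rw [← hR, hV, hV, hl]
      ext k
      obtain ⟨k₁, h₁, k₂, h₂, rfl⟩ := K₀.exists_add_mem_mem_orthogonal k
      simp only [ContinuousLinearMap.comp_apply, map_add]
      rw [hK k₁ h₁, hV' k₂ h₂, hV' _ (hinv' a k₂ h₂), _root_.map_zero]
    exact ⟨V, hV, hcomm⟩
  let T := ContinuousLinearMap.adjoint V ∘L V
  have hT : ∀ a : A.Elt, Commute T (diagOp (a : A.Space →L[ℂ] A.Space)) := by
    intro a
    have h1 := congrArg ContinuousLinearMap.adjoint (hcomm (star a))
    rw [ContinuousLinearMap.adjoint_comp, ContinuousLinearMap.adjoint_comp, map_star,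
      ContinuousLinearMap.star_eq_adjoint (l a),
      ContinuousLinearMap.adjoint_adjoint] at h1
    have h2 : ContinuousLinearMap.adjoint (diagOp ((star a : A.Elt) : A.Space →L[ℂ] A.Space)) =
        diagOp (a : A.Space →L[ℂ] A.Space) := by
      rw [← ContinuousLinearMap.star_eq_adjoint, star_diagOp]
      change diagOp (star (star (a : A.Space →L[ℂ] A.Space))) = _
      rw [star_star]
    rw [h2] at h1
    change T ∘L _ = _ ∘L T
    rw [ContinuousLinearMap.comp_assoc, hcomm, ← ContinuousLinearMap.comp_assoc, ← h1,
      ContinuousLinearMap.comp_assoc]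
  -- `V* V` commutes with `M ⊗ 1`, hence so does its square root `S`. Then `τ x = ⟨V ζ, V x ζ⟩ = ⟨S
  -- ζ, x S ζ⟩`, and the coordinates of `S ζ` are the required vectors.
  obtain ⟨S, hSs, hS, hS'⟩ := exists_sqrt V
  have hSc : ∀ a : A.Elt, Commute S (diagOp (a : A.Space →L[ℂ] A.Space)) := fun a => hS' _ (hT a)
  refine ⟨fun n => S ζ n, summable_norm_sq _, fun x => ?_⟩
  have key : A.τ x = inner ℂ (S ζ) (diagOp (x : A.Space →L[ℂ] A.Space) (S ζ)) := by
    have h1 : R 1 = ζ := by ext i; simp [R, diagOp_apply]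
    have h2 : A.τ x = inner ℂ (V ζ) (V (R x)) := by
      rw [← h1, hV, hV, he]; simp
    have h3 : diagOp (x : A.Space →L[ℂ] A.Space) (S ζ) =
        S (diagOp (x : A.Space →L[ℂ] A.Space) ζ) :=
      (congrArg (fun U => U ζ) (hSc x).eq).symm
    rw [h3, ← ContinuousLinearMap.adjoint_inner_right, ← ContinuousLinearMap.star_eq_adjoint, hSs,
      h2, ← ContinuousLinearMap.adjoint_inner_right]
    congr 1
    exact (congrArg (fun U : AmpSpace A.Space →L[ℂ] AmpSpace A.Space => U (R x)) hS).symm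
  rw [key]
  have := lp.hasSum_inner (𝕜 := ℂ) (S ζ) (diagOp (x : A.Space →L[ℂ] A.Space) (S ζ))
  simp only [diagOp_apply] at this
  exact this

end TracialVN

/-! ### Unitary representations and projections to the invariant vectors. -/

section UnitaryRep

variable {G : Type v} [Group G]
  {E : Type u} [NormedAddCommGroup E] [InnerProductSpace ℂ E] [CompleteSpace E]

/-- The unitary representation given by a multiplicative family of isometric operators. -/
def unitaryRep (U : G → E →L[ℂ] E) (h1 : U 1 = 1) (hmul : ∀ g h, U (g * h) = U g * U h)
    (hnorm : ∀ g x, ‖U g x‖ = ‖x‖) : G →* unitary (E →L[ℂ] E) where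
  toFun g := ⟨U g, by
    have h2 : star (U g) * U g = 1 := (ContinuousLinearMap.norm_map_iff_adjoint_comp_self _).1 (hnorm g)
    have h3 : U g * U g⁻¹ = 1 := by rw [← hmul, mul_inv_cancel, h1]
    refine Unitary.mem_iff.2 ⟨h2, ?_⟩
    rw [left_inv_eq_right_inv h2 h3, h3]⟩
  map_one' := Subtype.ext h1
  map_mul' g h := Subtype.ext (hmul g h)

theorem norm_unitary_apply (U : unitary (E →L[ℂ] E)) (x : E) : ‖(U : E →L[ℂ] E) x‖ = ‖x‖ :=
  (ContinuousLinearMap.norm_map_iff_adjoint_comp_self _).2 (Unitary.coe_star_mul_self U) x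

theorem inner_unitary_apply (U : unitary (E →L[ℂ] E)) (x y : E) :
    inner ℂ ((U : E →L[ℂ] E) x) ((U : E →L[ℂ] E) y) = inner ℂ x y :=
  ((ContinuousLinearMap.inner_map_map_iff_adjoint_comp_self _).2 (Unitary.coe_star_mul_self U)) x y

/-- The projection of a vector to the invariant vectors is a limit of convex combinations of its
translates. -/
theorem starProjection_invariantVectors_mem_closure (π : G →* unitary (E →L[ℂ] E)) (ξ : E) :
    (invariantVectors π).starProjection ξ ∈
      closure (convexHull ℝ (Set.range fun g => (π g : E →L[ℂ] E) ξ)) := by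
  let : InnerProductSpace ℝ E := InnerProductSpace.rclikeToReal ℂ E
  let O : Set E := Set.range fun g => (π g : E →L[ℂ] E) ξ
  let S : Set E := closure (convexHull ℝ O)
  have hconv : Convex ℝ S := (convex_convexHull ℝ O).closure
  have hξ : ξ ∈ S := subset_closure (subset_convexHull ℝ _ ⟨1, by simp⟩)
  -- The point of least norm of the closed convex hull of the orbit. The hull is invariant, so
  -- comparing `y` with its translates, which have the same norm, forces `y` to be invariant.
  obtain ⟨y, hy, hmin⟩ := exists_norm_eq_iInf_of_complete_convex ⟨ξ, hξ⟩
    isClosed_closure.isComplete hconv 0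
  have hvar := (norm_eq_iInf_iff_real_inner_le_zero hconv hy).1 hmin
  have hinv : ∀ g, ∀ z ∈ S, (π g : E →L[ℂ] E) z ∈ S := by
    intro g z hz
    refine map_mem_closure (π g : E →L[ℂ] E).continuous hz ?_
    intro z hz
    have h1 := (((π g : E →L[ℂ] E) : E →ₗ[ℂ] E).restrictScalars ℝ).image_convexHull O
    have h2 : (π g : E →L[ℂ] E) z ∈ convexHull ℝ
        ((((π g : E →L[ℂ] E) : E →ₗ[ℂ] E).restrictScalars ℝ) '' O) := h1 ▸ ⟨z, hz, rfl⟩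
    refine convexHull_mono ?_ h2
    rintro _ ⟨_, ⟨h, rfl⟩, rfl⟩
    exact ⟨g * h, by simp⟩
  have hyinv : y ∈ invariantVectors π := by
    rw [mem_invariantVectors]
    intro g
    have h1 := hvar _ (hinv g y hy)
    have h2 : ‖(π g : E →L[ℂ] E) y‖ = ‖y‖ := norm_unitary_apply _ _
    have h3 := norm_add_sq_real y ((π g : E →L[ℂ] E) y - y)
    rw [zero_sub, inner_neg_left] at h1
    rw [add_sub_cancel, h2] at h3
    have h4 : ‖(π g : E →L[ℂ] E) y - y‖ ^ 2 ≤ 0 := by linarith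
    exact sub_eq_zero.1 (norm_eq_zero.1 (pow_eq_zero_iff two_ne_zero |>.1 (le_antisymm h4 (by positivity))))
  -- An invariant vector has the same inner product with every point of the orbit, hence of the
  -- hull; so `ξ - y` is orthogonal to the invariant vectors.
  have horth : ∀ z ∈ S, ∀ v ∈ invariantVectors π, inner ℂ v z = inner ℂ v ξ := by
    intro z hz v hv
    rw [mem_invariantVectors] at hv
    refine closure_minimal (s := convexHull ℝ O) (t := {z | inner ℂ v z = inner ℂ v ξ}) ?_
      (isClosed_eq (by fun_prop) (by fun_prop)) hz
    refine convexHull_min ?_ ?_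
    · rintro _ ⟨g, rfl⟩
      change inner ℂ v ((π g : E →L[ℂ] E) ξ) = _
      conv_lhs => rw [← hv g]
      exact inner_unitary_apply _ _ _
    · intro a ha b hb s t _ _ hst
      change inner ℂ v (s • a + t • b) = _
      have ha' : inner ℂ v a = inner ℂ v ξ := ha
      have hb' : inner ℂ v b = inner ℂ v ξ := hb
      rw [inner_add_right, inner_smul_right_eq_smul, inner_smul_right_eq_smul, ha', hb', ← add_smul,
        hst, one_smul]
  have : (invariantVectors π).starProjection ξ = y := by
    refine Submodule.eq_starProjection_of_mem_of_inner_eq_zero hyinv fun v hv => ?_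
    rw [inner_sub_left, sub_eq_zero, ← inner_conj_symm, ← inner_conj_symm y, horth y hy v hv]
  rw [this]
  exact hy

end UnitaryRep

/-! ### Weak compactness of the unit ball of a von Neumann algebra. -/

section WeakLimit

variable {H : Type u} [NormedAddCommGroup H] [InnerProductSpace ℂ H] [CompleteSpace H]

/-- A sequence in the unit ball of a von Neumann algebra converges in the weak operator topology
along an ultrafilter. -/
theorem exists_weak_limit (M : VonNeumannAlgebra H) (U : Ultrafilter ℕ) (Y : ℕ → H →L[ℂ] H)
    (hM : ∀ n, Y n ∈ M) (hY : ∀ n, ‖Y n‖ ≤ 1) :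
    ∃ Z ∈ M, ‖Z‖ ≤ 1 ∧ ∀ a b, Tendsto (fun n => inner ℂ a (Y n b)) U (𝓝 (inner ℂ a (Z b))) := by
  have hbd : ∀ a b n, ‖inner ℂ (Y n a) b‖ ≤ 1 * ‖a‖ * ‖b‖ := fun a b n =>
    (norm_inner_le_norm _ _).trans (by gcongr; exact (Y n).le_of_opNorm_le (hY n) a)
  have hex : ∀ a b, ∃ c : ℂ, ‖c‖ ≤ 1 * ‖a‖ * ‖b‖ ∧ Tendsto (fun n => inner ℂ (Y n a) b) U (𝓝 c) := by
    intro a b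
    obtain ⟨c, hc, h⟩ := (isCompact_closedBall (0 : ℂ) (1 * ‖a‖ * ‖b‖)).ultrafilter_le_nhds
      (U.map fun n => inner ℂ (Y n a) b) (by
        rw [Ultrafilter.coe_map, Filter.le_principal_iff, Filter.mem_map]
        exact Filter.univ_mem' fun n => mem_closedBall_zero_iff.2 (hbd a b n))
    exact ⟨c, mem_closedBall_zero_iff.1 hc, h⟩
  choose f hf hlim using hex
  let B : H →ₗ⋆[ℂ] H →ₗ[ℂ] ℂ := LinearMap.mk₂'ₛₗ (starRingEnd ℂ) (RingHom.id ℂ) f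
    (fun a a' b => tendsto_nhds_unique (hlim _ _) (by
      simpa only [map_add, inner_add_left] using (hlim a b).add (hlim a' b)))
    (fun c a b => tendsto_nhds_unique (hlim _ _) (by
      simpa only [map_smul, inner_smul_left, smul_eq_mul] using (hlim a b).const_mul (starRingEnd ℂ c)))
    (fun a b b' => tendsto_nhds_unique (hlim _ _) (by
      simpa only [inner_add_right] using (hlim a b).add (hlim a b')))
    (fun c a b => tendsto_nhds_unique (hlim _ _) (by
      simpa only [inner_smul_right, smul_eq_mul, RingHom.id_apply] using (hlim a b).const_mul c))
  let B' : H →L⋆[ℂ] H →L[ℂ] ℂ := B.mkContinuous₂ 1 hf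
  let Z := InnerProductSpace.continuousLinearMapOfBilin B'
  have hZ : ∀ a b, inner ℂ (Z a) b = f a b := fun a b =>
    InnerProductSpace.continuousLinearMapOfBilin_apply B' a b
  have hZlim : ∀ a b, Tendsto (fun n => inner ℂ a (Y n b)) U (𝓝 (inner ℂ a (Z b))) := by
    intro a b
    have := (Complex.continuous_conj.tendsto _).comp (hlim b a)
    rw [← hZ, inner_conj_symm] at this
    refine this.congr fun n => ?_
    exact inner_conj_symm _ _
  refine ⟨Z, ?_, ?_, hZlim⟩
  · rw [← VonNeumannAlgebra.commutant_commutant M, VonNeumannAlgebra.mem_commutant_iff]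
    intro x hx
    ext b
    refine ext_inner_left ℂ fun a => ?_
    simp only [mul_apply_eq_comp]
    refine tendsto_nhds_unique ?_ (hZlim a (x b))
    rw [← ContinuousLinearMap.adjoint_inner_left]
    refine (hZlim (ContinuousLinearMap.adjoint x a) b).congr fun n => ?_
    rw [ContinuousLinearMap.adjoint_inner_left]
    have := VonNeumannAlgebra.mem_commutant_iff.1 hx _ (hM n)
    exact congrArg (fun T : H →L[ℂ] H => inner ℂ a (T b)) this.symm
  · refine ContinuousLinearMap.opNorm_le_bound _ zero_le_one fun a => ?_
    by_cases h0 : Z a = 0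
    · rw [h0, norm_zero]; positivity
    have h1 := hf a (Z a)
    rw [← hZ, inner_self_eq_norm_sq_to_K, norm_pow, RCLike.norm_ofReal, abs_norm, sq] at h1
    exact le_of_mul_le_mul_right h1 (norm_pos_iff.2 h0)

end WeakLimit

/-! ### The 2-norm, and projections to the commutant of a group of unitaries. -/

namespace TracialVN

variable {A : TracialVN.{u}}

theorem τ_star (x : A.Elt) : A.τ (star x) = star (A.τ x) := by
  obtain ⟨L, _, _, _, e, l, hd, he, hl⟩ := A.exists_gns
  have h1 := he x 1
  have h2 := he 1 x
  rw [mul_one] at h1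
  rw [star_one, one_mul] at h2
  rw [← h1, ← h2]
  exact (inner_conj_symm _ _).symm

theorem coe_normSq (x : A.Elt) : ((normSq x : ℝ) : ℂ) = A.τ (star x * x) :=
  (Complex.eq_re_of_ofReal_le (r := 0) (by rw [Complex.ofReal_zero]; exact A.nonneg x)).symm

theorem normSq_nonneg (x : A.Elt) : 0 ≤ normSq x := (Complex.nonneg_iff.1 (A.nonneg x)).1

theorem normSq_eq_zero {x : A.Elt} (h : normSq x = 0) : x = 0 :=
  A.faithful x (by rw [← coe_normSq, h, Complex.ofReal_zero])

theorem normSq_star (x : A.Elt) : normSq (star x) = normSq x := by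
  rw [normSq, star_star, A.tracial]; rfl

theorem normSq_neg (x : A.Elt) : normSq (-x) = normSq x := by simp [normSq]

theorem normSq_sub_comm (x y : A.Elt) : normSq (x - y) = normSq (y - x) := by
  rw [← normSq_neg, neg_sub]

theorem normSq_one : normSq (1 : A.Elt) = 1 := by simp [normSq, A.map_one]

theorem normSq_zero : normSq (0 : A.Elt) = 0 := by simp [normSq]

theorem normSq_unitary_mul {u : A.Elt} (hu : u ∈ unitary A.Elt) (x : A.Elt) :
    normSq (u * x) = normSq x := by
  rw [normSq, star_mul, mul_assoc, ← mul_assoc (star u), Unitary.star_mul_self_of_mem hu, one_mul]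
  rfl

theorem normSq_mul_unitary {u : A.Elt} (hu : u ∈ unitary A.Elt) (x : A.Elt) :
    normSq (x * u) = normSq x := by
  rw [← normSq_star, star_mul, normSq_unitary_mul (Unitary.star_mem hu), normSq_star]

theorem normSq_unitary {u : A.Elt} (hu : u ∈ unitary A.Elt) : normSq u = 1 := by
  rw [← mul_one u, normSq_unitary_mul hu, normSq_one]

theorem normSq_eq_norm_sq {L : Type*} [NormedAddCommGroup L] [InnerProductSpace ℂ L]
    {e : A.Elt →ₗ[ℂ] L} (he : ∀ x y, inner ℂ (e x) (e y) = A.τ (star x * y)) (x : A.Elt) :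
    normSq x = ‖e x‖ ^ 2 := by
  rw [normSq, ← he, ← inner_self_eq_norm_sq (𝕜 := ℂ)]; rfl

theorem normSq_mul_le (a x : A.Elt) : normSq (a * x) ≤ ‖a‖ ^ 2 * normSq x := by
  obtain ⟨L, _, _, _, e, l, hd, he, hl⟩ := A.exists_gns
  rw [normSq_eq_norm_sq he, normSq_eq_norm_sq he, ← hl, ← mul_pow]
  gcongr
  exact (l a).le_of_opNorm_le (NonUnitalStarAlgHom.norm_apply_le l a) _

theorem normSq_le (x : A.Elt) : normSq x ≤ ‖x‖ ^ 2 := by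
  simpa [normSq_one] using normSq_mul_le x 1

theorem normSq_add_le (x y : A.Elt) : normSq (x + y) ≤ 2 * normSq x + 2 * normSq y := by
  obtain ⟨L, _, _, _, e, l, hd, he, hl⟩ := A.exists_gns
  rw [normSq_eq_norm_sq he, normSq_eq_norm_sq he, normSq_eq_norm_sq he, _root_.map_add]
  have := parallelogram_law_with_norm ℂ (e x) (e y)
  nlinarith [sq_nonneg ‖e x - e y‖]

theorem normSq_sub_le (x y z : A.Elt) :
    normSq (x - z) ≤ 2 * normSq (x - y) + 2 * normSq (y - z) := by
  simpa using normSq_add_le (x - y) (y - z)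

/-- The conjugation representation on `L²(M, τ)` of a group of unitaries of `M`: the projection to
the invariant vectors maps the unit ball of `M` to the unit ball of the commutant. -/
theorem exists_commutant_projection {G : Type v} [Group G] (ρ : G →* unitary A.Elt) (X : A.Elt)
    (hX : ‖X‖ ≤ 1) :
    ∃ (L : Type u) (_ : NormedAddCommGroup L) (_ : InnerProductSpace ℂ L) (_ : CompleteSpace L)
      (e : A.Elt →ₗ[ℂ] L) (σ : G →* unitary (L →L[ℂ] L)) (Y : A.Elt),
      (∀ x y, inner ℂ (e x) (e y) = A.τ (star x * y)) ∧
      (∀ g x, (σ g : L →L[ℂ] L) (e x) = e (ρ g * x * star (ρ g : A.Elt))) ∧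
      ‖Y‖ ≤ 1 ∧ (∀ g, (ρ g : A.Elt) * Y = Y * ρ g) ∧
      e Y = (invariantVectors σ).starProjection (e X) := by
  obtain ⟨L, _, _, _, e, l, hd, he, hl⟩ := A.exists_gns
  let c : G → A.Elt →ₗ[ℂ] A.Elt := fun g =>
    { toFun := fun x => ρ g * x * star (ρ g : A.Elt)
      map_add' := fun x y => by rw [mul_add, add_mul]
      map_smul' := fun r x => by simp }
  have hc : ∀ g x, ‖e (c g x)‖ = ‖e x‖ := fun g x => by
    refine (sq_eq_sq₀ (norm_nonneg _) (norm_nonneg _)).1 ?_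
    rw [← normSq_eq_norm_sq he, ← normSq_eq_norm_sq he]
    exact (normSq_mul_unitary (Unitary.star_mem (ρ g).2) _).trans (normSq_unitary_mul (ρ g).2 _)
  let V : G → L →L[ℂ] L := fun g => (e ∘ₗ c g).extendOfNorm e
  have hV : ∀ g x, V g (e x) = e (c g x) := fun g =>
    LinearMap.extendOfNorm_eq hd ⟨1, fun x => by simpa using (hc g x).le⟩
  have hext : ∀ S T : L →L[ℂ] L, (∀ x, S (e x) = T (e x)) → S = T := fun S T h =>
    DFunLike.coe_injective (hd.equalizer S.continuous T.continuous (funext h))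
  let σ : G →* unitary (L →L[ℂ] L) := unitaryRep V
    (hext _ _ fun x => by rw [hV]; simp [c])
    (fun g h => hext _ _ fun x => by
      rw [mul_apply_eq_comp, hV, hV, hV]; simp [c, mul_assoc])
    (fun g x => by
      refine hd.induction_on (p := fun x => ‖V g x‖ = ‖x‖) x
        (isClosed_eq (by fun_prop) (by fun_prop)) fun x => ?_
      rw [hV, hc])
  have hσ : ∀ g x, (σ g : L →L[ℂ] L) (e x) = e (ρ g * x * star (ρ g : A.Elt)) := hV
  let O : Set A.Elt := Set.range fun g => c g X
  -- The projection is a 2-norm limit of convex combinations of conjugates of `X`, all of operator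
  -- norm at most one. A weak operator limit of these then represents it by an element of the unit
  -- ball of `M`.
  have hmem : (invariantVectors σ).starProjection (e X) ∈ closure (e '' convexHull ℝ O) := by
    have h1 := starProjection_invariantVectors_mem_closure σ (e X)
    have h2 := (e.restrictScalars ℝ).image_convexHull O
    have h3 : e '' convexHull ℝ O = convexHull ℝ (e '' O) := h2
    rw [h3, ← Set.range_comp]
    convert h1 using 4
    ext g
    exact (hσ g X).symm
  have hO : ∀ y ∈ convexHull ℝ O, ‖y‖ ≤ 1 := by
    intro y hy
    refine mem_closedBall_zero_iff.1 (convexHull_min (t := Metric.closedBall (0 : A.Elt) 1) ?_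
      (convex_closedBall _ _) hy)
    rintro _ ⟨g, rfl⟩
    rw [mem_closedBall_zero_iff]
    refine (norm_mul_le _ _).trans ?_
    refine (mul_le_mul_of_nonneg_right (norm_mul_le _ _) (norm_nonneg _)).trans ?_
    have h1 : ‖(ρ g : A.Elt)‖ ≤ 1 := by
      have : Nontrivial A.Elt := ⟨1, 0, fun h => by simpa [A.map_one] using congrArg A.τ h⟩
      exact (CStarRing.norm_of_mem_unitary (ρ g).2).le
    rw [norm_star]
    calc _ ≤ (1 : ℝ) * 1 * 1 := by gcongr
      _ = 1 := by norm_num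
  obtain ⟨s, hs, hlim⟩ := mem_closure_iff_seq_limit.1 hmem
  choose Y hY hYe using hs
  let U : Ultrafilter ℕ := Filter.hyperfilter ℕ
  obtain ⟨Z, hZM, hZ, hZlim⟩ := exists_weak_limit A.alg U (fun n => (Y n : A.Space →L[ℂ] A.Space))
    (fun n => (Y n).2) (fun n => hO _ (hY n))
  have hUat : (U : Filter ℕ) ≤ atTop := by
    rw [← Nat.cofinite_eq_atTop]; exact Filter.hyperfilter_le_cofinite
  obtain ⟨ξ, hξ, hτ⟩ := A.exists_vectorStates
  -- Weak operator convergence tests one pair of vectors at a time. Normality is what carries it to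
  -- `τ`: the series of vector states is dominated by `‖x‖ ‖ξ n‖²`, uniformly in the sequence.
  have hτlim : ∀ x : A.Elt, Tendsto (fun n => A.τ (x * Y n)) U (𝓝 (A.τ (x * ⟨Z, hZM⟩))) := by
    intro x
    rw [← (hτ _).tsum_eq]
    simp_rw [fun n => ((hτ (x * Y n)).tsum_eq).symm]
    refine tendsto_tsum_of_dominated_convergence (bound := fun n => ‖x‖ * ‖ξ n‖ ^ 2)
      (hξ.mul_left _) (fun k => ?_) (Eventually.of_forall fun n k => ?_)
    · have := hZlim (ContinuousLinearMap.adjoint (x : A.Space →L[ℂ] A.Space) (ξ k)) (ξ k)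
      simp only [ContinuousLinearMap.adjoint_inner_left] at this
      exact this
    · refine (norm_inner_le_norm _ _).trans ?_
      have h1 : ‖x * Y n‖ ≤ ‖x‖ := (norm_mul_le _ _).trans
        (mul_le_of_le_one_right (norm_nonneg _) (hO _ (hY n)))
      have h2 : ‖((x * Y n : A.Elt) : A.Space →L[ℂ] A.Space) (ξ k)‖ ≤ ‖x‖ * ‖ξ k‖ :=
        ContinuousLinearMap.le_of_opNorm_le _ h1 _
      nlinarith [norm_nonneg (ξ k)]
  have heZ : e ⟨Z, hZM⟩ = (invariantVectors σ).starProjection (e X) := by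
    refine ext_inner_left ℂ fun v => hd.induction_on
      (p := fun v => inner ℂ v (e ⟨Z, hZM⟩) =
        inner ℂ v ((invariantVectors σ).starProjection (e X))) v
      (isClosed_eq (by fun_prop) (by fun_prop)) fun x => ?_
    rw [he]
    refine tendsto_nhds_unique (hτlim (star x)) ?_
    simp_rw [← he, hYe]
    exact (tendsto_const_nhds.inner hlim).mono_left hUat
  refine ⟨L, inferInstance, inferInstance, inferInstance, e, σ, ⟨Z, hZM⟩, he, hσ, hZ, fun g => ?_, heZ⟩
  have h1 : (σ g : L →L[ℂ] L) (e ⟨Z, hZM⟩) = e ⟨Z, hZM⟩ := by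
    have := ((invariantVectors σ).starProjection_apply_mem (e X))
    rw [mem_invariantVectors] at this
    rw [heZ]; exact this g
  rw [hσ] at h1
  have h2 : (ρ g : A.Elt) * ⟨Z, hZM⟩ * star (ρ g : A.Elt) = ⟨Z, hZM⟩ := by
    rw [← sub_eq_zero]
    refine normSq_eq_zero ?_
    rw [normSq_eq_norm_sq he, _root_.map_sub, h1, sub_self, norm_zero]
    norm_num
  calc (ρ g : A.Elt) * ⟨Z, hZM⟩ = (ρ g : A.Elt) * ⟨Z, hZM⟩ * (star (ρ g : A.Elt) * ρ g) := by
        rw [Unitary.coe_star_mul_self, mul_one]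
    _ = _ := by rw [← mul_assoc, h2]

end TracialVN

/-! ### Approximation of contractions by unitaries. -/

/-- Take `r = √(1 - a²)`. The estimate is `1 - √(1 - x²) ≤ x²` on the spectrum; being quadratic in
`a`, it makes `r` negligible in first-order perturbations. -/
theorem exists_self_add_I_smul_mem_unitary {A : Type*} [CStarAlgebra A] {a : A}
    (ha : IsSelfAdjoint a) (h1 : ‖a‖ ≤ 1) :
    ∃ r : A, IsSelfAdjoint r ∧ ‖1 - r‖ ≤ ‖a‖ ^ 2 ∧ a + Complex.I • r ∈ unitary A := by
  let : PartialOrder A := CStarAlgebra.spectralOrder _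
  have : StarOrderedRing A := CStarAlgebra.spectralOrderedRing _
  obtain _ | _ := subsingleton_or_nontrivial A
  · exact ⟨0, .zero _, by simp [Subsingleton.elim (1 : A) 0],
      Subsingleton.elim (1 : A) (a + Complex.I • (0 : A)) ▸ one_mem (unitary A)⟩
  refine ⟨CFC.sqrt (1 - a ^ 2), (CFC.sqrt_nonneg _).isSelfAdjoint, ?_,
    ha.self_add_I_smul_cfcSqrt_sub_sq_mem_unitary a h1⟩
  have hnn : 0 ≤ 1 - a ^ 2 := by
    rwa [sub_nonneg, ← CStarAlgebra.norm_le_one_iff_of_nonneg (a ^ 2), sq, ha.norm_mul_self,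
      sq_le_one_iff₀ (by positivity)]
  have h2 : CFC.sqrt (1 - a ^ 2) = cfc (fun x : ℝ => √(1 - x ^ 2)) a := by
    rw [CFC.sqrt_eq_real_sqrt (1 - a ^ 2) hnn, cfcₙ_eq_cfc, cfc_comp' (√·) (1 - · ^ 2) a,
      cfc_sub .., cfc_pow .., cfc_const_one .., cfc_id' ..]
  have h3 : 1 - CFC.sqrt (1 - a ^ 2) = cfc (fun x : ℝ => 1 - √(1 - x ^ 2)) a := by
    rw [h2, cfc_sub .., cfc_const_one ..]
  rw [h3]
  refine norm_cfc_le (by positivity) fun x hx => ?_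
  have hx1 : x ^ 2 ≤ ‖a‖ ^ 2 := by
    have := spectrum.norm_le_norm_of_mem hx
    rw [Real.norm_eq_abs] at this
    rw [← sq_abs]; gcongr
  have hx2 : x ^ 2 ≤ 1 := hx1.trans (pow_le_one₀ (norm_nonneg _) h1)
  have h4 : 1 - x ^ 2 ≤ √(1 - x ^ 2) := Real.le_sqrt_of_sq_le (by nlinarith [sq_nonneg x])
  have h5 : √(1 - x ^ 2) ≤ 1 := Real.sqrt_le_one.2 (by nlinarith [sq_nonneg x])
  rw [Real.norm_eq_abs, abs_le]
  constructor <;> linarith [sq_nonneg x]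

theorem exists_one_sub_star_mul_self {A : Type*} [CStarAlgebra A] {y : A} (hy : ‖y‖ ≤ 1) :
    ∃ b, 1 - star y * y = star b * b := by
  let : PartialOrder A := CStarAlgebra.spectralOrder _
  have : StarOrderedRing A := CStarAlgebra.spectralOrderedRing _
  refine CStarAlgebra.nonneg_iff_eq_star_mul_self.1 ?_
  rw [sub_nonneg, ← CStarAlgebra.norm_le_one_iff_of_nonneg _ (star_mul_self_nonneg y),
    CStarRing.norm_star_mul_self]
  exact mul_le_one₀ hy (norm_nonneg _) hy

namespace TracialVN

variable {A : TracialVN.{u}}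

theorem I_smul_I_smul (x : A.Elt) : Complex.I • Complex.I • x = -x := by
  rw [smul_smul, Complex.I_mul_I, neg_one_smul]

theorem re_τ_I_smul_mul {a b : A.Elt} (ha : IsSelfAdjoint a) (hb : IsSelfAdjoint b) :
    (A.τ (Complex.I • (a * b))).re = 0 := by
  have h : star (A.τ (a * b)) = A.τ (a * b) := by
    rw [← τ_star, star_mul, ha.star_eq, hb.star_eq, A.tracial]
  rw [map_smul, smul_eq_mul, Complex.I_mul_re, Complex.conj_eq_iff_im.1 h, neg_zero]

theorem normSq_sub_eq (x y : A.Elt) :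
    normSq (x - y) = normSq x + normSq y - 2 * (A.τ (star x * y)).re := by
  have h : (A.τ (star y * x)).re = (A.τ (star x * y)).re := by
    have := τ_star (star x * y)
    rw [star_mul, star_star] at this
    rw [this]; rfl
  simp only [normSq, star_sub, sub_mul, mul_sub, _root_.map_sub, Complex.sub_re, h]
  ring

theorem abs_re_τ_mul_le (x y : A.Elt) : |(A.τ (x * y)).re| ≤ ‖x‖ * ‖y‖ := by
  obtain ⟨L, _, _, _, e, l, hd, he, hl⟩ := A.exists_gns
  have h : ∀ x : A.Elt, ‖e x‖ ≤ ‖x‖ := fun x => by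
    rw [← sq_le_sq₀ (norm_nonneg _) (norm_nonneg _), ← normSq_eq_norm_sq he]
    exact normSq_le x
  rw [← norm_star x, ← star_star x, ← he, star_star]
  refine (Complex.abs_re_le_norm _).trans ((norm_inner_le_norm _ _).trans ?_)
  gcongr
  · exact h _
  · exact h y

/-- With a polar decomposition this would be `τ(|y|) ≥ τ(y* y)`. A variational argument replaces it:
for a unitary `u` that nearly maximizes `Re τ(u* y)`, write `u* y = S + iT` with `S`, `T`
self-adjoint. Near maximality forces `T` to be small in 2-norm, and `τ(S²)` is an average of values
of the functional at unitaries. -/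
theorem exists_unitary_lt_re_τ (y : A.Elt) (hy : ‖y‖ ≤ 1) {η : ℝ} (hη : 0 < η) :
    ∃ u ∈ unitary A.Elt, normSq y - η < (A.τ (star u * y)).re := by
  have hnt : Nontrivial A.Elt := ⟨1, 0, fun h => by simpa [A.map_one] using congrArg A.τ h⟩
  by_contra! hcon
  have hne : (unitary A.Elt : Set A.Elt).Nonempty := ⟨1, one_mem _⟩
  obtain ⟨t, ht0, ht1, htη⟩ : ∃ t : ℝ, 0 < t ∧ t ≤ 1 ∧ 2 * t < η :=
    ⟨min 1 (η / 4), by positivity, min_le_left _ _, by linarith [min_le_right 1 (η / 4)]⟩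
  let F : Set ℝ := (fun u : A.Elt => (A.τ (star u * y)).re) '' (unitary A.Elt : Set A.Elt)
  have hbdd : BddAbove F := ⟨normSq y - η, by rintro _ ⟨u, hu, rfl⟩; exact hcon u hu⟩
  -- The defect `t²` from the supremum has the order of the second-order error made by a
  -- perturbation of size `t`.
  obtain ⟨_, ⟨u, hu, rfl⟩, hlt⟩ := exists_lt_of_lt_csSup (hne.image _)
    (show sSup F - t ^ 2 < sSup F by linarith [pow_pos ht0 2])
  have hsup : ∀ v ∈ unitary A.Elt, (A.τ (star v * (star u * y))).re ≤ sSup F := by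
    intro v hv
    refine le_csSup hbdd ⟨u * v, mul_mem hu hv, ?_⟩
    simp [mul_assoc]
  have hsup' : sSup F ≤ normSq y - η := csSup_le (hne.image _) (by rintro _ ⟨u, hu, rfl⟩; exact hcon u hu)
  let Z := star u * y
  have hZ : ‖Z‖ ≤ 1 := by
    refine (norm_mul_le _ _).trans ?_
    rw [norm_star, CStarRing.norm_of_mem_unitary hu, one_mul]
    exact hy
  obtain ⟨S, hS⟩ : ∃ S : A.Elt, S = realPart Z := ⟨_, rfl⟩
  obtain ⟨T, hT⟩ : ∃ T : A.Elt, T = imaginaryPart Z := ⟨_, rfl⟩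
  have hSs : IsSelfAdjoint S := hS ▸ (realPart Z).2
  have hTs : IsSelfAdjoint T := hT ▸ (imaginaryPart Z).2
  have hSn : ‖S‖ ≤ 1 := hS ▸ (realPart.norm_le Z).trans hZ
  have hTn : ‖T‖ ≤ 1 := hT ▸ (imaginaryPart.norm_le Z).trans hZ
  have hdec : Z = S + Complex.I • T := by rw [hS, hT, realPart_add_I_smul_imaginaryPart]
  have hreal : ∀ {a : A.Elt}, IsSelfAdjoint a → (A.τ (Complex.I • a)).re = 0 := fun {a} ha => by
    simpa using re_τ_I_smul_mul ha (.one A.Elt)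
  have hZy : normSq Z = normSq y := normSq_unitary_mul (Unitary.star_mem hu) y
  have hZST : normSq Z = (A.τ (S * S)).re + (A.τ (T * T)).re := by
    have h1 : star Z * Z = S * S + T * T + (Complex.I • (S * T) - Complex.I • (T * S)) := by
      rw [hdec, star_add, star_smul, hSs.star_eq, hTs.star_eq]
      simp only [add_mul, mul_add, smul_mul_assoc, mul_smul_comm, Complex.star_def, Complex.conj_I,
        neg_smul, neg_mul, smul_add, smul_neg, I_smul_I_smul]
      abel
    rw [normSq, h1, _root_.map_add, _root_.map_sub, Complex.add_re, Complex.sub_re, re_τ_I_smul_mul hSs hTs,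
      re_τ_I_smul_mul hTs hSs, _root_.map_add, Complex.add_re]
    ring
  have hτZ : (A.τ Z).re = (A.τ S).re := by
    rw [hdec, _root_.map_add, Complex.add_re, hreal hTs, add_zero]
  -- Test against the unitary `r + i t T`, where `r = √(1 - t² T²)`: the functional gains `t τ(T²)`
  -- at first order, loses at most `t²` from `1 - r`, and can exceed its value at `u` by at most
  -- `t²`.
  have htt : t * (A.τ (T * T)).re ≤ 2 * t ^ 2 := by
    have hn : ‖-((t : ℂ) • T)‖ ≤ t := by
      rw [norm_neg, norm_smul, Complex.norm_real, Real.norm_of_nonneg ht0.le]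
      exact mul_le_of_le_one_right ht0.le hTn
    have hsa : IsSelfAdjoint (-((t : ℂ) • T)) := by
      refine IsSelfAdjoint.neg ?_
      rw [isSelfAdjoint_iff, star_smul, hTs.star_eq]
      simp
    obtain ⟨r, hr, hr1, hru⟩ := exists_self_add_I_smul_mem_unitary hsa (hn.trans ht1)
    have h1 := hsup _ (Unitary.smul_mem_of_mem (r := -Complex.I) (by
      simp [Unitary.mem_iff]) hru)
    have h2 : star (-Complex.I • (-((t : ℂ) • T) + Complex.I • r)) * (star u * y) =
        S - (1 - r) * S + (t : ℂ) • (T * T) + (Complex.I • (r * T) - (t : ℂ) • (Complex.I • (T * S))) := by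
      change _ * Z = _
      rw [hdec]
      simp only [star_smul, star_add, star_neg, hTs.star_eq, hr.star_eq]
      simp only [Complex.star_def, Complex.conj_I, Complex.conj_ofReal, neg_smul, neg_neg,
        smul_add, smul_neg, I_smul_I_smul, add_mul, mul_add, smul_mul_assoc, mul_smul_comm,
        neg_mul, sub_mul, one_mul, smul_comm Complex.I (t : ℂ) (_ : A.Elt)]
      abel
    rw [h2] at h1
    simp only [_root_.map_add, _root_.map_sub, Complex.add_re, Complex.sub_re, re_τ_I_smul_mul hr hTs] at h1
    rw [map_smul, smul_eq_mul, Complex.re_ofReal_mul, map_smul, smul_eq_mul, Complex.re_ofReal_mul,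
      re_τ_I_smul_mul hTs hSs] at h1
    have h3 : (A.τ ((1 - r) * S)).re ≤ t ^ 2 := by
      refine (le_abs_self _).trans ((abs_re_τ_mul_le _ _).trans ?_)
      calc _ ≤ t ^ 2 * 1 := by
            gcongr
            exact hr1.trans (by gcongr)
        _ = t ^ 2 := mul_one _
    have h4 : sSup F - t ^ 2 < (A.τ S).re := by rw [← hτZ]; exact hlt
    linarith
  have hTT : (A.τ (T * T)).re ≤ 2 * t := by nlinarith
  -- Average over the two unitaries `S ± i √(1 - S²)`: the terms in `r * T` cancel.
  have hSS : (A.τ (S * S)).re ≤ sSup F := by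
    obtain ⟨r, hr, -, hru⟩ := exists_self_add_I_smul_mem_unitary hSs hSn
    have h1 := hsup _ hru
    have h2 := hsup _ (Unitary.star_mem hru)
    have e1 : star (S + Complex.I • r) * (star u * y) =
        S * S + r * T + (Complex.I • (S * T) - Complex.I • (r * S)) := by
      change _ * Z = _
      rw [hdec, star_add, star_smul, hSs.star_eq, hr.star_eq]
      simp only [add_mul, mul_add, smul_mul_assoc, mul_smul_comm, Complex.star_def, Complex.conj_I,
        neg_smul, neg_mul, smul_add, smul_neg, I_smul_I_smul]
      abel
    have e2 : star (star (S + Complex.I • r)) * (star u * y) =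
        S * S - r * T + (Complex.I • (S * T) + Complex.I • (r * S)) := by
      change _ * Z = _
      rw [hdec, star_star]
      simp only [add_mul, mul_add, smul_mul_assoc, mul_smul_comm, smul_add,
        I_smul_I_smul]
      abel
    rw [e1] at h1
    rw [e2] at h2
    simp only [_root_.map_add, _root_.map_sub, Complex.add_re, Complex.sub_re, re_τ_I_smul_mul hSs hTs,
      re_τ_I_smul_mul hr hSs] at h1 h2
    linarith
  linarith

/-- A contraction of a finite von Neumann algebra is as close to a unitary as its `2`-norm is close
to `1`. -/
theorem exists_unitary_normSq_sub_le (y : A.Elt) (hy : ‖y‖ ≤ 1) :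
    ∃ u ∈ unitary A.Elt, normSq (u - y) ≤ 2 * (1 - normSq y) := by
  have h1 : normSq y ≤ 1 := (normSq_le y).trans (pow_le_one₀ (norm_nonneg _) hy)
  rcases h1.eq_or_lt with h | h
  -- In the case of equality, faithfulness turns `τ(1 - y* y) = 0` into `y* y = 1`, and traciality
  -- makes the isometry `y` unitary.
  · have hpos : star y * y = 1 := by
      obtain ⟨b, hb⟩ := exists_one_sub_star_mul_self hy
      have h3 : normSq b = 0 := by
        rw [normSq, ← hb, _root_.map_sub, A.map_one, ← coe_normSq, h]
        simp
      rw [normSq_eq_zero h3, mul_zero, sub_eq_zero] at hb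
      exact hb.symm
    have hneg : y * star y = 1 := by
      have h2 : normSq (1 - y * star y) = 0 := by
        have h3 : star (1 - y * star y) * (1 - y * star y) = 1 - y * star y := by
          rw [star_sub, star_one, star_mul, star_star, mul_sub, mul_one, sub_mul, one_mul,
            mul_assoc, ← mul_assoc (star y), hpos, one_mul, sub_self, sub_zero]
        rw [normSq, h3, _root_.map_sub, A.tracial y, hpos, sub_self, Complex.zero_re]
      exact (sub_eq_zero.1 (normSq_eq_zero h2)).symm
    exact ⟨y, Unitary.mem_iff.2 ⟨hpos, hneg⟩, by rw [sub_self, normSq_zero, h]; norm_num⟩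
  -- With `η = (1 - ‖y‖₂²) / 2`, the identity `‖u - y‖₂² = 1 + ‖y‖₂² - 2 Re τ(u* y)` gives exactly
  -- the factor two.
  · obtain ⟨u, hu, hlt⟩ := exists_unitary_lt_re_τ y hy (half_pos (sub_pos.2 h))
    refine ⟨u, hu, ?_⟩
    rw [normSq_sub_eq, normSq_unitary hu]
    linarith

end TracialVN

/-- The commutant of a set of operators and of their adjoints. -/
def commutantOf {H : Type u} [NormedAddCommGroup H] [InnerProductSpace ℂ H] [CompleteSpace H]
    (S : Set (H →L[ℂ] H)) : VonNeumannAlgebra H where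
  toStarSubalgebra := StarSubalgebra.centralizer ℂ S
  centralizer_centralizer' := by
    change Set.centralizer (Set.centralizer (StarSubalgebra.centralizer ℂ S : Set (H →L[ℂ] H))) =
      (StarSubalgebra.centralizer ℂ S : Set (H →L[ℂ] H))
    rw [StarSubalgebra.coe_centralizer, Set.centralizer_centralizer_centralizer]

theorem mem_commutantOf_iff {H : Type u} [NormedAddCommGroup H] [InnerProductSpace ℂ H]
    [CompleteSpace H] {S : Set (H →L[ℂ] H)} {z : H →L[ℂ] H} :
    z ∈ (commutantOf S).toStarSubalgebra ↔ ∀ g ∈ S, g * z = z * g ∧ star g * z = z * star g :=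
  StarSubalgebra.mem_centralizer_iff ℂ

/-- A quadratic Poincaré inequality for all unitary representations of `G` on Hilbert spaces. -/
def HasSpectralGap (G : Type v) [Group G] (F : (G → ℝ) → ℝ) : Prop :=
  ∀ (H : Type u) [NormedAddCommGroup H] [InnerProductSpace ℂ H] [CompleteSpace H]
    (π : G →* unitary (H →L[ℂ] H)) (ξ : H),
    ‖ξ - (invariantVectors π).starProjection ξ‖ ^ 2 ≤
      F fun g => ‖(π g : H →L[ℂ] H) ξ - ξ‖ ^ 2

namespace TracialVN

/-! ### Relative commutants of groups of unitaries. -/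

section RelativeCommutant

variable {A : TracialVN.{u}} {G : Type v} [Group G] (ρ : G →* unitary A.Elt)

/-- The operators of the relative commutant. -/
def relCommutantAlg : VonNeumannAlgebra A.Space :=
  commutantOf ((A.alg.commutant : Set (A.Space →L[ℂ] A.Space)) ∪
    Set.range fun g => ((ρ g : A.Elt) : A.Space →L[ℂ] A.Space))

/-- Commuting with `M'` places an operator in `M'' = M`. Adjoints of the `ρ g` cost nothing, as they
are the `ρ g⁻¹`. -/
theorem mem_relCommutantAlg_iff {x : A.Space →L[ℂ] A.Space} :
    x ∈ (relCommutantAlg ρ).toStarSubalgebra ↔ x ∈ A.alg.toStarSubalgebra ∧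
      ∀ g, ((ρ g : A.Elt) : A.Space →L[ℂ] A.Space) * x = x * ((ρ g : A.Elt) : A.Space →L[ℂ] A.Space) := by
  rw [relCommutantAlg, mem_commutantOf_iff]
  constructor
  · intro h
    refine ⟨?_, fun g => (h _ (Or.inr ⟨g, rfl⟩)).1⟩
    change x ∈ A.alg
    rw [← VonNeumannAlgebra.commutant_commutant A.alg, VonNeumannAlgebra.mem_commutant_iff]
    exact fun y hy => (h y (Or.inl hy)).1
  · rintro ⟨h1, h2⟩ y (hy | ⟨g, rfl⟩)
    · exact ⟨(VonNeumannAlgebra.mem_commutant_iff.1 hy x h1).symm,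
        (VonNeumannAlgebra.mem_commutant_iff.1 (star_mem hy) x h1).symm⟩
    · refine ⟨h2 g, ?_⟩
      have h3 : star ((ρ g : A.Elt) : A.Space →L[ℂ] A.Space) =
          ((ρ g⁻¹ : A.Elt) : A.Space →L[ℂ] A.Space) := by
        rw [map_inv]; rfl
      rw [h3]
      exact h2 g⁻¹

theorem relCommutantAlg_le : (relCommutantAlg ρ).toStarSubalgebra ≤ A.alg.toStarSubalgebra :=
  fun _ hx => ((mem_relCommutantAlg_iff ρ).1 hx).1

/-- The relative commutant in `M` of a group of unitaries, with the restricted trace. -/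
def relCommutant : TracialVN.{u} where
  Space := A.Space
  alg := relCommutantAlg ρ
  τ := A.τ ∘ₗ (StarSubalgebra.inclusion (relCommutantAlg_le ρ)).toLinearMap
  normal := by
    obtain ⟨ξ, η, h1, h2, h3⟩ := A.normal
    exact ⟨ξ, η, h1, h2, fun x => h3 (StarSubalgebra.inclusion (relCommutantAlg_le ρ) x)⟩
  nonneg x := A.nonneg (StarSubalgebra.inclusion (relCommutantAlg_le ρ) x)
  map_one := A.map_one
  faithful x hx := StarSubalgebra.inclusion_injective (relCommutantAlg_le ρ)
    (A.faithful (StarSubalgebra.inclusion (relCommutantAlg_le ρ) x) hx)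
  tracial x y := A.tracial (StarSubalgebra.inclusion (relCommutantAlg_le ρ) x)
    (StarSubalgebra.inclusion (relCommutantAlg_le ρ) y)

/-- The inclusion of the relative commutant. -/
def relInclusion : (relCommutant ρ).Elt →⋆ₐ[ℂ] A.Elt :=
  StarSubalgebra.inclusion (relCommutantAlg_le ρ)

theorem τ_relInclusion (x : (relCommutant ρ).Elt) :
    A.τ (relInclusion ρ x) = (relCommutant ρ).τ x := rfl

theorem normSq_relInclusion (x : (relCommutant ρ).Elt) :
    normSq (relInclusion ρ x) = normSq x := rfl

theorem relCommutant_mem {C : Set TracialVN.{u}} (hC : ClosedUnderSubalgebras C) (hA : A ∈ C) :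
    relCommutant ρ ∈ C := hC A hA _ (relInclusion ρ) (τ_relInclusion ρ)

theorem commute_relInclusion (x : (relCommutant ρ).Elt) (g : G) :
    (ρ g : A.Elt) * relInclusion ρ x = relInclusion ρ x * ρ g :=
  Subtype.ext (((mem_relCommutantAlg_iff ρ).1 x.2).2 g)

theorem exists_relInclusion_eq {x : A.Elt} (h : ∀ g, (ρ g : A.Elt) * x = x * ρ g) :
    ∃ y, relInclusion ρ y = x :=
  ⟨⟨x.1, (mem_relCommutantAlg_iff ρ).2 ⟨x.2, fun g => congrArg Subtype.val (h g)⟩⟩, rfl⟩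

/-- In the presence of a spectral gap, a contraction of almost full `2`-norm that almost commutes
with a group of unitaries is close to a unitary of the relative commutant. -/
theorem exists_unitary_relCommutant {F : (G → ℝ) → ℝ} (hF : HasSpectralGap.{u} G F) (X : A.Elt)
    (hX : ‖X‖ ≤ 1) : ∃ u : unitary (relCommutant ρ).Elt,
      normSq (relInclusion ρ u - X) ≤
        6 * (1 - normSq X + F fun g => normSq ((ρ g : A.Elt) * X - X * (ρ g : A.Elt))) := by
  obtain ⟨L, _, _, _, e, σ, Y, he, hσ, hY, hc, heY⟩ := exists_commutant_projection ρ X hX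
  obtain ⟨y, rfl⟩ := exists_relInclusion_eq ρ hc
  have hgap := hF L σ (e X)
  have h1 : ∀ g, ‖(σ g : L →L[ℂ] L) (e X) - e X‖ ^ 2 = normSq ((ρ g : A.Elt) * X - X * (ρ g : A.Elt)) := by
    intro g
    rw [hσ, ← _root_.map_sub, ← normSq_eq_norm_sq he, ← normSq_mul_unitary (ρ g).2, sub_mul, mul_assoc,
      Unitary.coe_star_mul_self, mul_one]
  simp_rw [h1] at hgap
  rw [← heY, ← _root_.map_sub, ← normSq_eq_norm_sq he] at hgap
  -- Since `y` is an orthogonal projection of `X`, its defect from full norm is that of `X` plus `‖X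
  -- - y‖₂²`, which the spectral gap controls. Passing to a unitary near `y` doubles this defect.
  have hpyth : normSq X = normSq (relInclusion ρ y) + normSq (X - relInclusion ρ y) := by
    rw [normSq_eq_norm_sq he, normSq_eq_norm_sq he, normSq_eq_norm_sq he, _root_.map_sub, heY]
    have := Submodule.norm_sq_eq_add_norm_sq_starProjection (e X) (invariantVectors σ)
    rw [this, Submodule.starProjection_orthogonal_val]
  obtain ⟨u, hu, hle⟩ := exists_unitary_normSq_sub_le y hY
  refine ⟨⟨u, hu⟩, ?_⟩
  have h2 := normSq_sub_le (relInclusion ρ u) (relInclusion ρ y) X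
  rw [← _root_.map_sub, normSq_relInclusion, normSq_sub_comm (relInclusion ρ y)] at h2
  rw [normSq_relInclusion] at hpyth
  have h3 := normSq_nonneg (X - relInclusion ρ y)
  have h4 : normSq X ≤ 1 := (normSq_le X).trans (pow_le_one₀ (norm_nonneg _) hX)
  dsimp only
  linarith

end RelativeCommutant

end TracialVN

/-! ### Spectral gap constants and property (T). -/

section SpectralGap

variable {G : Type v} [Group G]

theorem HasSpectralGap.of_poincareInequality [MeasurableSpace G] {μ : Measure G} {κ : ℝ}
    (h : PoincareInequality.{u} μ κ) : HasSpectralGap.{u} G fun f => κ / 2 * ∫ g, f g ∂μ :=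
  fun H _ _ _ π ξ => h H π ξ

/-- The infimum is attained: for fixed `π` and `ξ`, the quotient of the two sides is a lower bound
of all admissible constants. If the integral vanishes, any admissible constant already gives the
inequality. -/
theorem poincareInequality_spectralGapConst [MeasurableSpace G] {μ : Measure G}
    (h : spectralGapConst.{u} μ ≠ ∞) : PoincareInequality.{u} μ (spectralGapConst.{u} μ).toReal := by
  intro H _ _ _ π ξ
  have hI : 0 ≤ ∫ g, ‖(π g : H →L[ℂ] H) ξ - ξ‖ ^ 2 ∂μ := integral_nonneg fun g => by positivity
  rcases hI.eq_or_lt with h0 | h0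
  · obtain ⟨κ, hκ⟩ : ∃ κ : ℝ≥0, PoincareInequality.{u} μ κ := by
      by_contra! hcon
      exact h (by simp [spectralGapConst, hcon])
    have := hκ H π ξ
    rwa [← h0, mul_zero] at this ⊢
  · have h1 : ENNReal.ofReal (‖ξ - (invariantVectors π).starProjection ξ‖ ^ 2 * 2 /
        ∫ g, ‖(π g : H →L[ℂ] H) ξ - ξ‖ ^ 2 ∂μ) ≤ spectralGapConst.{u} μ := by
      refine le_iInf₂ fun κ hκ => ?_
      refine ENNReal.ofReal_le_of_le_toReal ?_
      rw [div_le_iff₀ h0, ENNReal.coe_toReal]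
      have := hκ H π ξ
      linarith
    rw [ENNReal.ofReal_le_iff_le_toReal h, div_le_iff₀ h0] at h1
    linarith

/-- The restriction of a unitary representation to the orthogonal of the invariant vectors. -/
theorem exists_restrict_orthogonal {E : Type u} [NormedAddCommGroup E] [InnerProductSpace ℂ E]
    [CompleteSpace E] (π : G →* unitary (E →L[ℂ] E)) :
    ∃ σ : G →* unitary (↥(invariantVectors π)ᗮ →L[ℂ] ↥(invariantVectors π)ᗮ), ∀ g ξ,
      (((σ g : ↥(invariantVectors π)ᗮ →L[ℂ] ↥(invariantVectors π)ᗮ) ξ : ↥(invariantVectors π)ᗮ) : E) = (π g : E →L[ℂ] E) ξ := by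
  have hmem : ∀ g, ∀ ξ : ↥(invariantVectors π)ᗮ, (π g : E →L[ℂ] E) ξ ∈ (invariantVectors π)ᗮ := by
    intro g ξ
    rw [Submodule.mem_orthogonal]
    intro v hv
    have h1 := (mem_invariantVectors π v).1 hv g
    rw [← h1, inner_unitary_apply]
    exact (Submodule.mem_orthogonal _ _).1 ξ.2 v hv
  exact ⟨unitaryRep (fun g => ((π g : E →L[ℂ] E) ∘L (invariantVectors π)ᗮ.subtypeL).codRestrict _
    (hmem g)) (by ext; simp)
    (fun g h => by
      ext x
      change (π (g * h) : E →L[ℂ] E) x = (π g : E →L[ℂ] E) ((π h : E →L[ℂ] E) x)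
      simp) (fun g x => norm_unitary_apply (π g) x),
    fun g ξ => rfl⟩

/-- On the orthogonal complement of the invariant vectors there is no nonzero invariant vector, so
every nonzero vector is moved by at least `ε` times its norm by some element of `Q`. Hence the
constant `ε⁻²`. -/
theorem HasPropertyT.hasSpectralGap (h : HasPropertyT G) :
    ∃ (Q : Finset G) (c : ℝ), 0 < c ∧ HasSpectralGap.{0} G fun f => c * ∑ g ∈ Q, f g := by
  obtain ⟨Q, ε, hε, hQ⟩ := h
  refine ⟨Q, (ε ^ 2)⁻¹, by positivity, fun H _ _ _ π ξ => ?_⟩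
  let ζ : ↥(invariantVectors π)ᗮ := ⟨ξ - (invariantVectors π).starProjection ξ,
    Submodule.sub_starProjection_mem_orthogonal ξ⟩
  have hζ : ∀ g, ‖(π g : H →L[ℂ] H) ζ - ζ‖ = ‖(π g : H →L[ℂ] H) ξ - ξ‖ := fun g => by
    have := (mem_invariantVectors π _).1 ((invariantVectors π).starProjection_apply_mem ξ) g
    simp only [ζ, _root_.map_sub, this]
    congr 1; abel
  by_cases h0 : ζ = 0
  · have : ξ - (invariantVectors π).starProjection ξ = 0 := congrArg Subtype.val h0
    rw [this, norm_zero, zero_pow two_ne_zero]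
    positivity
  obtain ⟨σ, hσ⟩ := exists_restrict_orthogonal π
  have h1 : ∃ g ∈ Q, ε * ‖ζ‖ ≤ ‖(σ g : ↥(invariantVectors π)ᗮ →L[ℂ] ↥(invariantVectors π)ᗮ) ζ - ζ‖ := by
    by_contra! hcon
    obtain ⟨η, hη, hinv⟩ := hQ _ σ ⟨ζ, h0, hcon⟩
    refine hη (Subtype.ext ?_)
    have h2 : (η : H) ∈ invariantVectors π := (mem_invariantVectors π _).2 fun g => by
      rw [← hσ, hinv]
    exact inner_self_eq_zero.1 ((Submodule.mem_orthogonal _ _).1 η.2 η h2)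
  obtain ⟨g, hg, hle⟩ := h1
  have h2 : ‖(σ g : ↥(invariantVectors π)ᗮ →L[ℂ] ↥(invariantVectors π)ᗮ) ζ - ζ‖ = ‖(π g : H →L[ℂ] H) ξ - ξ‖ := by
    rw [← hζ, ← hσ]; rfl
  rw [h2] at hle
  have h3 : ‖(π g : H →L[ℂ] H) ξ - ξ‖ ^ 2 ≤ ∑ g ∈ Q, ‖(π g : H →L[ℂ] H) ξ - ξ‖ ^ 2 :=
    Finset.single_le_sum (f := fun g => ‖(π g : H →L[ℂ] H) ξ - ξ‖ ^ 2) (fun g _ => by positivity) hg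
  change _ ≤ (ε ^ 2)⁻¹ * ∑ g ∈ Q, ‖(π g : H →L[ℂ] H) ξ - ξ‖ ^ 2
  rw [inv_mul_eq_div, le_div_iff₀ (by positivity), mul_comm, ← mul_pow]
  refine le_trans ?_ h3
  gcongr
  exact hle

/-- The inverse spectral gap of a nontrivial group is bounded below. -/
theorem half_le_spectralGapConst [Countable G] [Nontrivial G] [MeasurableSpace G]
    {μ : Measure G} [IsProbabilityMeasure μ] (h : spectralGapConst.{u} μ ≠ ∞) :
    1 / 2 ≤ (spectralGapConst.{u} μ).toReal := by
  classical
  -- Countability allows the regular representation to be realized in the universe over which the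
  -- Poincaré inequality quantifies.
  have : Small.{u} G := Countable.toSmall G
  let S := Shrink.{u, v} G
  let e : G ≃ S := equivShrink.{u, v} G
  let E := lp (fun _ : S => ℂ) 2
  let p : G → S ≃ S := fun g => e.symm.trans ((Equiv.mulLeft g⁻¹).trans e)
  have hsum : ∀ g, ∀ f : E, Memℓp (fun s => f (p g s)) 2 := fun g f =>
    memℓp_gen (((p g).summable_iff (f := fun s => ‖f s‖ ^ (2 : ℝ≥0∞).toReal)).2
      ((lp.memℓp f).summable (by norm_num)))
  have hnorm : ∀ g, ∀ f : E, ‖(⟨_, hsum g f⟩ : E)‖ = ‖f‖ := fun g f => by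
    rw [lp.norm_eq_tsum_rpow (by norm_num), lp.norm_eq_tsum_rpow (by norm_num)]
    congr 1
    exact (p g).tsum_eq fun s => ‖f s‖ ^ (2 : ℝ≥0∞).toReal
  let U : G → E →L[ℂ] E := fun g => LinearMap.mkContinuous
    { toFun := fun f => ⟨_, hsum g f⟩
      map_add' := fun f f' => rfl
      map_smul' := fun c f => rfl } 1 (fun f => by rw [one_mul]; exact (hnorm g f).le)
  have hU : ∀ g f s, U g f s = f (p g s) := fun g f s => rfl
  let π : G →* unitary (E →L[ℂ] E) := unitaryRep U
    (by ext f s; simp [hU, p]) (fun g h => by ext f s; simp [hU, p, mul_assoc]) hnorm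
  obtain ⟨a, ha⟩ := exists_ne (1 : G)
  -- Invariant vectors of the regular representation are constant functions, hence orthogonal to
  -- this difference of Dirac functions. A unitary moves `ξ` by at most `2 ‖ξ‖`, so the Poincaré
  -- inequality reads `1 ≤ (κ / 2) * 4`.
  let ξ : E := lp.single 2 (e 1) 1 - lp.single 2 (e a) 1
  have hξ : ξ ≠ 0 := fun h0 => by
    have h1 := congrArg (fun f : E => f (e 1)) h0
    have h2 : e 1 ≠ e a := fun h => ha (e.injective h).symm
    simp [ξ, Pi.single_eq_of_ne h2] at h1
  have hproj : (invariantVectors π).starProjection ξ = 0 := by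
    rw [Submodule.starProjection_apply_eq_zero_iff, Submodule.mem_orthogonal]
    intro v hv
    have hconst : ∀ g, v (e g) = v (e 1) := fun g => by
      have h1 := congrArg (fun f : E => f (e g)) ((mem_invariantVectors π v).1 hv g)
      have h2 : U g v (e g) = v (e g) := h1
      rw [← h2, hU]
      simp [p]
    rw [inner_sub_right, lp.inner_single_right, lp.inner_single_right, hconst a, sub_self]
  have hP := poincareInequality_spectralGapConst h E π ξ
  rw [hproj, sub_zero] at hP
  have hle : ∫ g, ‖(π g : E →L[ℂ] E) ξ - ξ‖ ^ 2 ∂μ ≤ 4 * ‖ξ‖ ^ 2 := by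
    have h1 : ∀ g, ‖(π g : E →L[ℂ] E) ξ - ξ‖ ^ 2 ≤ 4 * ‖ξ‖ ^ 2 := fun g => by
      have h2 := norm_sub_le ((π g : E →L[ℂ] E) ξ) ξ
      rw [norm_unitary_apply] at h2
      nlinarith [norm_nonneg ((π g : E →L[ℂ] E) ξ - ξ), norm_nonneg ξ]
    calc _ ≤ ∫ _, 4 * ‖ξ‖ ^ 2 ∂μ := integral_mono_of_nonneg
          (Eventually.of_forall fun g => by positivity) (integrable_const _)
          (Eventually.of_forall h1)
      _ = _ := by simp
  have hκ : 0 ≤ (spectralGapConst.{u} μ).toReal := ENNReal.toReal_nonneg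
  have hpos : 0 < ‖ξ‖ ^ 2 := by have := norm_pos_iff.2 hξ; positivity
  nlinarith

end SpectralGap

/-- Polarization: the arguments `x* + y` and `x* + i y` separate `f (x y) - f (y x)` from the
corresponding difference for the adjoints. -/
theorem mul_comm_of_star_mul_self {R : Type*} [Ring R] [StarRing R] [Algebra ℂ R] [StarModule ℂ R]
    (f : R →ₗ[ℂ] ℂ) (h : ∀ x, f (star x * x) = f (x * star x)) (x y : R) : f (x * y) = f (y * x) := by
  have h1 := h (star x + y)
  have h2 := h (star x + Complex.I • y)
  simp only [star_add, star_star, star_smul, add_mul, mul_add, map_add, smul_mul_assoc,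
    mul_smul_comm, map_smul, smul_eq_mul, Complex.star_def, Complex.conj_I] at h1 h2
  have h3 := h (star x)
  rw [star_star] at h3
  have h4 := h y
  have h5 : Complex.I * (f (x * y) - f (y * x)) = Complex.I * (f (star y * star x) - f (star x * star y)) := by
    linear_combination h2 - h3 + Complex.I * Complex.I * h4
  have h6 := mul_left_cancel₀ Complex.I_ne_zero h5
  linear_combination (1/2) * (h1 - h3 - h4 + h6)

/-! ### Corners of von Neumann algebras. -/

section Corner

variable {K L : Type u} [NormedAddCommGroup K] [InnerProductSpace ℂ K] [CompleteSpace K]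
  [NormedAddCommGroup L] [InnerProductSpace ℂ L] [CompleteSpace L]

/-- The corner of a von Neumann algebra defined by an isometry `ι` onto the range of a projection. -/
def cornerAlg (M : VonNeumannAlgebra K) (ι : L →L[ℂ] K) : VonNeumannAlgebra L :=
  commutantOf ((fun x : K →L[ℂ] K => (adjoint ι) ∘L x ∘L ι) '' M.commutant)

/-- As the commutant of the compressed commutant, the corner is a von Neumann algebra by
construction; this recovers its concrete description. The projection `ι ι*` lies in `M`, so it
commutes with `M'` and can be moved through the products. -/
theorem mem_cornerAlg_iff {M : VonNeumannAlgebra K} {ι : L →L[ℂ] K} (h1 : (adjoint ι) ∘L ι = 1)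
    (h2 : ι ∘L (adjoint ι) ∈ M) {T : L →L[ℂ] L} : T ∈ (cornerAlg M ι).toStarSubalgebra ↔ ι ∘L T ∘L (adjoint ι) ∈ M := by
  have e1 : ∀ v, (adjoint ι) (ι v) = v := fun v => congrArg (fun S : L →L[ℂ] L => S v) h1
  rw [cornerAlg, mem_commutantOf_iff]
  constructor
  · intro h
    rw [← VonNeumannAlgebra.commutant_commutant M, VonNeumannAlgebra.mem_commutant_iff]
    intro x hx
    have h3 := (h _ ⟨x, hx, rfl⟩).1
    have h4 := VonNeumannAlgebra.mem_commutant_iff.1 hx _ h2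
    ext v
    have h5 := congrArg (fun S : K →L[ℂ] K => S (ι (T ((adjoint ι) v)))) h4
    have h6 := congrArg (fun S : K →L[ℂ] K => (adjoint ι) (S v)) h4
    have h7 := congrArg (fun S : L →L[ℂ] L => ι (S ((adjoint ι) v))) h3
    simp only [mul_apply_eq_comp, ContinuousLinearMap.comp_apply, e1] at h5 h6 h7 ⊢
    rw [← h5, h7, h6]
  · rintro h _ ⟨x, hx, rfl⟩
    have key : ∀ x ∈ M.commutant, ((adjoint ι) ∘L x ∘L ι) * T = T * ((adjoint ι) ∘L x ∘L ι) := by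
      intro x hx
      have h4 := VonNeumannAlgebra.mem_commutant_iff.1 hx _ h
      ext v
      have h5 := congrArg (fun S : K →L[ℂ] K => (adjoint ι) (S (ι v))) h4
      simp only [mul_apply_eq_comp, ContinuousLinearMap.comp_apply, e1] at h5 ⊢
      exact h5.symm
    refine ⟨key x hx, ?_⟩
    have h6 : star ((adjoint ι) ∘L x ∘L ι) = (adjoint ι) ∘L star x ∘L ι := by
      simp only [ContinuousLinearMap.star_eq_adjoint, ContinuousLinearMap.adjoint_comp,
      ContinuousLinearMap.adjoint_adjoint, ContinuousLinearMap.comp_assoc]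
    rw [h6]
    exact key _ (star_mem hx)

end Corner

/-! ### The trace on the amplification. -/

namespace TracialVN

variable {A : TracialVN.{u}}

theorem entry_star (T : A.Amp) (i j : ℕ) : entry (star T) i j = star (entry T j i) := by
  refine Subtype.ext ?_
  ext v
  refine ext_inner_left ℂ fun v' => ?_
  change inner ℂ v' ((star (T : AmpSpace A.Space →L[ℂ] AmpSpace A.Space)) (lp.single 2 j v) i) =
    inner ℂ v' ((star (matCoeff (T : AmpSpace A.Space →L[ℂ] AmpSpace A.Space) j i)) v)
  rw [ContinuousLinearMap.star_eq_adjoint, ContinuousLinearMap.star_eq_adjoint,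
    ContinuousLinearMap.adjoint_inner_right, matCoeff_apply]
  refine (lp.inner_single_left (𝕜 := ℂ) (G := fun _ : ℕ => A.Space) i v' _).symm.trans ?_
  refine (ContinuousLinearMap.adjoint_inner_right _ _ _).trans ?_
  exact lp.inner_single_right (𝕜 := ℂ) (G := fun _ : ℕ => A.Space) j v _

theorem amp_ext {S T : A.Amp} (h : ∀ i j, entry S i j = entry T i j) : S = T := by
  refine Subtype.ext (lp.ext_continuousLinearMap (by simp) fun j => ?_)
  ext v i
  exact congrArg (fun x : A.Elt => (x : A.Space →L[ℂ] A.Space) v) (h i j)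

variable (A) in
/-- Vectors of the Hilbert space of `M_∞` whose vector states sum up to the trace. -/
def ampVec (p : ℕ × ℕ) : AmpSpace A.Space :=
  lp.single 2 p.1 (A.exists_vectorStates.choose p.2)

theorem hasSum_ampVec (T : A.Amp) (i : ℕ) :
    HasSum (fun n => inner ℂ (A.ampVec (i, n))
      ((T : AmpSpace A.Space →L[ℂ] AmpSpace A.Space) (A.ampVec (i, n)))) (A.τ (entry T i i)) := by
  have := A.exists_vectorStates.choose_spec.2 (entry T i i)
  simp only [ampVec, lp.inner_single_left]
  exact this

theorem tsum_norm_sq_vectorStates (x : A.Elt) :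
    ∑' n, ENNReal.ofReal (‖(x : A.Space →L[ℂ] A.Space) (A.exists_vectorStates.choose n)‖ ^ 2) =
      ENNReal.ofReal (normSq x) := by
  have h := Complex.hasSum_re (A.exists_vectorStates.choose_spec.2 (star x * x))
  have h1 : ∀ v : A.Space, (inner ℂ v (((star x * x : A.Elt) : A.Space →L[ℂ] A.Space) v)).re =
      ‖(x : A.Space →L[ℂ] A.Space) v‖ ^ 2 := fun v => by
    change (inner ℂ v ((star (x : A.Space →L[ℂ] A.Space)) ((x : A.Space →L[ℂ] A.Space) v))).re = _
    rw [ContinuousLinearMap.star_eq_adjoint, ContinuousLinearMap.adjoint_inner_right,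
      ← inner_self_eq_norm_sq (𝕜 := ℂ)]
    rfl
  simp only [h1] at h
  rw [← ENNReal.ofReal_tsum_of_nonneg (fun n => by positivity) h.summable, h.tsum_eq]
  rfl

theorem tsum_norm_sq_ampVec (T : A.Amp) :
    ∑' p, ENNReal.ofReal (‖(T : AmpSpace A.Space →L[ℂ] AmpSpace A.Space) (A.ampVec p)‖ ^ 2) =
      ∑' i, ∑' j, ENNReal.ofReal (normSq (entry T j i)) := by
  rw [ENNReal.tsum_prod']
  refine tsum_congr fun i => ?_
  have h1 : ∀ f : AmpSpace A.Space, ENNReal.ofReal (‖f‖ ^ 2) = ∑' j, ENNReal.ofReal (‖f j‖ ^ 2) := by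
    intro f
    rw [← ENNReal.ofReal_tsum_of_nonneg (fun n => by positivity) (summable_norm_sq f)]
    have := lp.norm_rpow_eq_tsum (p := 2) (by norm_num) f
    norm_num at this
    rw [this]
  simp_rw [h1]
  rw [ENNReal.tsum_comm]
  refine tsum_congr fun j => ?_
  rw [← tsum_norm_sq_vectorStates]
  rfl

/-- Writing the trace of `T* T` as a sum of `‖T v‖²` over one fixed family of vectors reduces
inequalities between traces to inequalities between vectors, term by term. -/
theorem traceInf_star_mul_self' (T : A.Amp) : traceInf (star T * T) =
    ∑' p, ENNReal.ofReal (‖(T : AmpSpace A.Space →L[ℂ] AmpSpace A.Space) (A.ampVec p)‖ ^ 2) := by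
  rw [ENNReal.tsum_prod', traceInf]
  refine tsum_congr fun i => ?_
  have h := Complex.hasSum_re (hasSum_ampVec (star T * T) i)
  have h1 : ∀ v : AmpSpace A.Space, (inner ℂ v (((star T * T : A.Amp) :
      AmpSpace A.Space →L[ℂ] AmpSpace A.Space) v)).re =
      ‖(T : AmpSpace A.Space →L[ℂ] AmpSpace A.Space) v‖ ^ 2 := fun v => by
    change (inner ℂ v ((star (T : AmpSpace A.Space →L[ℂ] AmpSpace A.Space))
      ((T : AmpSpace A.Space →L[ℂ] AmpSpace A.Space) v))).re = _
    rw [ContinuousLinearMap.star_eq_adjoint, ContinuousLinearMap.adjoint_inner_right,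
      ← inner_self_eq_norm_sq (𝕜 := ℂ)]
    rfl
  simp only [h1] at h
  rw [← ENNReal.ofReal_tsum_of_nonneg (fun n => by positivity) h.summable, h.tsum_eq]

theorem traceInf_star_mul_self (T : A.Amp) : traceInf (star T * T) =
    ∑' i, ∑' j, ENNReal.ofReal (normSq (entry T j i)) := by
  rw [traceInf_star_mul_self', tsum_norm_sq_ampVec]

/-- Both sides are the sum of the squared 2-norms of all matrix entries, read by rows or by columns.
Traciality on `M` enters through `normSq_star`. -/
theorem traceInf_mul_star_self (T : A.Amp) : traceInf (T * star T) = traceInf (star T * T) := by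
  have := traceInf_star_mul_self (star T)
  rw [star_star] at this
  rw [this, traceInf_star_mul_self, ENNReal.tsum_comm]
  simp_rw [entry_star, normSq_star]

theorem eq_zero_of_traceInf_eq_zero {T : A.Amp} (h : traceInf (star T * T) = 0) : T = 0 := by
  rw [traceInf_star_mul_self, ENNReal.tsum_eq_zero] at h
  refine amp_ext fun i j => ?_
  have h1 := ENNReal.tsum_eq_zero.1 (h j) i
  rw [ENNReal.ofReal_eq_zero] at h1
  rw [normSq_eq_zero (le_antisymm h1 (normSq_nonneg _))]
  refine Subtype.ext ?_
  ext v
  rfl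

/-! ### Corners of finite trace as tracial von Neumann algebras. -/

section CornerTracial

variable {L : Type u} [NormedAddCommGroup L] [InnerProductSpace ℂ L] [CompleteSpace L]
  {ι : L →L[ℂ] AmpSpace A.Space} {P : A.Amp}

/-- `x ↦ ι x ι*`, from the corner to `M_∞`. -/
def cornerIncl (h1 : (adjoint ι) ∘L ι = 1) (h2 : ι ∘L (adjoint ι) = P.1) :
    (cornerAlg (amplification A.alg) ι).toStarSubalgebra →⋆ₙₐ[ℂ] A.Amp where
  toFun T := ⟨ι ∘L T.1 ∘L (adjoint ι), (mem_cornerAlg_iff h1 (h2 ▸ P.2)).1 T.2⟩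
  map_smul' c T := Subtype.ext (by ext; simp)
  map_zero' := Subtype.ext (by ext; simp)
  map_add' S T := Subtype.ext (by ext; simp)
  map_mul' S T := Subtype.ext (by
    have e1 : ∀ v, (adjoint ι) (ι v) = v := fun v => congrArg (fun S : L →L[ℂ] L => S v) h1
    refine ContinuousLinearMap.ext fun v => ?_
    change ι (S.1 (T.1 ((adjoint ι) v))) = ι (S.1 ((adjoint ι) (ι (T.1 ((adjoint ι) v)))))
    rw [e1])
  map_star' T := Subtype.ext (by
    change ι ∘L (star T.1) ∘L (adjoint ι) = star (ι ∘L T.1 ∘L (adjoint ι))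
    simp only [ContinuousLinearMap.star_eq_adjoint, ContinuousLinearMap.adjoint_comp,
      ContinuousLinearMap.adjoint_adjoint, ContinuousLinearMap.comp_assoc])

theorem coe_cornerIncl (h1 : (adjoint ι) ∘L ι = 1) (h2 : ι ∘L (adjoint ι) = P.1)
    (T : (cornerAlg (amplification A.alg) ι).toStarSubalgebra) :
    (cornerIncl h1 h2 T).1 = ι ∘L T.1 ∘L (adjoint ι) := rfl

theorem cornerIncl_one (h1 : (adjoint ι) ∘L ι = 1) (h2 : ι ∘L (adjoint ι) = P.1) : cornerIncl h1 h2 1 = P :=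
  Subtype.ext h2

theorem cornerIncl_injective (h1 : (adjoint ι) ∘L ι = 1) (h2 : ι ∘L (adjoint ι) = P.1) :
    Function.Injective (cornerIncl h1 h2) := fun S T h => by
  have e1 : ∀ v, (adjoint ι) (ι v) = v := fun v => congrArg (fun S : L →L[ℂ] L => S v) h1
  refine Subtype.ext (ContinuousLinearMap.ext fun v => ?_)
  have := congrArg (fun U : A.Amp => (adjoint ι) (U.1 (ι v))) h
  simpa [coe_cornerIncl, e1] using this

theorem tsum_norm_sq_corner (h1 : (adjoint ι) ∘L ι = 1) (h2 : ι ∘L (adjoint ι) = P.1)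
    (T : (cornerAlg (amplification A.alg) ι).toStarSubalgebra) :
    ∑' p, ENNReal.ofReal (‖T.1 ((adjoint ι) (A.ampVec p))‖ ^ 2) =
      traceInf (star (cornerIncl h1 h2 T) * cornerIncl h1 h2 T) := by
  rw [traceInf_star_mul_self']
  refine tsum_congr fun p => ?_
  have : ‖(cornerIncl h1 h2 T).1 (A.ampVec p)‖ = ‖T.1 ((adjoint ι) (A.ampVec p))‖ := by
    rw [coe_cornerIncl]
    exact (ContinuousLinearMap.norm_map_iff_adjoint_comp_self _).2 h1 _
  rw [this]

theorem summable_norm_sq_corner (h1 : (adjoint ι) ∘L ι = 1) (h2 : ι ∘L (adjoint ι) = P.1)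
    (hfin : traceInf P ≠ ∞) : Summable fun p => ‖(adjoint ι) (A.ampVec p)‖ ^ 2 := by
  have h := tsum_norm_sq_corner h1 h2 1
  rw [← map_star, ← map_mul, star_one, one_mul, cornerIncl_one] at h
  have h3 := ENNReal.summable_toReal (h ▸ hfin)
  refine h3.congr fun p => ?_
  rw [ENNReal.toReal_ofReal (by positivity)]
  rfl

theorem traceInf_corner_ne_top (h1 : (adjoint ι) ∘L ι = 1) (h2 : ι ∘L (adjoint ι) = P.1)
    (hfin : traceInf P ≠ ∞) (T : (cornerAlg (amplification A.alg) ι).toStarSubalgebra) :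
    traceInf (star (cornerIncl h1 h2 T) * cornerIncl h1 h2 T) ≠ ∞ := by
  rw [← tsum_norm_sq_corner]
  refine ((summable_norm_sq_corner h1 h2 hfin).mul_left (‖T.1‖ ^ 2)).of_nonneg_of_le
    (fun p => by positivity) (fun p => ?_) |>.tsum_ofReal_ne_top
  rw [← mul_pow]
  gcongr
  exact T.1.le_opNorm _

theorem summable_inner_corner (hs : Summable fun p => ‖(adjoint ι) (A.ampVec p)‖ ^ 2) (T : L →L[ℂ] L) :
    Summable fun p => inner ℂ ((adjoint ι) (A.ampVec p)) (T ((adjoint ι) (A.ampVec p))) := by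
  refine Summable.of_norm_bounded (hs.mul_left ‖T‖) fun p => ?_
  refine (norm_inner_le_norm _ _).trans ?_
  nlinarith [T.le_opNorm ((adjoint ι) (A.ampVec p)), norm_nonneg ((adjoint ι) (A.ampVec p))]

/-- The unnormalized trace of the corner. -/
def cornerTrace (hs : Summable fun p => ‖(adjoint ι) (A.ampVec p)‖ ^ 2) :
    (cornerAlg (amplification A.alg) ι).toStarSubalgebra →ₗ[ℂ] ℂ where
  toFun T := ∑' p, inner ℂ ((adjoint ι) (A.ampVec p)) (T.1 ((adjoint ι) (A.ampVec p)))
  map_add' S T := by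
    rw [← (summable_inner_corner hs S.1).tsum_add (summable_inner_corner hs T.1)]
    exact tsum_congr fun p => inner_add_right _ _ _
  map_smul' c T := by
    rw [RingHom.id_apply, smul_eq_mul, ← tsum_mul_left]
    exact tsum_congr fun p => inner_smul_right _ _ _

theorem cornerTrace_star_mul (h1 : (adjoint ι) ∘L ι = 1) (h2 : ι ∘L (adjoint ι) = P.1)
    (hs : Summable fun p => ‖(adjoint ι) (A.ampVec p)‖ ^ 2)
    (T : (cornerAlg (amplification A.alg) ι).toStarSubalgebra) :
    cornerTrace hs (star T * T) =
      (((traceInf (star (cornerIncl h1 h2 T) * cornerIncl h1 h2 T)).toReal : ℝ) : ℂ) := by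
  have h3 : ∀ v, inner ℂ v ((star T * T).1 v) = ((‖T.1 v‖ ^ 2 : ℝ) : ℂ) := fun v => by
    change inner ℂ v ((star T.1) (T.1 v)) = _
    rw [ContinuousLinearMap.star_eq_adjoint, ContinuousLinearMap.adjoint_inner_right,
      inner_self_eq_norm_sq_to_K]
    norm_cast
  change ∑' p, inner ℂ ((adjoint ι) (A.ampVec p)) ((star T * T).1 ((adjoint ι) (A.ampVec p))) = _
  simp_rw [h3]
  rw [← tsum_norm_sq_corner h1 h2, ENNReal.tsum_toReal_eq (fun _ => ENNReal.ofReal_ne_top),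
    ← Complex.ofReal_tsum]
  congr 1
  exact tsum_congr fun p => (ENNReal.toReal_ofReal (by positivity)).symm

theorem hasSum_cornerTrace (h1 : (adjoint ι) ∘L ι = 1) (h2 : ι ∘L (adjoint ι) = P.1)
    (hs : Summable fun p => ‖(adjoint ι) (A.ampVec p)‖ ^ 2)
    (T : (cornerAlg (amplification A.alg) ι).toStarSubalgebra) :
    HasSum (fun i => A.τ (entry (cornerIncl h1 h2 T) i i)) (cornerTrace hs T) := by
  refine (summable_inner_corner hs T.1).hasSum.prod_fiberwise fun i => ?_
  convert hasSum_ampVec (cornerIncl h1 h2 T) i using 2 with n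
  rw [ContinuousLinearMap.adjoint_inner_left]
  rfl

/-- The corner `P M_∞ P` of a projection of finite nonzero trace, with its normalized trace. -/
def cornerTracialVN (h1 : (adjoint ι) ∘L ι = 1) (h2 : ι ∘L (adjoint ι) = P.1) (hfin : traceInf P ≠ ∞)
    (hpos : traceInf P ≠ 0) : TracialVN.{u} where
  Space := L
  alg := cornerAlg (amplification A.alg) ι
  τ := (((traceInf P).toReal⁻¹ : ℝ) : ℂ) • cornerTrace (summable_norm_sq_corner h1 h2 hfin)
  normal := by
    have hs := summable_norm_sq_corner h1 h2 hfin
    -- Normality of the corner trace: the vectors of the trace of `M_∞`, indexed by pairs, are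
    -- pulled back by `ι*` and enumerated by `ℕ`. The normalization is put on one side only.
    refine ⟨fun k => (adjoint ι) (A.ampVec k.unpair),
      fun k => (((traceInf P).toReal⁻¹ : ℝ) : ℂ) • (adjoint ι) (A.ampVec k.unpair), ?_, ?_, fun x => ?_⟩
    · exact (Nat.pairEquiv.symm.summable_iff (f := fun p => ‖(adjoint ι) (A.ampVec p)‖ ^ 2)).2 hs
    · simp_rw [norm_smul, mul_pow]
      exact ((Nat.pairEquiv.symm.summable_iff (f := fun p => ‖(adjoint ι) (A.ampVec p)‖ ^ 2)).2 hs).mul_left _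
    · have h3 := (Nat.pairEquiv.symm.hasSum_iff).2 (summable_inner_corner hs x.1).hasSum
      simp_rw [inner_smul_left, Complex.conj_ofReal]
      exact h3.mul_left _
  nonneg x := by
    change 0 ≤ (((traceInf P).toReal⁻¹ : ℝ) : ℂ) * _
    rw [cornerTrace_star_mul h1 h2, ← Complex.ofReal_mul, ← Complex.ofReal_zero,
      Complex.real_le_real]
    positivity
  map_one := by
    have h := cornerTrace_star_mul h1 h2 (summable_norm_sq_corner h1 h2 hfin) 1
    rw [← map_star, ← map_mul, star_one, one_mul, cornerIncl_one] at h
    change (((traceInf P).toReal⁻¹ : ℝ) : ℂ) * _ = 1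
    rw [h, ← Complex.ofReal_mul, inv_mul_cancel₀ (ENNReal.toReal_ne_zero.2 ⟨hpos, hfin⟩),
      Complex.ofReal_one]
  faithful x hx := by
    have h3 : (((traceInf P).toReal⁻¹ : ℝ) : ℂ) * cornerTrace (summable_norm_sq_corner h1 h2 hfin)
      (star x * x) = 0 := hx
    rw [mul_eq_zero, Complex.ofReal_eq_zero, inv_eq_zero] at h3
    have h4 := h3.resolve_left (ENNReal.toReal_ne_zero.2 ⟨hpos, hfin⟩)
    rw [cornerTrace_star_mul h1 h2, Complex.ofReal_eq_zero, ENNReal.toReal_eq_zero_iff] at h4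
    have h5 := eq_zero_of_traceInf_eq_zero
      (h4.resolve_right (traceInf_corner_ne_top h1 h2 hfin x))
    exact cornerIncl_injective h1 h2 (h5.trans (map_zero (cornerIncl h1 h2)).symm)
  tracial x y := by
    refine mul_comm_of_star_mul_self
      ((((traceInf P).toReal⁻¹ : ℝ) : ℂ) • cornerTrace (summable_norm_sq_corner h1 h2 hfin)) ?_ x y
    intro x
    have h3 := cornerTrace_star_mul h1 h2 (summable_norm_sq_corner h1 h2 hfin) (star x)
    rw [star_star] at h3
    rw [LinearMap.smul_apply, LinearMap.smul_apply, cornerTrace_star_mul h1 h2, h3, map_star,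
      star_star, traceInf_mul_star_self]

theorem normSq_cornerTracialVN (h1 : (adjoint ι) ∘L ι = 1) (h2 : ι ∘L (adjoint ι) = P.1)
    (hfin : traceInf P ≠ ∞) (hpos : traceInf P ≠ 0) (x : (cornerTracialVN h1 h2 hfin hpos).Elt) :
    normSq x = (traceInf P).toReal⁻¹ *
      (traceInf (star (cornerIncl h1 h2 x) * cornerIncl h1 h2 x)).toReal := by
  change ((((traceInf P).toReal⁻¹ : ℝ) : ℂ) *
    cornerTrace (summable_norm_sq_corner h1 h2 hfin) (star x * x)).re = _
  have h := cornerTrace_star_mul h1 h2 (summable_norm_sq_corner h1 h2 hfin) x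
  refine (congrArg (fun z => ((((traceInf P).toReal⁻¹ : ℝ) : ℂ) * z).re) h).trans ?_
  rw [← Complex.ofReal_mul, Complex.ofReal_re]

theorem hasSum_cornerTracialVN (h1 : (adjoint ι) ∘L ι = 1) (h2 : ι ∘L (adjoint ι) = P.1)
    (hfin : traceInf P ≠ ∞) (hpos : traceInf P ≠ 0) (x : (cornerTracialVN h1 h2 hfin hpos).Elt) :
    HasSum (fun i => A.τ (entry (cornerIncl h1 h2 x) i i))
      (((traceInf P).toReal : ℂ) * (cornerTracialVN h1 h2 hfin hpos).τ x) := by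
  have h := hasSum_cornerTrace h1 h2 (summable_norm_sq_corner h1 h2 hfin) x
  convert h using 1
  change _ * ((((traceInf P).toReal⁻¹ : ℝ) : ℂ) * _) = _
  rw [← mul_assoc, ← Complex.ofReal_mul, mul_inv_cancel₀ (ENNReal.toReal_ne_zero.2 ⟨hpos, hfin⟩),
    Complex.ofReal_one, one_mul]

theorem mul_cornerIncl (h1 : (adjoint ι) ∘L ι = 1) (h2 : ι ∘L (adjoint ι) = P.1)
    (x : (cornerAlg (amplification A.alg) ι).toStarSubalgebra) :
    P * cornerIncl h1 h2 x = cornerIncl h1 h2 x := by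
  have h := map_mul (cornerIncl h1 h2) 1 x
  rw [one_mul, cornerIncl_one] at h
  exact h.symm

theorem cornerIncl_mul (h1 : (adjoint ι) ∘L ι = 1) (h2 : ι ∘L (adjoint ι) = P.1)
    (x : (cornerAlg (amplification A.alg) ι).toStarSubalgebra) :
    cornerIncl h1 h2 x * P = cornerIncl h1 h2 x := by
  have h := map_mul (cornerIncl h1 h2) x 1
  rw [mul_one, cornerIncl_one] at h
  exact h.symm

theorem exists_cornerIncl_eq (h1 : (adjoint ι) ∘L ι = 1) (h2 : ι ∘L (adjoint ι) = P.1) {T : A.Amp}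
    (hT : P * T * P = T) : ∃ x, cornerIncl h1 h2 x = T := by
  have h3 : ι ∘L ((adjoint ι) ∘L T.1 ∘L ι) ∘L (adjoint ι) = T.1 := by
    have h4 := congrArg Subtype.val hT
    change P.1 ∘L T.1 ∘L P.1 = T.1 at h4
    rw [← h2] at h4
    simpa only [ContinuousLinearMap.comp_assoc] using h4
  exact ⟨⟨(adjoint ι) ∘L T.1 ∘L ι, (mem_cornerAlg_iff h1 (h2 ▸ P.2)).2 (h3.symm ▸ T.2)⟩,
    Subtype.ext h3⟩

theorem isFiniteDilation_cornerTracialVN (h1 : (adjoint ι) ∘L ι = 1)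
    (h2 : ι ∘L (adjoint ι) = P.1) (hfin : traceInf P ≠ ∞) (hpos : traceInf P ≠ 0)
    (hP : IsStarProjection P) {w : A.Amp} (hw : star w * w = corner 1) (hPw : P * w = w) :
    IsFiniteDilation A (cornerTracialVN h1 h2 hfin hpos) := by
  refine ⟨P, w, cornerIncl h1 h2, hP, hfin, hw, hPw, cornerIncl_injective h1 h2, ?_,
    hasSum_cornerTracialVN h1 h2 hfin hpos⟩
  ext T
  constructor
  · rintro ⟨x, rfl⟩
    exact (congrArg (· * P) (mul_cornerIncl h1 h2 x)).trans (cornerIncl_mul h1 h2 x)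
  · exact fun h => exists_cornerIncl_eq h1 h2 h

/-- A projection of `M_∞` is the range projection of an isometry. -/
theorem exists_isometry_of_isStarProjection (hP : IsStarProjection P) :
    ∃ (L : Type u) (_ : NormedAddCommGroup L) (_ : InnerProductSpace ℂ L) (_ : CompleteSpace L)
      (ι : L →L[ℂ] AmpSpace A.Space), (adjoint ι) ∘L ι = 1 ∧ ι ∘L (adjoint ι) = P.1 := by
  have hP' : IsStarProjection P.1 :=
    ⟨congrArg Subtype.val hP.isIdempotentElem, congrArg Subtype.val hP.isSelfAdjoint.star_eq⟩
  obtain ⟨U, hU, hPU⟩ := isStarProjection_iff_eq_starProjection.1 hP'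
  have : CompleteSpace U := by
    have h : (U : Set (AmpSpace A.Space)) = {v | P.1 v = v} := by
      ext v
      rw [hPU, Set.mem_ofPred_eq, Submodule.starProjection_eq_self_iff, SetLike.mem_coe]
    have h3 : IsClosed (U : Set (AmpSpace A.Space)) :=
      h ▸ isClosed_eq P.1.continuous continuous_id
    exact h3.completeSpace_coe
  refine ⟨U, inferInstance, inferInstance, this, U.subtypeL, ?_, ?_⟩
  · rw [Submodule.adjoint_subtypeL]
    ext v
    simp
  · rw [Submodule.adjoint_subtypeL, hPU]
    rfl

end CornerTracial

/-! ### Hilbert–Schmidt estimates in the amplification. -/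

section HilbertSchmidt

theorem traceInf_star_mul_self_mul_le (S T : A.Amp) (hS : ‖S‖ ≤ 1) :
    traceInf (star (S * T) * (S * T)) ≤ traceInf (star T * T) := by
  rw [traceInf_star_mul_self', traceInf_star_mul_self']
  refine ENNReal.tsum_le_tsum fun p => ENNReal.ofReal_le_ofReal ?_
  gcongr
  simpa using S.1.le_of_opNorm_le hS (T.1 (A.ampVec p))

/-- Right multiplication is reduced to left multiplication by taking adjoints, thanks to traciality.
-/
theorem traceInf_star_mul_self_mul_le' (S T : A.Amp) (hS : ‖S‖ ≤ 1) :
    traceInf (star (T * S) * (T * S)) ≤ traceInf (star T * T) := by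
  rw [← traceInf_mul_star_self (T * S), ← traceInf_mul_star_self T]
  have := traceInf_star_mul_self_mul_le (star S) (star T) (by rwa [norm_star])
  rwa [← star_mul, star_star, star_star] at this

theorem traceInf_star_mul_self_add_le (S T : A.Amp) :
    traceInf (star (S + T) * (S + T)) ≤ 2 * traceInf (star S * S) + 2 * traceInf (star T * T) := by
  simp only [traceInf_star_mul_self']
  rw [← ENNReal.tsum_mul_left, ← ENNReal.tsum_mul_left, ← ENNReal.tsum_add]
  refine ENNReal.tsum_le_tsum fun p => ?_
  have h2 : ∀ r : ℝ, 2 * ENNReal.ofReal r = ENNReal.ofReal (2 * r) := fun r => by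
    rw [ENNReal.ofReal_mul zero_le_two, ENNReal.ofReal_ofNat]
  rw [h2, h2, ← ENNReal.ofReal_add (by positivity) (by positivity)]
  refine ENNReal.ofReal_le_ofReal ?_
  have h1 := norm_add_le (S.1 (A.ampVec p)) (T.1 (A.ampVec p))
  change ‖S.1 (A.ampVec p) + T.1 (A.ampVec p)‖ ^ 2 ≤ _
  nlinarith [norm_nonneg (S.1 (A.ampVec p) + T.1 (A.ampVec p)),
    sq_nonneg (‖S.1 (A.ampVec p)‖ - ‖T.1 (A.ampVec p)‖)]

theorem entry_corner (x : A.Elt) (i j : ℕ) :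
    entry (corner x) i j = if i = 0 ∧ j = 0 then x else 0 := by
  refine Subtype.ext ?_
  ext v
  change lp.single (E := fun _ : ℕ => A.Space) 2 0
    (x.1 (lp.single (E := fun _ : ℕ => A.Space) 2 j v 0)) i = _
  by_cases hi : i = 0
  · subst hi
    rw [lp.single_apply_self]
    by_cases hj : j = 0
    · subst hj
      rw [lp.single_apply_self]; simp
    · rw [lp.single_apply_ne _ _ _ (Ne.symm hj)]; simp [hj]
  · rw [lp.single_apply_ne _ _ _ hi]; simp [hi]

theorem ofReal_normSq_entry_le (T : A.Amp) :
    ENNReal.ofReal (normSq (entry T 0 0)) ≤ traceInf (star T * T) := by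
  rw [traceInf_star_mul_self]
  exact (ENNReal.le_tsum (f := fun j => ENNReal.ofReal (normSq (entry T j 0))) 0).trans
    (ENNReal.le_tsum (f := fun i => ∑' j, ENNReal.ofReal (normSq (entry T j i))) 0)

theorem traceInf_corner_star_mul (x : A.Elt) :
    traceInf (star (corner x) * corner x) = ENNReal.ofReal (normSq x) := by
  rw [traceInf_star_mul_self, tsum_eq_single 0, tsum_eq_single 0]
  · rw [entry_corner]; simp
  · intro j hj; rw [entry_corner]; simp [hj, normSq_zero]
  · intro i hi; simp [entry_corner, hi, normSq_zero]

theorem corner_mul (x y : A.Elt) : corner (x * y) = corner x * corner y := by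
  refine Subtype.ext (ContinuousLinearMap.ext fun f => ?_)
  change lp.single 2 0 (x.1 (y.1 (f 0))) = lp.single (E := fun _ : ℕ => A.Space) 2 0 (x.1
    (lp.single (E := fun _ : ℕ => A.Space) 2 0 (y.1 (f 0)) 0))
  rw [lp.single_apply_self]

theorem corner_star (x : A.Elt) : corner (star x) = star (corner x) := by
  refine amp_ext fun i j => ?_
  rw [entry_star, entry_corner, entry_corner]
  by_cases h : i = 0 ∧ j = 0
  · simp [h]
  · rw [if_neg h, if_neg (fun h' => h h'.symm), star_zero]

theorem corner_sub (x y : A.Elt) : corner (x - y) = corner x - corner y := by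
  refine amp_ext fun i j => ?_
  have : entry (corner x - corner y) i j = entry (corner x) i j - entry (corner y) i j := rfl
  rw [this, entry_corner, entry_corner, entry_corner]
  split_ifs <;> simp

theorem corner_entry {T : A.Amp} (h : corner 1 * T * corner 1 = T) : corner (entry T 0 0) = T := by
  refine Eq.trans ?_ h
  refine Subtype.ext (ContinuousLinearMap.ext fun f => ?_)
  rfl

theorem isStarProjection_corner_one : IsStarProjection (corner (1 : A.Elt)) :=
  ⟨by rw [IsIdempotentElem, ← corner_mul, mul_one], by
    rw [isSelfAdjoint_iff, ← corner_star, star_one]⟩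

theorem norm_le_one_of_star_mul_self {P T : A.Amp} (hP : IsStarProjection P) (h : star T * T = P) :
    ‖T‖ ≤ 1 := by
  have h1 := CStarRing.norm_star_mul_self (x := T)
  rw [h] at h1
  have h2 := hP.norm_le
  nlinarith [norm_nonneg T]

theorem traceInf_corner_one : traceInf (corner (1 : A.Elt)) = 1 := by
  have := traceInf_corner_star_mul (1 : A.Elt)
  rwa [isStarProjection_corner_one.isSelfAdjoint.star_eq,
    isStarProjection_corner_one.isIdempotentElem.eq, normSq_one, ENNReal.ofReal_one] at this

/-- The trace of the difference of two comparable projections. -/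
theorem traceInf_sub_add {P e : A.Amp} (hP : IsStarProjection P) (he : IsStarProjection e)
    (hPe : P * e = e) : traceInf (star (P - e) * (P - e)) + traceInf e = traceInf P := by
  have h1 : traceInf e = traceInf (star e * e) := by
    rw [he.isSelfAdjoint.star_eq, he.isIdempotentElem.eq]
  have h2 : traceInf P = traceInf (star P * P) := by
    rw [hP.isSelfAdjoint.star_eq, hP.isIdempotentElem.eq]
  rw [h1, h2, traceInf_star_mul_self', traceInf_star_mul_self', traceInf_star_mul_self',
    ← ENNReal.tsum_add]
  refine tsum_congr fun p => ?_
  rw [← ENNReal.ofReal_add (by positivity) (by positivity)]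
  congr 1
  have h3 : inner ℂ (e.1 (A.ampVec p)) ((P - e).1 (A.ampVec p)) = 0 := by
    have h4 : star e * (P - e) = 0 := by
      have h5 := congrArg star hPe
      rw [star_mul, he.isSelfAdjoint.star_eq, hP.isSelfAdjoint.star_eq] at h5
      rw [he.isSelfAdjoint.star_eq, mul_sub, h5, he.isIdempotentElem.eq, sub_self]
    have h5 := congrArg (fun T : A.Amp => T.1 (A.ampVec p)) h4
    change (star e.1) ((P - e).1 (A.ampVec p)) = 0 at h5
    rw [← ContinuousLinearMap.adjoint_inner_right, ← ContinuousLinearMap.star_eq_adjoint, h5,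
      inner_zero_right]
  have h6 := norm_add_sq (𝕜 := ℂ) (e.1 (A.ampVec p)) ((P - e).1 (A.ampVec p))
  rw [h3, RCLike.zero_re] at h6
  have h7 : e.1 (A.ampVec p) + (P - e).1 (A.ampVec p) = P.1 (A.ampVec p) := by
    change e.1 (A.ampVec p) + (P.1 (A.ampVec p) - e.1 (A.ampVec p)) = _
    abel
  rw [h7] at h6
  rw [h6]; ring

end HilbertSchmidt

end TracialVN

/-! ### Amplification of an isometry along a pairing of `ℕ × ℕ` with `ℕ`. -/

section AmpIsometry

variable {H L : Type u} [NormedAddCommGroup H] [InnerProductSpace ℂ H] [CompleteSpace H]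
  [NormedAddCommGroup L] [InnerProductSpace ℂ L] [CompleteSpace L]

theorem hasSum_norm_sq (f : AmpSpace H) : HasSum (fun i => ‖f i‖ ^ 2) (‖f‖ ^ 2) := by
  have h := (summable_norm_sq f).hasSum
  have := lp.norm_rpow_eq_tsum (p := 2) (by norm_num) f
  norm_num at this
  rwa [← this] at h

/-- `‖f‖² = ∑ᵢ ‖ι (f i)‖²`, and each term expands over the coordinates of `ι (f i)`; the double
series is then summed along the pairing. -/
theorem hasSum_norm_sq_unpair {ι : L →L[ℂ] AmpSpace H} (h1 : (adjoint ι) ∘L ι = 1)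
    (f : AmpSpace L) :
    HasSum (fun n : ℕ => ‖ι (f n.unpair.1) n.unpair.2‖ ^ 2) (‖f‖ ^ 2) := by
  have hn : ∀ v, ‖ι v‖ = ‖v‖ := (ContinuousLinearMap.norm_map_iff_adjoint_comp_self _).2 h1
  have h2 : ∀ i, HasSum (fun a => ‖ι (f i) a‖ ^ 2) (‖f i‖ ^ 2) := fun i => by
    have := hasSum_norm_sq (ι (f i))
    rwa [hn] at this
  have hs : Summable fun p : ℕ × ℕ => ‖ι (f p.1) p.2‖ ^ 2 := by
    refine (summable_prod_of_nonneg fun p => by positivity).2 ⟨fun i => (h2 i).summable, ?_⟩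
    simp_rw [(h2 _).tsum_eq]
    exact summable_norm_sq f
  have h3 : HasSum (fun p : ℕ × ℕ => ‖ι (f p.1) p.2‖ ^ 2) (‖f‖ ^ 2) := by
    have h4 := hs.hasSum
    rwa [(h4.prod_fiberwise h2).unique (hasSum_norm_sq f)] at h4
  exact (Nat.pairEquiv.symm.hasSum_iff (f := fun p : ℕ × ℕ => ‖ι (f p.1) p.2‖ ^ 2)).2 h3

/-- The isometry `ℓ²(ℕ, L) → ℓ²(ℕ × ℕ, H) = ℓ²(ℕ, H)` induced by an isometry `L → ℓ²(ℕ, H)`. -/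
theorem exists_ampIsometry {ι : L →L[ℂ] AmpSpace H} (h1 : (adjoint ι) ∘L ι = 1) :
    ∃ J : AmpSpace L →L[ℂ] AmpSpace H, (∀ f n, J f n = ι (f n.unpair.1) n.unpair.2) ∧
      (adjoint J) ∘L J = 1 ∧
      ∀ n x, (adjoint J) (lp.single 2 n x) =
        lp.single 2 n.unpair.1 ((adjoint ι) (lp.single 2 n.unpair.2 x)) := by
  let J₀ : AmpSpace L →ₗ[ℂ] AmpSpace H :=
    { toFun := fun f => ⟨fun n => ι (f n.unpair.1) n.unpair.2,
        memℓp_two_of_summable (hasSum_norm_sq_unpair h1 f).summable⟩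
      map_add' := fun f g => by ext n; simp; rfl
      map_smul' := fun c f => by ext n; simp }
  have hJ₀ : ∀ f, ‖J₀ f‖ = ‖f‖ := fun f => by
    have h2 := (hasSum_norm_sq (J₀ f)).unique (hasSum_norm_sq_unpair h1 f)
    exact (sq_eq_sq₀ (norm_nonneg _) (norm_nonneg _)).1 h2
  let J : AmpSpace L →L[ℂ] AmpSpace H := J₀.mkContinuous 1 fun f => by rw [hJ₀, one_mul]
  refine ⟨J, fun f n => rfl, (ContinuousLinearMap.norm_map_iff_adjoint_comp_self _).1 hJ₀,
    fun n x => ?_⟩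
  refine ext_inner_right ℂ fun f => ?_
  rw [ContinuousLinearMap.adjoint_inner_left, lp.inner_single_left, lp.inner_single_left,
    ContinuousLinearMap.adjoint_inner_left, lp.inner_single_left]
  rfl

/-- `T ↦ J T J*` for an isometry `J`. -/
def conjIsometry {E F : Type*} [NormedAddCommGroup E] [InnerProductSpace ℂ E] [CompleteSpace E]
    [NormedAddCommGroup F] [InnerProductSpace ℂ F] [CompleteSpace F] {J : E →L[ℂ] F}
    (hJ : (adjoint J) ∘L J = 1) : (E →L[ℂ] E) →⋆ₙₐ[ℂ] (F →L[ℂ] F) where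
  toFun T := J ∘L T ∘L (adjoint J)
  map_smul' c T := by ext; simp
  map_zero' := by ext; simp
  map_add' S T := by ext; simp
  map_mul' S T := by
    have e : ∀ v, (adjoint J) (J v) = v := fun v => congrArg (fun S : E →L[ℂ] E => S v) hJ
    ext v
    change J (S (T ((adjoint J) v))) = J (S ((adjoint J) (J (T ((adjoint J) v)))))
    rw [e]
  map_star' T := by
    simp only [ContinuousLinearMap.star_eq_adjoint, ContinuousLinearMap.adjoint_comp,
      ContinuousLinearMap.adjoint_adjoint, ContinuousLinearMap.comp_assoc]

end AmpIsometry

namespace TracialVN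

variable {A : TracialVN.{u}}

/-! ### Dilations of dilations inside `M_∞`. -/

section DilationEmbedding

variable {L : Type u} [NormedAddCommGroup L] [InnerProductSpace ℂ L] [CompleteSpace L]
  {ι : L →L[ℂ] AmpSpace A.Space} {P : A.Amp}

/-- The amplification of a corner `P M_∞ P` embeds in `M_∞`. -/
theorem exists_ampEmbedding (h1 : (adjoint ι) ∘L ι = 1) (h2 : ι ∘L (adjoint ι) = P.1)
    (hfin : traceInf P ≠ ∞) (hpos : traceInf P ≠ 0) :
    ∃ (D : (cornerTracialVN h1 h2 hfin hpos).Amp →⋆ₙₐ[ℂ] A.Amp) (V : A.Amp),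
      star V * V = P ∧ (∀ x, D (corner x) * V = V * cornerIncl h1 h2 x) ∧
      ∀ T, traceInf (star (D T) * D T) = traceInf P * traceInf (star T * T) := by
  obtain ⟨J, hJ, hJ1, hJ2⟩ := exists_ampIsometry h1
  have e1 : ∀ v, (adjoint ι) (ι v) = v := fun v => congrArg (fun S : L →L[ℂ] L => S v) h1
  have eJ : ∀ v, (adjoint J) (J v) = v :=
    fun v => congrArg (fun S : AmpSpace L →L[ℂ] AmpSpace L => S v) hJ1
  have hent : ∀ (T : (cornerTracialVN h1 h2 hfin hpos).Amp) (n m : ℕ),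
      matCoeff (J ∘L T.1 ∘L (adjoint J)) n m =
        (entry (cornerIncl h1 h2 (entry T n.unpair.1 m.unpair.1)) n.unpair.2 m.unpair.2).1 := by
    intro T n m
    ext v
    have h3 := congrArg (fun z => ι ((T.1 z) n.unpair.1) n.unpair.2) (hJ2 m v)
    exact (hJ _ n).trans h3
  let D : (cornerTracialVN h1 h2 hfin hpos).Amp →⋆ₙₐ[ℂ] A.Amp :=
    { toFun := fun T => ⟨J ∘L T.1 ∘L (adjoint J), fun n m => by
        rw [hent]; exact (entry _ _ _).2⟩
      map_smul' := fun c T => Subtype.ext (map_smul (conjIsometry hJ1) c T.1)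
      map_zero' := Subtype.ext (map_zero (conjIsometry hJ1))
      map_add' := fun S T => Subtype.ext (map_add (conjIsometry hJ1) S.1 T.1)
      map_mul' := fun S T => Subtype.ext (map_mul (conjIsometry hJ1) S.1 T.1)
      map_star' := fun T => Subtype.ext (map_star (conjIsometry hJ1) T.1) }
  have hD : ∀ T n m, entry (D T) n m =
      entry (cornerIncl h1 h2 (entry T n.unpair.1 m.unpair.1)) n.unpair.2 m.unpair.2 :=
    fun T n m => Subtype.ext (hent T n m)
  -- The embedding `D` is conjugation by `J`, which does not place the first corner of the
  -- amplification back on `P`. The partial isometry `V = J s₀ ι*` of `M_∞` relates the two copies.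
  let s₀ : L →L[ℂ] AmpSpace L := lp.singleContinuousLinearMap ℂ (fun _ : ℕ => L) 2 0
  have hV : ∀ n m, matCoeff (J ∘L s₀ ∘L (adjoint ι)) n m ∈ A.alg := by
    intro n m
    by_cases hn : n.unpair.1 = 0
    · have : matCoeff (J ∘L s₀ ∘L (adjoint ι)) n m = (entry P n.unpair.2 m).1 := by
        ext v
        have h3 : ι ((adjoint ι) (lp.single 2 m v)) = P.1 (lp.single 2 m v) :=
          congrArg (fun S : AmpSpace A.Space →L[ℂ] AmpSpace A.Space => S (lp.single 2 m v)) h2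
        change J (lp.single 2 0 ((adjoint ι) (lp.single 2 m v))) n = P.1 (lp.single 2 m v) _
        rw [hJ, hn, lp.single_apply_self, h3]
      rw [this]
      exact (entry _ _ _).2
    · have : matCoeff (J ∘L s₀ ∘L (adjoint ι)) n m = 0 := by
        ext v
        change J (lp.single 2 0 ((adjoint ι) (lp.single 2 m v))) n = 0
        rw [hJ, lp.single_apply_ne _ _ _ hn, map_zero]
        rfl
      rw [this]
      exact zero_mem A.alg
  have hs₀ : ∀ v, (adjoint s₀) (s₀ v) = v := fun v => by
    refine ext_inner_right ℂ fun v' => ?_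
    rw [ContinuousLinearMap.adjoint_inner_left]
    change inner ℂ (lp.single (E := fun _ : ℕ => L) 2 0 v) (lp.single 2 0 v') = _
    rw [lp.inner_single_left, lp.single_apply_self]
  refine ⟨D, ⟨J ∘L s₀ ∘L (adjoint ι), hV⟩, ?_, fun x => ?_, fun T => ?_⟩
  · refine Subtype.ext (ContinuousLinearMap.ext fun v => ?_)
    have h3 : ι ((adjoint ι) v) = P.1 v :=
      congrArg (fun S : AmpSpace A.Space →L[ℂ] AmpSpace A.Space => S v) h2
    change (star (J ∘L s₀ ∘L (adjoint ι))) (J (s₀ ((adjoint ι) v))) = _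
    rw [ContinuousLinearMap.star_eq_adjoint, ContinuousLinearMap.adjoint_comp,
      ContinuousLinearMap.adjoint_comp, ContinuousLinearMap.adjoint_adjoint]
    simp only [ContinuousLinearMap.comp_apply]
    rw [eJ, hs₀, h3]
  · refine Subtype.ext (ContinuousLinearMap.ext fun v => ?_)
    change J (lp.single (E := fun _ : ℕ => L) 2 0 (x.1 ((adjoint J) (J (lp.single (E := fun _ : ℕ => L) 2 0 ((adjoint ι) v))) 0))) =
      J (lp.single (E := fun _ : ℕ => L) 2 0 ((adjoint ι) (ι (x.1 ((adjoint ι) v)))))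
    rw [eJ, lp.single_apply_self]
    exact congrArg (fun z => J (lp.single (E := fun _ : ℕ => L) 2 0 z)) (e1 _).symm
  -- The corner carries the normalized trace, which explains the factor `traceInf P`. The general
  -- case follows entry by entry.
  · have hx : ∀ x : (cornerTracialVN h1 h2 hfin hpos).Elt,
        traceInf (star (cornerIncl h1 h2 x) * cornerIncl h1 h2 x) =
          traceInf P * ENNReal.ofReal (normSq x) := by
      intro x
      rw [normSq_cornerTracialVN, ENNReal.ofReal_mul (by positivity),
        ENNReal.ofReal_toReal (traceInf_corner_ne_top h1 h2 hfin x),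
        ENNReal.ofReal_inv_of_pos (ENNReal.toReal_pos hpos hfin), ENNReal.ofReal_toReal hfin,
        ← mul_assoc, ENNReal.mul_inv_cancel hpos hfin, one_mul]
    have hsum : ∀ f : ℕ × ℕ → ℝ≥0∞, ∑' n : ℕ, f n.unpair = ∑' i, ∑' a, f (i, a) := fun f => by
      rw [← ENNReal.tsum_prod (f := fun i a => f (i, a))]
      exact Nat.pairEquiv.symm.tsum_eq f
    rw [traceInf_star_mul_self, traceInf_star_mul_self]
    simp_rw [hD]
    rw [hsum fun p => ∑' m : ℕ, ENNReal.ofReal (normSq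
      (entry (cornerIncl h1 h2 (entry T m.unpair.1 p.1)) m.unpair.2 p.2)), ← ENNReal.tsum_mul_left]
    refine tsum_congr fun i => ?_
    rw [← ENNReal.tsum_mul_left]
    have h4 : ∀ a, ∑' m : ℕ, ENNReal.ofReal (normSq
      (entry (cornerIncl h1 h2 (entry T m.unpair.1 i)) m.unpair.2 a)) =
      ∑' j, ∑' b, ENNReal.ofReal (normSq (entry (cornerIncl h1 h2 (entry T j i)) b a)) := fun a =>
        hsum fun p => ENNReal.ofReal (normSq (entry (cornerIncl h1 h2 (entry T p.1 i)) p.2 a))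
    simp only [h4]
    rw [ENNReal.tsum_comm]
    refine tsum_congr fun j => ?_
    rw [← hx, traceInf_star_mul_self]

end DilationEmbedding

/-! ### Amplifications of relative commutants and diagonal unitaries. -/

section RelAmp

variable {G : Type v} [Group G] (ρ : G →* unitary A.Elt)

/-- The inclusion of amplifications `(ρ(G)' ∩ M)_∞ ⊆ M_∞`. -/
def relAmp : (relCommutant ρ).Amp →⋆ₙₐ[ℂ] A.Amp where
  toFun T := ⟨T.1, fun i j => relCommutantAlg_le ρ (T.2 i j)⟩
  map_smul' _ _ := rfl
  map_zero' := rfl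
  map_add' _ _ := rfl
  map_mul' _ _ := rfl
  map_star' _ := rfl

theorem traceInf_relAmp (T : (relCommutant ρ).Amp) : traceInf (relAmp ρ T) = traceInf T := rfl

theorem relAmp_corner (x : (relCommutant ρ).Elt) : relAmp ρ (corner x) = corner (relInclusion ρ x) :=
  rfl

/-- The diagonal elements `x ⊗ 1` of `M_∞`. -/
def ampDiag (x : A.Elt) : A.Amp := ⟨diagOp x.1, fun i j => by
  by_cases h : i = j
  · subst h
    refine (congrArg (· ∈ A.alg) (?_ : _ = x.1)).mpr x.2
    ext v
    rw [matCoeff_apply, diagOp_apply, lp.single_apply_self]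
  · refine (congrArg (· ∈ A.alg) (?_ : _ = (0 : A.Space →L[ℂ] A.Space))).mpr (zero_mem A.alg)
    ext v
    rw [matCoeff_apply, diagOp_apply, lp.single_apply_ne _ _ _ h, map_zero]
    rfl⟩

theorem ampDiag_mul (x y : A.Elt) : ampDiag (x * y) = ampDiag x * ampDiag y :=
  Subtype.ext (diagOp_mul _ _)

theorem ampDiag_star (x : A.Elt) : ampDiag (star x) = star (ampDiag x) :=
  Subtype.ext (star_diagOp _).symm

theorem ampDiag_one : ampDiag (1 : A.Elt) = 1 :=
  Subtype.ext (by ext f i; change diagOp 1 f i = f i; rw [diagOp_apply]; rfl)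

theorem ampDiag_mul_corner (x y : A.Elt) : ampDiag x * corner y = corner (x * y) := by
  refine Subtype.ext (ContinuousLinearMap.ext fun f => ?_)
  ext i
  change diagOp x.1 (lp.single 2 0 (y.1 (f 0))) i = lp.single (E := fun _ : ℕ => A.Space) 2 0 (x.1 (y.1 (f 0))) i
  rw [diagOp_apply]
  by_cases h : i = 0
  · subst h
    rw [lp.single_apply_self, lp.single_apply_self]
  · rw [lp.single_apply_ne _ _ _ h, lp.single_apply_ne _ _ _ h, map_zero]

/-- `ρ g` commutes with every matrix entry of `T`, so `ρ g ⊗ 1` commutes with `T`. This is the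
source of the commutation of the two representations built below. -/
theorem commute_ampDiag_relAmp (g : G) (T : (relCommutant ρ).Amp) :
    ampDiag (ρ g : A.Elt) * relAmp ρ T = relAmp ρ T * ampDiag (ρ g : A.Elt) := by
  have h := (mem_centralizer_diag_iff (relCommutantAlg ρ) T.1).2 T.2
  refine Subtype.ext (StarSubalgebra.mem_centralizer_iff ℂ |>.1 h (diagOp (ρ g : A.Elt).1) ⟨_, ?_, fun f i => diagOp_apply _ _ _⟩).1
  rw [VonNeumannAlgebra.mem_commutant_iff]
  intro x hx
  exact congrArg Subtype.val (commute_relInclusion ρ ⟨x, hx⟩ g).symm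

end RelAmp

end TracialVN

namespace TracialVN

variable {A : TracialVN.{u}}

/-! ### Compressions by isometries and their commutators. -/

section Compression

variable {P w : A.Amp}

theorem mul_corner_one (hw : star w * w = corner 1) : w * corner 1 = w := by
  have h1 : corner (1 : A.Elt) * corner 1 = corner 1 := isStarProjection_corner_one.isIdempotentElem.eq
  have h2 : star (corner (1 : A.Elt)) = corner 1 := isStarProjection_corner_one.isSelfAdjoint.star_eq
  have h : star (w * corner 1 - w) * (w * corner 1 - w) = 0 := by
    rw [star_sub, star_mul, h2, sub_mul, mul_sub, mul_sub]
    simp only [mul_assoc]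
    rw [← mul_assoc (star w), hw, h1, h1]
    simp
  exact sub_eq_zero.1 ((CStarRing.star_mul_self_eq_zero_iff _).1 h)

theorem corner_one_mul_star (hw : star w * w = corner 1) : corner 1 * star w = star w := by
  have := congrArg star (mul_corner_one hw)
  rwa [star_mul, isStarProjection_corner_one.isSelfAdjoint.star_eq] at this

theorem corner_entry_compression (hw : star w * w = corner 1) (T : A.Amp) :
    corner (entry (star w * T * w) 0 0) = star w * T * w := by
  refine corner_entry ?_
  rw [mul_assoc (star w), ← mul_assoc, corner_one_mul_star hw, mul_assoc, mul_assoc,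
    mul_corner_one hw]

theorem isStarProjection_mul_star (hw : star w * w = corner 1) : IsStarProjection (w * star w) :=
  ⟨by rw [IsIdempotentElem, mul_assoc, ← mul_assoc (star w), hw, corner_one_mul_star hw],
    by rw [isSelfAdjoint_iff, star_mul, star_star]⟩

theorem traceInf_mul_star (hw : star w * w = corner 1) : traceInf (w * star w) = 1 := by
  rw [traceInf_mul_star_self, hw, traceInf_corner_one]

theorem norm_isometry_le (hw : star w * w = corner 1) : ‖w‖ ≤ 1 :=
  norm_le_one_of_star_mul_self isStarProjection_corner_one hw

theorem traceInf_conj_le (hw : star w * w = corner 1) (T : A.Amp) :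
    traceInf (star (w * T * star w) * (w * T * star w)) ≤ traceInf (star T * T) :=
  (traceInf_star_mul_self_mul_le' _ _ (by rw [norm_star]; exact norm_isometry_le hw)).trans
    (traceInf_star_mul_self_mul_le _ _ (norm_isometry_le hw))

theorem traceInf_conj_le' (hw : star w * w = corner 1) (T : A.Amp) :
    traceInf (star (star w * T * w) * (star w * T * w)) ≤ traceInf (star T * T) :=
  (traceInf_star_mul_self_mul_le' _ _ (norm_isometry_le hw)).trans
    (traceInf_star_mul_self_mul_le _ _ (by rw [norm_star]; exact norm_isometry_le hw))

/-- Replacing `a` by `p` changes the commutator by `[v, p - a]`, whose two terms have the 2-norm of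
`p - a`. -/
theorem normSq_commutator_le (p a : A.Elt) {v : A.Elt} (hv : v ∈ unitary A.Elt) :
    normSq (a * v - v * a) ≤ 8 * normSq (p - a) + 2 * normSq (p * v - v * p) := by
  have h1 : a * v - v * a = (v * (p - a) - (p - a) * v) + (p * v - v * p) := by noncomm_ring
  have h2 := normSq_add_le (v * (p - a) - (p - a) * v) (p * v - v * p)
  have h3 := normSq_sub_le (v * (p - a)) 0 ((p - a) * v)
  rw [sub_zero, zero_sub, normSq_neg, normSq_unitary_mul hv, normSq_mul_unitary hv] at h3
  rw [h1]
  linarith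

/-- The commutator of `π` with the image of a unitary of `M` under the isometry `w`. -/
theorem traceInf_commutator_le (hP : IsStarProjection P) (hw : star w * w = corner 1)
    (hPw : P * w = w) {π : A.Amp} (hπ : ‖π‖ ≤ 1) (hπP : P * π = π) (hπP' : π * P = π)
    (p : A.Elt) {v : A.Elt} (hv : v ∈ unitary A.Elt) :
    traceInf (star (π * (w * corner v * star w) - (w * corner v * star w) * π) *
        (π * (w * corner v * star w) - (w * corner v * star w) * π)) ≤
      ENNReal.ofReal (16 * normSq (p - entry (star w * π * w) 0 0) +
        4 * normSq (p * v - v * p)) + 8 * (traceInf P - 1) := by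
  set X := w * corner v * star w with hX
  set e := w * star w with he
  set a := entry (star w * π * w) 0 0 with ha
  have hca : corner a = star w * π * w := corner_entry_compression hw π
  -- `P = e + (P - e)` splits the commutator: compressed by `e = w w*` it is the commutator of `a`
  -- and `v` in `M`, and the remaining terms contain `P - e`, whose trace is `traceInf P - 1`.
  have h1 : π * X - X * π = w * corner (a * v - v * a) * star w +
      ((P - e) * (π * X) - (X * π) * (P - e)) := by
    have e1 : w * corner (a * v - v * a) * star w = e * (π * X) - (X * π) * e := by
      rw [corner_sub, corner_mul, corner_mul, hca, he, hX]
      noncomm_ring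
    rw [e1, sub_mul, mul_sub, ← mul_assoc P, hπP, mul_assoc X π P, hπP']
    noncomm_ring
  have hXn : ‖X‖ ≤ 1 := by
    have hv' : ‖corner v‖ ≤ 1 := by
      refine norm_le_one_of_star_mul_self isStarProjection_corner_one ?_
      rw [← corner_star, ← corner_mul, hv.1]
    have hwn := norm_isometry_le hw
    calc ‖X‖ ≤ ‖w * corner v‖ * ‖star w‖ := norm_mul_le _ _
      _ ≤ (‖w‖ * ‖corner v‖) * ‖star w‖ := by gcongr; exact norm_mul_le _ _
      _ ≤ (1 * 1) * 1 := by gcongr; rw [norm_star]; exact hwn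
      _ = 1 := by norm_num
  have hprod : ∀ S T : A.Amp, ‖S‖ ≤ 1 → ‖T‖ ≤ 1 → ‖S * T‖ ≤ 1 := fun S T hS hT =>
    (norm_mul_le _ _).trans (mul_le_one₀ hS (norm_nonneg _) hT)
  have hPe : traceInf (star (P - e) * (P - e)) = traceInf P - 1 := by
    rw [← traceInf_sub_add hP (isStarProjection_mul_star hw) (by rw [← mul_assoc, hPw]), traceInf_mul_star hw]
    exact (ENNReal.add_sub_cancel_right ENNReal.one_ne_top).symm
  rw [h1]
  refine (traceInf_star_mul_self_add_le _ _).trans ?_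
  have h2 : traceInf (star (w * corner (a * v - v * a) * star w) *
      (w * corner (a * v - v * a) * star w)) ≤
      ENNReal.ofReal (8 * normSq (p - a) + 2 * normSq (p * v - v * p)) := by
    refine (traceInf_conj_le hw _).trans ?_
    rw [traceInf_corner_star_mul]
    exact ENNReal.ofReal_le_ofReal (normSq_commutator_le p a hv)
  have h3 : traceInf (star ((P - e) * (π * X) - (X * π) * (P - e)) *
      ((P - e) * (π * X) - (X * π) * (P - e))) ≤ 4 * (traceInf P - 1) := by
    rw [sub_eq_add_neg]
    refine (traceInf_star_mul_self_add_le _ _).trans ?_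
    rw [star_neg, neg_mul_neg]
    have h4 := traceInf_star_mul_self_mul_le' (π * X) (P - e) (hprod _ _ hπ hXn)
    have h5 := traceInf_star_mul_self_mul_le (X * π) (P - e) (hprod _ _ hXn hπ)
    rw [hPe] at h4 h5
    calc _ ≤ 2 * (traceInf P - 1) + 2 * (traceInf P - 1) := by gcongr
      _ = 4 * (traceInf P - 1) := by rw [← add_mul]; norm_num
  calc _ ≤ 2 * ENNReal.ofReal (8 * normSq (p - a) + 2 * normSq (p * v - v * p)) +
        2 * (4 * (traceInf P - 1)) := by gcongr
    _ = _ := by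
      rw [← mul_assoc, ← ENNReal.ofReal_ofNat 2, ← ENNReal.ofReal_mul (by positivity)]
      congr 2
      · ring
      · rw [ENNReal.ofReal_ofNat]; norm_num

end Compression

end TracialVN

namespace TracialVN

variable {A : TracialVN.{u}}

/-- The dilation `P M_∞ P`, together with the embedding in `M_∞` of its own amplification. -/
theorem exists_finiteDilation {P w : A.Amp} (hP : IsStarProjection P) (hfin : traceInf P ≠ ∞)
    (hpos : traceInf P ≠ 0) (hw : star w * w = corner 1) (hPw : P * w = w) :
    ∃ (B : TracialVN.{u}) (j : B.Elt →⋆ₙₐ[ℂ] A.Amp) (D : B.Amp →⋆ₙₐ[ℂ] A.Amp) (V : A.Amp),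
      IsFiniteDilation A B ∧ j 1 = P ∧ Function.Injective j ∧ (∀ T, P * T * P = T → ∃ x, j x = T) ∧
      star V * V = P ∧ (∀ x, D (corner x) * V = V * j x) ∧
      (∀ T, traceInf (star (D T) * D T) = traceInf P * traceInf (star T * T)) ∧
      ∀ x, traceInf (star (j x) * j x) = traceInf P * ENNReal.ofReal (normSq x) := by
  obtain ⟨L, _, _, _, ι, h1, h2⟩ := exists_isometry_of_isStarProjection hP
  obtain ⟨D, V, hV, hD, hD'⟩ := exists_ampEmbedding h1 h2 hfin hpos
  refine ⟨cornerTracialVN h1 h2 hfin hpos, cornerIncl h1 h2, D, V,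
    isFiniteDilation_cornerTracialVN h1 h2 hfin hpos hP hw hPw, cornerIncl_one h1 h2,
    cornerIncl_injective h1 h2, fun T => exists_cornerIncl_eq h1 h2, hV, hD, hD', fun x => ?_⟩
  rw [normSq_cornerTracialVN, ENNReal.ofReal_mul (by positivity),
    ENNReal.ofReal_toReal (traceInf_corner_ne_top h1 h2 hfin x),
    ENNReal.ofReal_inv_of_pos (ENNReal.toReal_pos hpos hfin), ENNReal.ofReal_toReal hfin,
    ← mul_assoc, ENNReal.mul_inv_cancel hpos hfin, one_mul]
  rfl

end TracialVN

theorem integrable_of_abs_le {G : Type*} [MeasurableSpace G] [DiscreteMeasurableSpace G] [Countable G]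
    {μ : Measure G} [IsFiniteMeasure μ] {f : G → ℝ} {c : ℝ} (h : ∀ g, |f g| ≤ c) : Integrable f μ :=
  Integrable.of_bound (Measurable.of_discrete).aestronglyMeasurable c (Eventually.of_forall h)

section StarHom

variable {R S : Type*} [Semiring R] [StarRing R] [Algebra ℂ R] [Semiring S] [StarRing S] [Algebra ℂ S]
  (D : R →⋆ₙₐ[ℂ] S) {a b : R}

theorem map_mul_comm_of_comm (h : a * b = b * a) : D a * D b = D b * D a := by
  rw [← map_mul, h, map_mul]

theorem map_mul_cancel (h : a = 1) (b : R) : D a * D b = D b := by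
  rw [← map_mul, h, one_mul]

theorem map_star_mul_cancel (h : star a * a = 1) (b : R) : star (D a) * D a * D b = D b := by
  rw [← map_star, ← map_mul, ← map_mul, h, one_mul]

theorem map_mul_star_cancel (h : a * star a = 1) (b : R) : D a * star (D a) * D b = D b := by
  rw [← map_star, ← map_mul, ← map_mul, h, one_mul]

end StarHom

/-! ### Dilations in which almost commuting unitaries become commuting. -/

namespace TracialVN

variable {A : TracialVN.{u}}

theorem normSq_sub_le_four {x y : A.Elt} (hx : normSq x ≤ 1) (hy : normSq y ≤ 1) :
    normSq (x - y) ≤ 4 := by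
  have := normSq_sub_le x 0 y
  rw [sub_zero, zero_sub, normSq_neg] at this
  linarith

theorem abs_normSq_sub_le_four {x y : A.Elt} (hx : normSq x ≤ 1) (hy : normSq y ≤ 1) :
    |normSq (x - y)| ≤ 4 := by
  rw [abs_of_nonneg (normSq_nonneg _)]
  exact normSq_sub_le_four hx hy

theorem normSq_unitary_mul_le {x y : A.Elt} (hx : x ∈ unitary A.Elt) (hy : y ∈ unitary A.Elt) :
    normSq (x * y) ≤ 1 := (normSq_unitary (mul_mem hx hy)).le

theorem normSq_entry_compression_le {w π : A.Amp} (hw : star w * w = corner 1) (hπ : ‖π‖ ≤ 1) :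
    normSq (entry (star w * π * w) 0 0) ≤ 1 := by
  have hS : ‖star w * π‖ ≤ 1 := (norm_mul_le _ _).trans
    (mul_le_one₀ (by rw [norm_star]; exact norm_isometry_le hw) (norm_nonneg _) hπ)
  have h := (ofReal_normSq_entry_le (star w * π * w)).trans
    (traceInf_star_mul_self_mul_le (star w * π) w hS)
  rwa [hw, traceInf_corner_one, ENNReal.ofReal_le_one] at h

variable {G : Type v} [Group G] [Countable G] [MeasurableSpace G] [DiscreteMeasurableSpace G]

theorem integral_le_of_le_add {G : Type v} [MeasurableSpace G] {μ : Measure G} [IsProbabilityMeasure μ] {f f₁ f₂ : G → ℝ} {a b c d : ℝ}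
    (ha : 0 ≤ a) (hf : ∀ g, 0 ≤ f g) (h₁ : Integrable f₁ μ) (h₂ : Integrable f₂ μ)
    (h : ∀ g, f g ≤ a * f₁ g + b * f₂ g + c) (hd : ∫ g, f₁ g ∂μ ≤ d) :
    ∫ g, f g ∂μ ≤ a * d + b * ∫ g, f₂ g ∂μ + c := by
  have h3 : ∫ g, f g ∂μ ≤ ∫ g, (a * f₁ g + b * f₂ g + c) ∂μ :=
    integral_mono_of_nonneg (Eventually.of_forall hf)
      (((h₁.const_mul _).add (h₂.const_mul _)).add (integrable_const _)) (Eventually.of_forall h)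
  have h4 : ∫ g, (a * f₁ g + b * f₂ g + c) ∂μ = a * ∫ g, f₁ g ∂μ + b * ∫ g, f₂ g ∂μ + c := by
    have e1 := integral_add ((h₁.const_mul a).add (h₂.const_mul b)) (integrable_const (μ := μ) c)
    have e2 := integral_add (h₁.const_mul a) (h₂.const_mul b)
    rw [integral_const_mul, integral_const_mul] at e2
    simp only [Pi.add_apply, integral_const, probReal_univ, one_smul] at e1
    rw [e1, e2]
  rw [h4] at h3
  have := mul_le_mul_of_nonneg_left hd ha
  linarith

/-- Under the hypotheses of spectral gap, unitaries of `M` which almost commute with `p` are close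
to unitaries of the dilation which commute with the representation `ρ`. -/
theorem exists_unitary_relCommutant_near {B : TracialVN.{u}} {j : B.Elt →⋆ₙₐ[ℂ] A.Amp}
    (ρ : G →* unitary B.Elt) {μ : Measure G} [IsProbabilityMeasure μ] {κ : ℝ}
    (hκ : 0 ≤ κ) (hgap : HasSpectralGap.{u} G fun f => κ / 2 * ∫ g, f g ∂μ) {d : ℝ} (hd : 0 ≤ d)
    {P w : A.Amp} {π : G → A.Amp} {p : G → unitary A.Elt} (hP : IsStarProjection P)
    (hw : star w * w = corner 1) (hPw : P * w = w) (ht1 : 1 ≤ traceInf P)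
    (htr : traceInf P ≤ ENNReal.ofReal (1 + d))
    (hjinj : Function.Injective j) (hjsurj : ∀ T, P * T * P = T → ∃ x, j x = T)
    (hj : ∀ x, traceInf (star (j x) * j x) = traceInf P * ENNReal.ofReal (normSq x))
    (hjρ : ∀ g, j (ρ g : B.Elt) = π g) (hπ1 : ∀ g, ‖π g‖ ≤ 1) (hPπ : ∀ g, P * π g = π g)
    (hπP : ∀ g, π g * P = π g)
    (hint : ∫ g, normSq ((p g : A.Elt) - entry (star w * π g * w) 0 0) ∂μ ≤ d)
    {v : A.Elt} (hv : v ∈ unitary A.Elt) :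
    ∃ u : unitary (relCommutant ρ).Elt,
      traceInf (star (j (relInclusion ρ u) - w * corner v * star w) *
        (j (relInclusion ρ u) - w * corner v * star w)) ≤
          traceInf P * ENNReal.ofReal (6 * d + 72 * κ * d +
            12 * κ * ∫ g, normSq ((p g : A.Elt) * v - v * (p g : A.Elt)) ∂μ) := by
  have hfin : traceInf P ≠ ∞ := (htr.trans_lt ENNReal.ofReal_lt_top).ne
  obtain ⟨X, hX⟩ := hjsurj (w * corner v * star w) (by
    have : star w * P = star w := by
      have := congrArg star hPw
      rwa [star_mul, hP.isSelfAdjoint.star_eq] at this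
    rw [mul_assoc, mul_assoc, this, ← mul_assoc, ← mul_assoc, hPw])
  have hXX : j (star X * X) = w * star w := by
    rw [map_mul, map_star, hX, star_mul, star_mul, star_star, ← corner_star]
    calc _ = w * corner (star v) * (star w * w) * corner v * star w := by simp only [mul_assoc]
      _ = _ := by
        rw [hw, mul_assoc w, ← corner_mul, mul_assoc w, ← corner_mul, mul_one, hv.1,
          mul_corner_one hw]
  -- `X* X` is carried to the projection `w w*`, of trace one, while the corner is normalized by
  -- `traceInf P`. So `X` is a partial isometry, and its 2-norm defect is at most `d`.
  have hXn : normSq X = (traceInf P).toReal⁻¹ := by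
    have h5 := hj X
    rw [← map_star, ← map_mul, hXX, traceInf_mul_star hw] at h5
    have h6 := congrArg ENNReal.toReal h5
    rw [ENNReal.toReal_mul, ENNReal.toReal_ofReal (normSq_nonneg _), ENNReal.toReal_one] at h6
    exact eq_inv_of_mul_eq_one_right h6.symm
  have hT1 : 1 ≤ (traceInf P).toReal := by
    rw [← ENNReal.toReal_one]; exact ENNReal.toReal_mono hfin ht1
  have hT2 : (traceInf P).toReal ≤ 1 + d := ENNReal.toReal_le_of_le_ofReal (by positivity) htr
  have hX1 : ‖X‖ ≤ 1 := by
    have hq : star X * X * (star X * X) = star X * X := hjinj (by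
      rw [map_mul j (star X * X), hXX, (isStarProjection_mul_star hw).isIdempotentElem.eq])
    have h5 : ‖star X * X‖ * ‖star X * X‖ = ‖star X * X‖ := by
      rw [← CStarRing.norm_star_mul_self, star_mul, star_star, hq]
    rw [CStarRing.norm_star_mul_self] at h5
    by_contra! hlt
    nlinarith [mul_lt_mul'' hlt hlt zero_le_one zero_le_one]
  obtain ⟨u, hu⟩ := exists_unitary_relCommutant ρ hgap X hX1
  refine ⟨u, ?_⟩
  rw [← hX, ← _root_.map_sub, hj]
  gcongr
  refine hu.trans ?_
  have h7 : 1 - normSq X ≤ d := by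
    rw [hXn]
    have : 1 - d ≤ (traceInf P).toReal⁻¹ := by
      rw [← one_div, le_div_iff₀ (by linarith)]
      nlinarith
    linarith
  have h8 : ∀ g, normSq ((ρ g : B.Elt) * X - X * (ρ g : B.Elt)) ≤
      16 * normSq ((p g : A.Elt) - entry (star w * π g * w) 0 0) +
        4 * normSq ((p g : A.Elt) * v - v * (p g : A.Elt)) + 8 * d := by
    intro g
    have h9 := traceInf_commutator_le hP hw hPw (hπ1 g) (hPπ g) (hπP g) (p g) hv
    have h12 : j ((ρ g : B.Elt) * X - X * (ρ g : B.Elt)) =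
        π g * (w * corner v * star w) - (w * corner v * star w) * π g := by
      rw [_root_.map_sub, map_mul, map_mul, hX, hjρ]
    rw [← h12, hj] at h9
    have h10 : traceInf P - 1 ≤ ENNReal.ofReal d := by
      rw [tsub_le_iff_right, ← ENNReal.ofReal_one, ← ENNReal.ofReal_add hd zero_le_one, add_comm d]
      exact htr
    have hn1 := normSq_nonneg ((p g : A.Elt) - entry (star w * π g * w) 0 0)
    have hn2 := normSq_nonneg ((p g : A.Elt) * v - v * (p g : A.Elt))
    refine (ENNReal.ofReal_le_ofReal_iff (by positivity)).1 ?_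
    rw [ENNReal.ofReal_add (by positivity) (by positivity), ENNReal.ofReal_mul (by norm_num),
      ENNReal.ofReal_ofNat]
    -- The commutator estimate is for the unnormalized trace; as `traceInf P ≥ 1`, the normalization
    -- only improves it.
    refine (le_mul_of_one_le_left' ht1).trans (h9.trans ?_)
    gcongr
  have hi1 : Integrable (fun g => normSq ((p g : A.Elt) - entry (star w * π g * w) 0 0)) μ :=
    integrable_of_abs_le fun g => abs_normSq_sub_le_four (normSq_unitary (p g).2).le
      (normSq_entry_compression_le hw (hπ1 g))
  have hi2 : Integrable (fun g => normSq ((p g : A.Elt) * v - v * (p g : A.Elt))) μ :=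
    integrable_of_abs_le fun g => abs_normSq_sub_le_four (normSq_unitary_mul_le (p g).2 hv)
      (normSq_unitary_mul_le hv (p g).2)
  have h9 := integral_le_of_le_add (by norm_num) (fun g => normSq_nonneg _) hi1 hi2 h8 hint
  have h10 := mul_le_mul_of_nonneg_left h9 (div_nonneg hκ zero_le_two)
  dsimp only
  linarith

theorem star_ampDiag_mul {x : A.Elt} (hx : x ∈ unitary A.Elt) : star (ampDiag x) * ampDiag x = 1 := by
  rw [← ampDiag_star, ← ampDiag_mul, hx.1, ampDiag_one]

theorem ampDiag_mul_star {x : A.Elt} (hx : x ∈ unitary A.Elt) : ampDiag x * star (ampDiag x) = 1 := by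
  rw [← ampDiag_star, ← ampDiag_mul, hx.2, ampDiag_one]

/-- From a representation close to `p`, a dilation in which unitaries of `M` which almost commute
with `p` can be approximated by unitaries which commute with the representation. -/
theorem exists_commuting_dilation {C : Set TracialVN.{u}} (hsub : ClosedUnderSubalgebras C)
    (hdil : ClosedUnderDilations C) (hA : A ∈ C) {μ : Measure G} [IsProbabilityMeasure μ] {κ : ℝ}
    (hκ : 0 ≤ κ) (hgap : HasSpectralGap.{u} G fun f => κ / 2 * ∫ g, f g ∂μ) {d : ℝ}
    {p : G → unitary A.Elt} (hp : IsFlexiblyClose μ d p) :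
    ∃ (N : TracialVN.{u}) (j : N.Elt →⋆ₙₐ[ℂ] A.Amp) (D : N.Amp →⋆ₙₐ[ℂ] A.Amp) (P w V : A.Amp)
      (π Δ : G → A.Amp), N ∈ C ∧ IsStarProjection P ∧ 1 ≤ traceInf P ∧
      traceInf P ≤ ENNReal.ofReal (1 + d) ∧ star w * w = corner 1 ∧ P * w = w ∧ star V * V = P ∧
      (∀ x, D (corner x) * V = V * j x) ∧
      (∀ T, traceInf (star (D T) * D T) = traceInf P * traceInf (star T * T)) ∧
      (∀ x, traceInf (star (j x) * j x) = traceInf P * ENNReal.ofReal (normSq x)) ∧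
      j 1 = P ∧
      (∀ g h, Δ (g * h) = Δ g * Δ h) ∧ (∀ g T, Δ g * D T = D T * Δ g) ∧
      (∀ T, Δ 1 * D T = D T) ∧ (∀ g T, star (Δ g) * Δ g * D T = D T) ∧
      (∀ g T, Δ g * star (Δ g) * D T = D T) ∧ (∀ g, Δ g * V = V * π g) ∧
      ∫ g, normSq ((p g : A.Elt) - entry (star w * π g * w) 0 0) ∂μ ≤ d ∧
      ∀ v ∈ unitary A.Elt, ∃ u : unitary N.Elt,
        traceInf (star (j u - w * corner v * star w) * (j u - w * corner v * star w)) ≤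
          traceInf P * ENNReal.ofReal (6 * d + 72 * κ * d +
            12 * κ * ∫ g, normSq ((p g : A.Elt) * v - v * (p g : A.Elt)) ∂μ) := by
  obtain ⟨P, w, π, hP, hπ, hπmul, hw, hPw, htr, hint⟩ := hp
  have hd : 0 ≤ d := (integral_nonneg fun g => normSq_nonneg _).trans hint
  have hPe := traceInf_sub_add hP (isStarProjection_mul_star hw) (by rw [← mul_assoc, hPw])
  rw [traceInf_mul_star hw] at hPe
  have ht1 : 1 ≤ traceInf P := by rw [← hPe]; exact le_add_self
  have hfin : traceInf P ≠ ∞ := (htr.trans_lt ENNReal.ofReal_lt_top).ne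
  have hpos : traceInf P ≠ 0 := (zero_lt_one.trans_le ht1).ne'
  obtain ⟨B, j, D, V, hB, hj1, hjinj, hjsurj, hV, hDV, hD, hj⟩ := exists_finiteDilation hP hfin hpos hw hPw
  choose r hr using fun g => hjsurj (π g) (hπ g).1
  have hπ1 : ∀ g, ‖π g‖ ≤ 1 := fun g => norm_le_one_of_star_mul_self hP (hπ g).2.1
  have hPπ : ∀ g, P * π g = π g := fun g => by
    rw [← (hπ g).1, ← mul_assoc, ← mul_assoc, hP.isIdempotentElem.eq]
  have hπP : ∀ g, π g * P = π g := fun g => by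
    rw [← (hπ g).1, mul_assoc, hP.isIdempotentElem.eq]
  have hru : ∀ g, r g ∈ unitary B.Elt := fun g => by
    refine ⟨hjinj ?_, hjinj ?_⟩
    · rw [map_mul, map_star, hr, hj1, (hπ g).2.1]
    · rw [map_mul, map_star, hr, hj1, (hπ g).2.2]
  let ρ : G →* unitary B.Elt := MonoidHom.mk' (fun g => ⟨r g, hru g⟩) fun g h =>
    Subtype.ext (hjinj (by
      change j (r (g * h)) = j (r g * r h)
      rw [map_mul, hr, hr, hr, hπmul]))
  have hjρ : ∀ g, j (ρ g : B.Elt) = π g := hr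
  have hBC : B ∈ C := hdil A hA B hB
  have hVP : V * P = V := by
    have h3 : star (V * P - V) * (V * P - V) = 0 := by
      rw [star_sub, star_mul, hP.isSelfAdjoint.star_eq, sub_mul, mul_sub, mul_sub]
      simp only [mul_assoc]
      rw [← mul_assoc (star V), hV, hP.isIdempotentElem.eq, hP.isIdempotentElem.eq]
      simp
    exact sub_eq_zero.1 ((CStarRing.star_mul_self_eq_zero_iff _).1 h3)
  -- `N` is the relative commutant of `ρ` in the corner `B`, and `Δ g` is the image of `ρ g ⊗ 1`.
  -- Since `D` need not preserve the unit of `M_∞`, the unitarity of `Δ` is only expressed on the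
  -- range of `D`.
  refine ⟨relCommutant ρ, j.comp (relInclusion ρ : _ →⋆ₙₐ[ℂ] _), D.comp (relAmp ρ), P, w, V, π,
    fun g => D (ampDiag (ρ g : B.Elt)), relCommutant_mem ρ hsub hBC, hP, ht1, htr, hw, hPw, hV,
    fun x => ?_, fun T => ?_, fun x => ?_, ?_, fun g h => ?_, fun g T => ?_, fun T => ?_,
    fun g T => ?_, fun g T => ?_, fun g => ?_, hint, fun v hv => ?_⟩
  · change D (relAmp ρ (corner x)) * V = V * j (relInclusion ρ x)
    rw [relAmp_corner, hDV]
  · change traceInf (star (D (relAmp ρ T)) * D (relAmp ρ T)) = _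
    rw [hD, ← map_star, ← map_mul, traceInf_relAmp]
  · change traceInf (star (j (relInclusion ρ x)) * j (relInclusion ρ x)) = _
    rw [hj, normSq_relInclusion]
  · change j (relInclusion ρ 1) = P
    rw [_root_.map_one, hj1]
  · dsimp only
    rw [map_mul, Submonoid.coe_mul, ampDiag_mul, map_mul]
  · exact map_mul_comm_of_comm D (commute_ampDiag_relAmp ρ g T)
  · exact map_mul_cancel D (by rw [_root_.map_one, OneMemClass.coe_one, ampDiag_one]) _
  · exact map_star_mul_cancel D (star_ampDiag_mul (ρ g).2) _
  · exact map_mul_star_cancel D (ampDiag_mul_star (ρ g).2) _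
  · have h4 : V = D (corner 1) * V := by rw [hDV, hj1, hVP]
    calc D (ampDiag (ρ g : B.Elt)) * V = D (ampDiag (ρ g : B.Elt)) * (D (corner 1) * V) := by rw [← h4]
      _ = D (corner (ρ g : B.Elt)) * V := by rw [← mul_assoc, ← map_mul, ampDiag_mul_corner, mul_one]
      _ = V * π g := by rw [hDV, hjρ]
  · obtain ⟨u, hu⟩ := exists_unitary_relCommutant_near ρ hκ hgap hd hP hw hPw ht1 htr hjinj hjsurj
      hj hjρ hπ1 hPπ hπP hint hv
    exact ⟨u, hu⟩

end TracialVN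

/-! ### The product representation in the iterated dilation. -/

section IteratedDilation

variable {R S : Type*} [Ring R] [StarRing R] [Algebra ℂ R] [Ring S] [StarRing S] [Algebra ℂ S]
  (D : S →⋆ₙₐ[ℂ] R) {G₁ : Type v} {G₂ : Type w} [Group G₁] [Group G₂] {P w V : R} {π Δ : G₁ → R}
  {Q s c : S} {σ : G₂ → S}

/-- `Δ` commutes with the image of `D` and acts on it as a representation by unitaries, so `Δ g * D
(σ h)` is multiplicative and unitary in the corner of `D Q`. -/
theorem iteratedDilation_rep (hΔmul : ∀ g h, Δ (g * h) = Δ g * Δ h)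
    (hΔD : ∀ g T, Δ g * D T = D T * Δ g)
    (hΔs : ∀ g T, star (Δ g) * Δ g * D T = D T) (hΔs' : ∀ g T, Δ g * star (Δ g) * D T = D T)
    (hQ : IsStarProjection Q)
    (hσ : ∀ g, Q * σ g * Q = σ g ∧ star (σ g) * σ g = Q ∧ σ g * star (σ g) = Q)
    (hσmul : ∀ g h, σ (g * h) = σ g * σ h) :
    (∀ x : G₁ × G₂, D Q * (Δ x.1 * D (σ x.2)) * D Q = Δ x.1 * D (σ x.2)) ∧
    (∀ x : G₁ × G₂, star (Δ x.1 * D (σ x.2)) * (Δ x.1 * D (σ x.2)) = D Q) ∧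
    (∀ x : G₁ × G₂, (Δ x.1 * D (σ x.2)) * star (Δ x.1 * D (σ x.2)) = D Q) ∧
    ∀ x y : G₁ × G₂, Δ (x * y).1 * D (σ (x * y).2) = Δ x.1 * D (σ x.2) * (Δ y.1 * D (σ y.2)) := by
  have hQ' := hQ.map D
  refine ⟨fun x => ?_, fun x => ?_, fun x => ?_, fun x y => ?_⟩
  · rw [← mul_assoc, ← hΔD, mul_assoc, mul_assoc, ← map_mul, ← map_mul, ← mul_assoc Q, (hσ _).1]
  · rw [star_mul, mul_assoc, ← mul_assoc (star (Δ x.1)), hΔs, ← map_star, ← map_mul, (hσ _).2.1]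
  · have h1 := congrArg star (hΔs' x.1 Q)
    rw [star_mul, star_mul, star_star, hQ'.isSelfAdjoint.star_eq] at h1
    rw [star_mul, mul_assoc, ← mul_assoc (D _), ← map_star, ← map_mul, (hσ _).2.2, ← mul_assoc,
      hΔD, mul_assoc, h1]
  · rw [Prod.fst_mul, Prod.snd_mul, hΔmul, hσmul, map_mul, mul_assoc, mul_assoc,
      ← mul_assoc (Δ y.1), hΔD y.1, mul_assoc (D (σ x.2))]

/-- The isometry `w' = D s * V * w` first enters the dilation by `w`, is transported by `V` to the
first corner of the amplification, and then enters the second dilation by `s`. Compressing the `G₁`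
part by `w'` gives back the compression of `π` by `w` exactly; only the `G₂` part sees the second
dilation. -/
theorem iteratedDilation_isometry (hP : IsStarProjection P)
    (hPw : P * w = w) (hV : star V * V = P) (hDV : D c * V = V * P)
    (hΔD : ∀ g T, Δ g * D T = D T * Δ g) (hΔ1 : ∀ T, Δ 1 * D T = D T)
    (hΔV : ∀ g, Δ g * V = V * π g) (hQ : IsStarProjection Q)
    (hσ : ∀ g, Q * σ g * Q = σ g ∧ star (σ g) * σ g = Q ∧ σ g * star (σ g) = Q)
    (hσmul : ∀ g h, σ (g * h) = σ g * σ h) (hs : star s * s = c) (hQs : Q * s = s) :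
    star (D s * (V * w)) * (D s * (V * w)) = star w * w ∧ D Q * (D s * (V * w)) = D s * (V * w) ∧
    (∀ g, star (D s * (V * w)) * (Δ g * D (σ 1)) * (D s * (V * w)) = star w * π g * w) ∧
    ∀ h, star (D s * (V * w)) * (Δ 1 * D (σ h)) * (D s * (V * w)) =
      star w * star V * (D (star s * σ h * s) * (V * w)) := by
  have hwP : star w * P = star w := by
    have := congrArg star hPw
    rwa [star_mul, hP.isSelfAdjoint.star_eq] at this
  -- `σ 1` is an idempotent and a unitary of the corner, hence its unit.
  have hσ1 : σ 1 = Q := by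
    have h1 : σ 1 * σ 1 = σ 1 := by rw [← hσmul, mul_one]
    have h2 : Q * σ 1 = σ 1 := by
      rw [← (hσ 1).1, ← mul_assoc, ← mul_assoc, hQ.isIdempotentElem.eq]
    rw [← h2, ← (hσ 1).2.1, mul_assoc, h1]
  have hVw : star w * star V * V = star w := by rw [mul_assoc, hV, hwP]
  have hDVw : D c * (V * w) = V * w := by rw [← mul_assoc, hDV, mul_assoc, hPw]
  have hDs : star (D s) * D s = D c := by rw [← map_star, ← map_mul, hs]
  refine ⟨?_, ?_, fun g => ?_, fun h => ?_⟩
  · calc _ = star w * star V * ((star (D s) * D s) * (V * w)) := by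
          simp only [star_mul, mul_assoc]
      _ = _ := by rw [hDs, hDVw, ← mul_assoc, hVw]
  · rw [← mul_assoc, ← map_mul, hQs]
  · calc _ = star w * star V * (star (D s) * (Δ g * (D (Q * s) * (V * w)))) := by
          simp only [star_mul, mul_assoc, hσ1, map_mul]
      _ = star w * star V * (star (D s) * (D s * (Δ g * (V * w)))) := by
          rw [hQs, ← mul_assoc (Δ g), hΔD, mul_assoc (D s)]
      _ = star w * star V * ((star (D s) * D s) * (V * (π g * w))) := by
          rw [← mul_assoc (Δ g), hΔV, mul_assoc V, mul_assoc (star (D s))]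
      _ = (star w * star V * V) * (P * (π g * w)) := by
          rw [hDs, ← mul_assoc (D c), hDV]; simp only [mul_assoc]
      _ = _ := by rw [hVw, ← mul_assoc, hwP, mul_assoc]
  · rw [hΔ1, map_mul, map_mul, map_star]
    simp only [star_mul, mul_assoc]

end IteratedDilation

namespace TracialVN

variable {A N : TracialVN.{u}} {G₁ : Type v} {G₂ : Type w} [Group G₁] [Group G₂]

/-- Composition of a dilation of `M` carrying commuting unitaries `Δ` with a second dilation. -/
theorem exists_iterated_dilation {j : N.Elt →⋆ₙₐ[ℂ] A.Amp} {D : N.Amp →⋆ₙₐ[ℂ] A.Amp}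
    {P w V : A.Amp} {π Δ : G₁ → A.Amp} (hP : IsStarProjection P) (hw : star w * w = corner 1)
    (hPw : P * w = w)
    (hV : star V * V = P) (hDV : ∀ x, D (corner x) * V = V * j x)
    (hD : ∀ T, traceInf (star (D T) * D T) = traceInf P * traceInf (star T * T)) (hj1 : j 1 = P)
    (hΔmul : ∀ g h, Δ (g * h) = Δ g * Δ h) (hΔD : ∀ g T, Δ g * D T = D T * Δ g)
    (hΔ1 : ∀ T, Δ 1 * D T = D T) (hΔs : ∀ g T, star (Δ g) * Δ g * D T = D T)
    (hΔs' : ∀ g T, Δ g * star (Δ g) * D T = D T) (hΔV : ∀ g, Δ g * V = V * π g)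
    {Q s : N.Amp} {σ : G₂ → N.Amp} (hQ : IsStarProjection Q)
    (hσ : ∀ g, Q * σ g * Q = σ g ∧ star (σ g) * σ g = Q ∧ σ g * star (σ g) = Q)
    (hσmul : ∀ g h, σ (g * h) = σ g * σ h) (hs : star s * s = corner 1) (hQs : Q * s = s) :
    ∃ (P' w' : A.Amp) (π' : G₁ × G₂ → A.Amp), IsStarProjection P' ∧
      (∀ g, P' * π' g * P' = π' g ∧ star (π' g) * π' g = P' ∧ π' g * star (π' g) = P') ∧
      (∀ g h, π' (g * h) = π' g * π' h) ∧ star w' * w' = corner 1 ∧ P' * w' = w' ∧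
      traceInf P' = traceInf P * traceInf Q ∧
      (∀ g, star w' * π' (g, 1) * w' = star w * π g * w) ∧
      ∀ h, star w' * π' (1, h) * w' = star w * j (entry (star s * σ h * s) 0 0) * w := by
  have hDV1 : D (corner 1) * V = V * P := by rw [hDV, hj1]
  have hQ' := hQ.map D
  obtain ⟨a1, a2, a3, a4⟩ := iteratedDilation_rep D hΔmul hΔD hΔs hΔs' hQ hσ hσmul
  obtain ⟨b1, b2, b3, b4⟩ := iteratedDilation_isometry D (w := w) hP hPw hV hDV1 hΔD hΔ1 hΔV hQ hσ hσmul hs hQs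
  refine ⟨D Q, D s * (V * w), fun x => Δ x.1 * D (σ x.2), hQ', fun x => ⟨a1 x, a2 x, a3 x⟩, a4,
    b1.trans hw, b2, ?_, b3, fun h => ?_⟩
  · have h1 := hD Q
    rwa [hQ.isSelfAdjoint.star_eq, hQ.isIdempotentElem.eq, hQ'.isSelfAdjoint.star_eq,
      hQ'.isIdempotentElem.eq] at h1
  · refine (b4 h).trans ?_
    have hwP : star w * P = star w := by
      have := congrArg star hPw
      rwa [star_mul, hP.isSelfAdjoint.star_eq] at this
    have e := corner_entry_compression hs (σ h)
    generalize entry (star s * σ h * s) 0 0 = y at e ⊢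
    rw [← e, ← mul_assoc (D _), hDV, mul_assoc V, ← mul_assoc,
      mul_assoc (star w), hV, hwP, mul_assoc]

/-- Unitaries close to the images of `V`, `v`, `v'` are almost multiplicative if the latter are. -/
theorem normSq_sub_mul_le {j : N.Elt →⋆ₙₐ[ℂ] A.Amp} {P w : A.Amp} (ht1 : 1 ≤ traceInf P)
    (hfin : traceInf P ≠ ∞) (hw : star w * w = corner 1)
    (hj : ∀ x, traceInf (star (j x) * j x) = traceInf P * ENNReal.ofReal (normSq x))
    {V v v' : A.Elt} (hv' : v' ∈ unitary A.Elt) {U u u' : N.Elt} (hu : u ∈ unitary N.Elt)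
    {C c c' : ℝ} (hC0 : 0 ≤ C) (hc0 : 0 ≤ c) (hc0' : 0 ≤ c')
    (hC : traceInf (star (j U - w * corner V * star w) * (j U - w * corner V * star w)) ≤
      traceInf P * ENNReal.ofReal C)
    (hc : traceInf (star (j u - w * corner v * star w) * (j u - w * corner v * star w)) ≤
      traceInf P * ENNReal.ofReal c)
    (hc' : traceInf (star (j u' - w * corner v' * star w) * (j u' - w * corner v' * star w)) ≤
      traceInf P * ENNReal.ofReal c') :
    normSq (U - u * u') ≤ 4 * (C + normSq (V - v * v') + c + c') := by
  have hpos : traceInf P ≠ 0 := (zero_lt_one.trans_le ht1).ne'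
  have hju : ‖j u‖ ≤ 1 := by
    have h1 : IsStarProjection (j 1) := ⟨by rw [IsIdempotentElem, ← map_mul, one_mul],
      by rw [isSelfAdjoint_iff, ← map_star, star_one]⟩
    refine norm_le_one_of_star_mul_self h1 ?_
    rw [← map_star, ← map_mul, hu.1]
  have hX' : ‖w * corner v' * star w‖ ≤ 1 := by
    refine norm_le_one_of_star_mul_self (isStarProjection_mul_star hw) ?_
    rw [star_mul, star_mul, star_star, ← corner_star]
    calc _ = w * corner (star v') * (star w * w) * corner v' * star w := by simp only [mul_assoc]
      _ = _ := by
        rw [hw, mul_assoc w, ← corner_mul, mul_assoc w, ← corner_mul, mul_one, hv'.1,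
          mul_corner_one hw]
  set X := w * corner v * star w with hX
  set X' := w * corner v' * star w with hX'd
  have hXX : X * X' = w * corner (v * v') * star w := by
    calc X * X' = w * corner v * (star w * w) * corner v' * star w := by
          simp only [hX, hX'd, mul_assoc]
      _ = _ := by rw [hw, mul_assoc w, ← corner_mul, mul_assoc w, ← corner_mul, mul_one]
  -- With `X X' = w (v v') w*`, the defect telescopes into four terms, grouped two by two so that
  -- the constant is four.
  have h1 : j (U - u * u') = ((j U - w * corner V * star w) + w * corner (V - v * v') * star w) +
      (-((j u - X) * X') + -(j u * (j u' - X'))) := by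
    rw [corner_sub, mul_sub, sub_mul, ← hXX, _root_.map_sub, map_mul]
    noncomm_ring
  have h2 := traceInf_conj_le hw (corner (V - v * v'))
  rw [traceInf_corner_star_mul] at h2
  have h3 := (traceInf_star_mul_self_mul_le' X' (j u - X) hX').trans hc
  have h4 := (traceInf_star_mul_self_mul_le (j u) (j u' - X') hju).trans hc'
  have h5 := traceInf_star_mul_self_add_le
    ((j U - w * corner V * star w) + w * corner (V - v * v') * star w)
    (-((j u - X) * X') + -(j u * (j u' - X')))
  have h6 := traceInf_star_mul_self_add_le (j U - w * corner V * star w)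
    (w * corner (V - v * v') * star w)
  have h7 := traceInf_star_mul_self_add_le (-((j u - X) * X')) (-(j u * (j u' - X')))
  rw [star_neg, star_neg, neg_mul_neg, neg_mul_neg] at h7
  have h8 : traceInf P * ENNReal.ofReal (normSq (U - u * u')) ≤
      traceInf P * ENNReal.ofReal (4 * (C + normSq (V - v * v') + c + c')) := by
    have hn := normSq_nonneg (V - v * v')
    rw [← hj, h1]
    calc _ ≤ 2 * (2 * (traceInf P * ENNReal.ofReal C) +
            2 * (traceInf P * ENNReal.ofReal (normSq (V - v * v')))) +
          2 * (2 * (traceInf P * ENNReal.ofReal c) + 2 * (traceInf P * ENNReal.ofReal c')) := by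
          refine h5.trans ?_
          gcongr
          · refine h6.trans ?_
            gcongr
            exact h2.trans (le_mul_of_one_le_left' ht1)
          · refine h7.trans ?_
            gcongr
      _ = _ := by
        rw [ENNReal.ofReal_mul (by norm_num), ENNReal.ofReal_add (by positivity) hc0',
          ENNReal.ofReal_add (by positivity) hc0, ENNReal.ofReal_add hC0 hn, ENNReal.ofReal_ofNat]
        ring
  rw [ENNReal.mul_le_mul_iff_right hpos hfin] at h8
  exact (ENNReal.ofReal_le_ofReal_iff (by have := normSq_nonneg (V - v * v'); positivity)).1 h8

/-- Compression by `w` recovers `v` from `w v w*` and is a contraction for the unnormalized 2-norm.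
The factor `1 + d` comes from the normalization of the trace of `N`. -/
theorem normSq_sub_entry_le {j : N.Elt →⋆ₙₐ[ℂ] A.Amp} {P w : A.Amp} {d : ℝ} (hd : 0 ≤ d)
    (htr : traceInf P ≤ ENNReal.ofReal (1 + d)) (hw : star w * w = corner 1)
    (hj : ∀ x, traceInf (star (j x) * j x) = traceInf P * ENNReal.ofReal (normSq x))
    {v : A.Elt} {u y : N.Elt} {c : ℝ} (hc0 : 0 ≤ c)
    (hc : traceInf (star (j u - w * corner v * star w) * (j u - w * corner v * star w)) ≤
      traceInf P * ENNReal.ofReal c) :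
    normSq (v - entry (star w * j y * w) 0 0) ≤ (1 + d) * (2 * c + 2 * normSq (u - y)) := by
  have hn := normSq_nonneg (u - y)
  have h1 : corner (v - entry (star w * j y * w) 0 0) =
      star w * (-(j u - w * corner v * star w) + j (u - y)) * w := by
    have h2 : star w * (w * corner v * star w) * w = corner v := by
      calc _ = (star w * w) * corner v * (star w * w) := by simp only [mul_assoc]
        _ = _ := by rw [hw, ← corner_mul, ← corner_mul, one_mul, mul_one]
    rw [corner_sub, corner_entry_compression hw]
    conv_lhs => rw [← h2]
    rw [_root_.map_sub]
    noncomm_ring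
  have h3 := traceInf_conj_le' hw (-(j u - w * corner v * star w) + j (u - y))
  rw [← h1, traceInf_corner_star_mul] at h3
  have h4 := traceInf_star_mul_self_add_le (-(j u - w * corner v * star w)) (j (u - y))
  rw [star_neg, neg_mul_neg, hj] at h4
  refine (ENNReal.ofReal_le_ofReal_iff (by positivity)).1 ?_
  calc _ ≤ 2 * (traceInf P * ENNReal.ofReal c) + 2 * (traceInf P * ENNReal.ofReal (normSq (u - y))) := by
        refine h3.trans (h4.trans ?_)
        gcongr
    _ = traceInf P * ENNReal.ofReal (2 * c + 2 * normSq (u - y)) := by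
        rw [ENNReal.ofReal_add (by positivity) (by positivity), ENNReal.ofReal_mul (by norm_num),
          ENNReal.ofReal_mul (by norm_num), ENNReal.ofReal_ofNat]
        ring
    _ ≤ _ := by
        rw [ENNReal.ofReal_mul (by positivity)]
        gcongr

end TracialVN

/-! ### Averages of bounded functions over products. -/

section Averages

variable {X : Type v} [MeasurableSpace X] [DiscreteMeasurableSpace X] [Countable X]
  {Y : Type w} [MeasurableSpace Y] [DiscreteMeasurableSpace Y] [Countable Y]

/-- Boundedness of a real function. -/
def IsBoundedFun {X : Type*} (f : X → ℝ) : Prop := ∃ c, ∀ x, |f x| ≤ c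

theorem IsBoundedFun.integrable {f : X → ℝ} (hf : IsBoundedFun f) (μ : Measure X)
    [IsFiniteMeasure μ] : Integrable f μ :=
  integrable_of_abs_le hf.choose_spec

theorem IsBoundedFun.comp {Z W : Type*} {f : Z → ℝ} (hf : IsBoundedFun f) (g : W → Z) :
    IsBoundedFun fun x => f (g x) :=
  ⟨hf.choose, fun x => hf.choose_spec (g x)⟩

omit [DiscreteMeasurableSpace Y] [Countable Y] in
theorem IsBoundedFun.integral {Z : Type*} {f : Z × Y → ℝ} (hf : IsBoundedFun f) (ν : Measure Y)
    [IsProbabilityMeasure ν] : IsBoundedFun fun x => ∫ y, f (x, y) ∂ν := by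
  obtain ⟨c, hc⟩ := hf
  refine ⟨c, fun x => ?_⟩
  have := norm_integral_le_of_norm_le_const (μ := ν) (f := fun y => f (x, y)) (C := c)
    (Eventually.of_forall fun y => hc (x, y))
  simpa using this

theorem integral_le_of_le_comb {μ : Measure X} [IsProbabilityMeasure μ] {f f₁ f₂ f₃ : X → ℝ}
    (a₁ a₂ a₃ k : ℝ) (hf : IsBoundedFun f) (h₁ : IsBoundedFun f₁) (h₂ : IsBoundedFun f₂)
    (h₃ : IsBoundedFun f₃) (h : ∀ x, f x ≤ a₁ * f₁ x + a₂ * f₂ x + a₃ * f₃ x + k) :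
    ∫ x, f x ∂μ ≤ a₁ * ∫ x, f₁ x ∂μ + a₂ * ∫ x, f₂ x ∂μ + a₃ * ∫ x, f₃ x ∂μ + k := by
  have i₁ := (h₁.integrable μ).const_mul a₁
  have i₂ := (h₂.integrable μ).const_mul a₂
  have i₃ := (h₃.integrable μ).const_mul a₃
  have e0 := integral_mono (hf.integrable μ) (((i₁.add i₂).add i₃).add (integrable_const k)) h
  have e1 := integral_add ((i₁.add i₂).add i₃) (integrable_const (μ := μ) k)
  have e2 := integral_add (i₁.add i₂) i₃
  have e3 := integral_add i₁ i₂
  rw [integral_const_mul, integral_const_mul] at e3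
  simp only [Pi.add_apply, integral_const, probReal_univ, one_smul] at e0 e1 e2
  rw [e1, e2, e3, integral_const_mul] at e0
  exact e0

instance {G₁ : Type v} {G₂ : Type w} [Group G₁] [Group G₂] [MeasurableSpace G₁] [MeasurableSpace G₂]
    (μ₁ : Measure G₁) [IsProbabilityMeasure μ₁] (μ₂ : Measure G₂) [IsProbabilityMeasure μ₂] :
    IsProbabilityMeasure (averagedMeasure μ₁ μ₂) :=
  ⟨by simp [averagedMeasure, ENNReal.inv_two_add_inv_two]⟩

theorem integral_averagedMeasure {G₁ : Type v} {G₂ : Type w} [Group G₁] [Group G₂]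
    [MeasurableSpace G₁] [MeasurableSpace G₂] [DiscreteMeasurableSpace G₁] [Countable G₁]
    [DiscreteMeasurableSpace G₂] [Countable G₂]
    (μ₁ : Measure G₁) [IsProbabilityMeasure μ₁] (μ₂ : Measure G₂) [IsProbabilityMeasure μ₂]
    {f : G₁ × G₂ → ℝ} (hf : IsBoundedFun f) :
    ∫ x, f x ∂averagedMeasure μ₁ μ₂ = 2⁻¹ * (∫ g, f (g, 1) ∂μ₁ + ∫ h, f (1, h) ∂μ₂) := by
  rw [averagedMeasure, integral_smul_measure, integral_add_measure (hf.integrable _) (hf.integrable _),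
    Measure.prod_dirac, Measure.dirac_prod, integral_map, integral_map]
  · simp
  · exact (Measurable.of_discrete).aemeasurable
  · exact (Measurable.of_discrete).aestronglyMeasurable
  · exact (Measurable.of_discrete).aemeasurable
  · exact (Measurable.of_discrete).aestronglyMeasurable

end Averages

/-! ### Flexible closeness for direct products. -/

namespace TracialVN

variable {A : TracialVN.{u}}

theorem isBoundedFun_normSq {Z : Type*} {x y : Z → A.Elt} (hx : ∀ z, normSq (x z) ≤ 1)
    (hy : ∀ z, normSq (y z) ≤ 1) : IsBoundedFun fun z => normSq (x z - y z) :=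
  ⟨4, fun z => abs_normSq_sub_le_four (hx z) (hy z)⟩

variable {G₁ : Type v} {G₂ : Type w} [Group G₁] [Group G₂]

section Expand

variable [MeasurableSpace G₁] [MeasurableSpace G₂] [DiscreteMeasurableSpace G₁] [Countable G₁]
    [DiscreteMeasurableSpace G₂] [Countable G₂]
    {μ₁ : Measure G₁} [IsProbabilityMeasure μ₁] {μ₂ : Measure G₂} [IsProbabilityMeasure μ₂]

/-- The averaged measure gives weight `1/4` to each of the four blocks `Gᵢ × Gⱼ`, so each block has
defect at most `4 ε`. The mixed blocks compare `φ (g, 1) φ (1, h)` and `φ (1, h) φ (g, 1)` with the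
common value `φ (g, h)`. -/
theorem _root_.IsAlmostHom.expand {ε : ℝ} {φ : G₁ × G₂ → unitary A.Elt}
    (h : IsAlmostHom (averagedMeasure μ₁ μ₂) ε φ) :
    IsAlmostHom μ₁ (4 * ε) (fun g => φ (g, 1)) ∧ IsAlmostHom μ₂ (4 * ε) (fun h => φ (1, h)) ∧
    ∫ h, ∫ g, normSq ((φ (g, 1) : A.Elt) * (φ (1, h) : A.Elt) - (φ (1, h) : A.Elt) * (φ (g, 1) : A.Elt))
      ∂μ₁ ∂μ₂ ≤ 16 * ε := by
  let F : (G₁ × G₂) × (G₁ × G₂) → ℝ := fun z =>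
    normSq ((φ (z.1 * z.2) : A.Elt) - (φ z.1 : A.Elt) * (φ z.2 : A.Elt))
  have hF : IsBoundedFun F := isBoundedFun_normSq (fun z => (normSq_unitary (φ _).2).le)
    fun z => normSq_unitary_mul_le (φ _).2 (φ _).2
  have hF0 : ∀ z, 0 ≤ F z := fun z => normSq_nonneg _
  have h1 : ∫ x, ∫ y, F (x, y) ∂averagedMeasure μ₁ μ₂ ∂averagedMeasure μ₁ μ₂ ≤ ε := h
  have h2 : ∀ x, ∫ y, F (x, y) ∂averagedMeasure μ₁ μ₂ =
      2⁻¹ * (∫ g, F (x, (g, 1)) ∂μ₁ + ∫ h, F (x, (1, h)) ∂μ₂) := fun x =>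
    integral_averagedMeasure μ₁ μ₂ (hF.comp fun y => (x, y))
  rw [integral_averagedMeasure μ₁ μ₂ (hF.integral _)] at h1
  simp only [h2] at h1
  rw [integral_const_mul, integral_const_mul,
    integral_add (((hF.comp fun z : G₁ × G₁ => ((z.1, 1), (z.2, 1))).integral μ₁).integrable _)
      (((hF.comp fun z : G₁ × G₂ => ((z.1, 1), (1, z.2))).integral μ₂).integrable _),
    integral_add (((hF.comp fun z : G₂ × G₁ => ((1, z.1), (z.2, 1))).integral μ₁).integrable _)
      (((hF.comp fun z : G₂ × G₂ => ((1, z.1), (1, z.2))).integral μ₂).integrable _)] at h1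
  have p1 : 0 ≤ ∫ g, ∫ g', F ((g, 1), (g', 1)) ∂μ₁ ∂μ₁ :=
    integral_nonneg fun g => integral_nonneg fun g' => hF0 _
  have p2 : 0 ≤ ∫ g, ∫ h, F ((g, 1), (1, h)) ∂μ₂ ∂μ₁ :=
    integral_nonneg fun g => integral_nonneg fun g' => hF0 _
  have p3 : 0 ≤ ∫ h, ∫ g, F ((1, h), (g, 1)) ∂μ₁ ∂μ₂ :=
    integral_nonneg fun g => integral_nonneg fun g' => hF0 _
  have p4 : 0 ≤ ∫ h, ∫ h', F ((1, h), (1, h')) ∂μ₂ ∂μ₂ :=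
    integral_nonneg fun g => integral_nonneg fun g' => hF0 _
  have q1 : ∫ g, ∫ g', F ((g, 1), (g', 1)) ∂μ₁ ∂μ₁ ≤ 4 * ε := by linarith
  have q4 : ∫ h, ∫ h', F ((1, h), (1, h')) ∂μ₂ ∂μ₂ ≤ 4 * ε := by linarith
  refine ⟨?_, ?_, ?_⟩
  · simpa [F, IsAlmostHom] using q1
  · simpa [F, IsAlmostHom] using q4
  · have b2 := hF.comp fun z : G₂ × G₁ => ((z.2, 1), (1, z.1))
    have b3 := hF.comp fun z : G₂ × G₁ => ((1, z.1), (z.2, 1))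
    have b : IsBoundedFun fun z : G₂ × G₁ => normSq ((φ (z.2, 1) : A.Elt) * (φ (1, z.1) : A.Elt) -
        (φ (1, z.1) : A.Elt) * (φ (z.2, 1) : A.Elt)) :=
      isBoundedFun_normSq (fun z => normSq_unitary_mul_le (φ _).2 (φ _).2)
        fun z => normSq_unitary_mul_le (φ _).2 (φ _).2
    have e := integral_le_of_le_comb (μ := μ₂.prod μ₁) 2 2 0 0 b b2 b3 b3 fun z => by
      have hz := normSq_sub_le ((φ (z.2, 1) : A.Elt) * (φ (1, z.1) : A.Elt)) (φ (z.2, z.1))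
        ((φ (1, z.1) : A.Elt) * (φ (z.2, 1) : A.Elt))
      rw [normSq_sub_comm ((φ (z.2, 1) : A.Elt) * (φ (1, z.1) : A.Elt)) (φ (z.2, z.1))] at hz
      simp only [F, Prod.mk_mul_mk, mul_one, one_mul]
      linarith
    rw [integral_prod _ (b.integrable _), integral_prod _ (b2.integrable _),
      integral_prod _ (b3.integrable _)] at e
    have sw := integral_integral_swap (f := fun h g => F ((g, 1), (1, h)))
      (b2.integrable (μ₂.prod μ₁))
    dsimp only at e
    rw [sw] at e
    linarith

end Expand

/-- The Leibniz rule for the commutator with `p`, after replacing `V` by `v v'`. -/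
theorem normSq_commutator_mul_le {p V v v' : A.Elt} (hp : p ∈ unitary A.Elt) (hv : v ∈ unitary A.Elt)
    (hv' : v' ∈ unitary A.Elt) :
    normSq (p * V - V * p) ≤ 8 * normSq (V - v * v') + 4 * normSq (p * v - v * p) +
      4 * normSq (p * v' - v' * p) := by
  have h1 : p * V - V * p = (p * (V - v * v') + -((V - v * v') * p)) +
      ((p * v - v * p) * v' + v * (p * v' - v' * p)) := by noncomm_ring
  have h2 := normSq_add_le (p * (V - v * v') + -((V - v * v') * p))
    ((p * v - v * p) * v' + v * (p * v' - v' * p))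
  have h3 := normSq_add_le (p * (V - v * v')) (-((V - v * v') * p))
  have h4 := normSq_add_le ((p * v - v * p) * v') (v * (p * v' - v' * p))
  rw [normSq_neg, normSq_unitary_mul hp, normSq_mul_unitary hp] at h3
  rw [normSq_unitary_mul hv, normSq_mul_unitary hv'] at h4
  rw [h1]
  linarith

/-- Flexible closeness for direct products: if the restriction of `φ` to `G₁` is `d₁`-close to a
representation, and almost representations of `G₂` are `d₂`-close to representations. -/
theorem isFlexiblyClose_averagedMeasure [MeasurableSpace G₁] [MeasurableSpace G₂]
    [DiscreteMeasurableSpace G₁] [Countable G₁] [DiscreteMeasurableSpace G₂] [Countable G₂]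
    {μ₁ : Measure G₁} [IsProbabilityMeasure μ₁] {μ₂ : Measure G₂} [IsProbabilityMeasure μ₂]
    {C : Set TracialVN.{u}} (hsub : ClosedUnderSubalgebras C) (hdil : ClosedUnderDilations C)
    (hA : A ∈ C) {κ : ℝ} (hκ : 0 ≤ κ) (hgap : HasSpectralGap.{u} G₁ fun f => κ / 2 * ∫ g, f g ∂μ₁)
    {φ : G₁ × G₂ → unitary A.Elt} {ε d₁ d₂ : ℝ} (hε : 0 ≤ ε) (hd₁ : d₁ ≤ 4)
    (hφ : IsAlmostHom (averagedMeasure μ₁ μ₂) ε φ)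
    (h₁ : IsFlexiblyClose μ₁ d₁ fun g => φ (g, 1))
    (h₂ : ∀ N ∈ C, ∀ ψ : G₂ → unitary N.Elt,
      IsAlmostHom μ₂ (10000 * (1 + κ) * (d₁ + ε)) ψ → IsFlexiblyClose μ₂ d₂ ψ) :
    IsFlexiblyClose (averagedMeasure μ₁ μ₂) (20 * (10000 * (1 + κ) * (d₁ + ε) + d₂)) φ := by
  obtain ⟨-, hφ₂, hφ₁₂⟩ := hφ.expand
  have hd0 : 0 ≤ d₁ := by
    obtain ⟨P, w, π, -, -, -, -, -, -, h⟩ := h₁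
    exact (integral_nonneg fun g => normSq_nonneg _).trans h
  obtain ⟨N, j, D, P, w, V, π, Δ, hN, hP, ht1, htr, hw, hPw, hV, hDV, hD, hj, hj1, hΔmul, hΔD, hΔ1,
    hΔs, hΔs', hΔV, hint, hu⟩ := exists_commuting_dilation hsub hdil hA hκ hgap h₁
  have hfin : traceInf P ≠ ∞ := (htr.trans_lt ENNReal.ofReal_lt_top).ne
  let p : G₁ → A.Elt := fun g => φ (g, 1)
  let q : G₂ → A.Elt := fun h => φ (1, h)
  have hp : ∀ g, p g ∈ unitary A.Elt := fun g => (φ (g, 1)).2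
  have hq : ∀ h, q h ∈ unitary A.Elt := fun h => (φ (1, h)).2
  choose u hu using fun h => hu (q h) (hq h)
  let β : G₂ × G₁ → ℝ := fun z => normSq (p z.2 * q z.1 - q z.1 * p z.2)
  have hβ : IsBoundedFun β := isBoundedFun_normSq
    (fun z => normSq_unitary_mul_le (hp _) (hq _)) fun z => normSq_unitary_mul_le (hq _) (hp _)
  let b : G₂ → ℝ := fun h => ∫ g, β (h, g) ∂μ₁
  have hb : IsBoundedFun b := hβ.integral μ₁
  have hb0 : ∀ h, 0 ≤ b h := fun h => integral_nonneg fun g => normSq_nonneg _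
  have hbint : ∫ h, b h ∂μ₂ ≤ 16 * ε := hφ₁₂
  let E : G₂ × G₂ → ℝ := fun z => normSq (q (z.1 * z.2) - q z.1 * q z.2)
  have hE : IsBoundedFun E := isBoundedFun_normSq (fun z => (normSq_unitary (hq _)).le)
    fun z => normSq_unitary_mul_le (hq _) (hq _)
  have hEint : ∫ z, E z ∂μ₂.prod μ₂ ≤ 4 * ε := by
    rw [integral_prod _ (hE.integrable _)]
    exact hφ₂
  -- Only the `μ₂`-average of `b` is controlled, while multiplicativity of `u` involves `b` at
  -- products, distributed as the convolution square of `μ₂`. Almost multiplicativity of `q` reduces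
  -- products to their factors.
  have hbmul : ∀ z : G₂ × G₂, b (z.1 * z.2) ≤ 8 * E z + 4 * b z.1 + 4 * b z.2 := fun z => by
    have := integral_le_of_le_comb (μ := μ₁) 4 4 0 (8 * E z) (hβ.comp fun g => (z.1 * z.2, g))
      (hβ.comp fun g => (z.1, g)) (hβ.comp fun g => (z.2, g)) (hβ.comp fun g => (z.2, g)) fun g => by
        have := normSq_commutator_mul_le (V := q (z.1 * z.2)) (hp g) (hq z.1) (hq z.2)
        simp only [β, E]
        linarith
    change b (z.1 * z.2) ≤ 4 * b z.1 + 4 * b z.2 + 0 * b z.2 + 8 * E z at this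
    linarith
  -- The squared distance from `u h` to `w q(h) w*` provided by the spectral gap.
  let Γ : G₂ → ℝ := fun h => 6 * d₁ + 72 * κ * d₁ + 12 * κ * b h
  have hΓ0 : ∀ h, 0 ≤ Γ h := fun h => by have := hb0 h; positivity
  have hfst : ∀ f : G₂ → ℝ, IsBoundedFun f → ∫ z : G₂ × G₂, f z.1 ∂μ₂.prod μ₂ = ∫ h, f h ∂μ₂ := by
    intro f hf
    rw [integral_prod _ ((hf.comp Prod.fst).integrable _)]
    simp
  have hsnd : ∀ f : G₂ → ℝ, IsBoundedFun f → ∫ z : G₂ × G₂, f z.2 ∂μ₂.prod μ₂ = ∫ h, f h ∂μ₂ := by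
    intro f hf
    rw [integral_prod _ ((hf.comp Prod.snd).integrable _)]
    simp
  have hκε : 0 ≤ κ * ε := mul_nonneg hκ hε
  have hκd : 0 ≤ κ * d₁ := mul_nonneg hκ hd0
  have hψ : IsAlmostHom μ₂ (10000 * (1 + κ) * (d₁ + ε)) u := by
    let F : G₂ × G₂ → ℝ := fun z =>
      normSq ((u (z.1 * z.2) : N.Elt) - (u z.1 : N.Elt) * (u z.2 : N.Elt))
    have hF : IsBoundedFun F := isBoundedFun_normSq (fun z => (normSq_unitary (u _).2).le)
      fun z => normSq_unitary_mul_le (u _).2 (u _).2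
    -- Four times the sum of three `Γ`s and `E`: the factor `48 κ` of `b` at the product becomes
    -- `384 κ` on `E` and `192 κ` on each `b`, to which the direct contribution `48 κ` is added.
    have h1 := integral_le_of_le_comb (μ := μ₂.prod μ₂) (4 + 384 * κ) (240 * κ) (240 * κ)
      (72 * d₁ + 864 * (κ * d₁)) hF hE (hb.comp Prod.fst) (hb.comp Prod.snd) fun z => by
        have h2 := normSq_sub_mul_le ht1 hfin hw hj (hq z.2) (u z.1).2 (hΓ0 (z.1 * z.2)) (hΓ0 z.1)
          (hΓ0 z.2) (hu _) (hu _) (hu _)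
        have h3 := mul_le_mul_of_nonneg_left (hbmul z) (mul_nonneg (by norm_num : (0 : ℝ) ≤ 48) hκ)
        change F z ≤ 4 * (Γ (z.1 * z.2) + E z + Γ z.1 + Γ z.2) at h2
        simp only [Γ] at h2
        linarith
    rw [hfst b hb, hsnd b hb, integral_prod _ (hF.integrable _)] at h1
    refine h1.trans ?_
    have h4 := mul_le_mul_of_nonneg_left hEint (by positivity : 0 ≤ 4 + 384 * κ)
    have h5 := mul_le_mul_of_nonneg_left hbint (by positivity : 0 ≤ 240 * κ)
    linarith
  obtain ⟨Q, s, σ, hQ, hσ, hσmul, hs, hQs, hQtr, hσint⟩ := h₂ N hN u hψ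
  have hd₂ : 0 ≤ d₂ := (integral_nonneg fun g => normSq_nonneg _).trans hσint
  obtain ⟨P', w', π', hP', hπ', hπmul', hw', hPw', htr', hm₁, hm₂⟩ :=
    exists_iterated_dilation hP hw hPw hV hDV hD hj1 hΔmul hΔD hΔ1 hΔs hΔs' hΔV hQ hσ hσmul hs hQs
  set e₂ := 10000 * (1 + κ) * (d₁ + ε) with he₂
  have he : 10000 * (d₁ + ε + κ * d₁ + κ * ε) = e₂ := by rw [he₂]; ring
  refine ⟨P', w', π', hP', hπ', hπmul', hw', hPw', ?_, ?_⟩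
  · rw [htr']
    calc _ ≤ ENNReal.ofReal (1 + d₁) * ENNReal.ofReal (1 + d₂) := by gcongr
      _ = ENNReal.ofReal ((1 + d₁) * (1 + d₂)) := by rw [ENNReal.ofReal_mul (by positivity)]
      _ ≤ _ := ENNReal.ofReal_le_ofReal (by nlinarith)
  have hπn : ∀ x, ‖π' x‖ ≤ 1 := fun x => norm_le_one_of_star_mul_self hP' (hπ' x).2.1
  rw [integral_averagedMeasure μ₁ μ₂ (isBoundedFun_normSq (fun z => (normSq_unitary (φ z).2).le)
    fun z => normSq_entry_compression_le hw' (hπn z))]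
  simp only [hm₁, hm₂]
  have hσn : ∀ h, ‖σ h‖ ≤ 1 := fun h => norm_le_one_of_star_mul_self hQ (hσ h).2.1
  have h5 : ∫ h, normSq ((φ (1, h) : A.Elt) -
      entry (star w * j (entry (star s * σ h * s) 0 0) * w) 0 0) ∂μ₂ ≤
      (1 + d₁) * (24 * κ) * (∫ h, b h ∂μ₂) + (1 + d₁) * 2 * (∫ h, normSq ((u h : N.Elt) -
        entry (star s * σ h * s) 0 0) ∂μ₂) + 0 * (∫ h, b h ∂μ₂) +
      (1 + d₁) * (2 * (6 * d₁ + 72 * κ * d₁)) := by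
    refine integral_le_of_le_comb _ _ _ _ ?_ hb (isBoundedFun_normSq
      (fun z => (normSq_unitary (u z).2).le) fun z => normSq_entry_compression_le hs (hσn z)) hb
      fun h => ?_
    · refine isBoundedFun_normSq (fun z => (normSq_unitary (φ (1, z)).2).le) fun z => ?_
      rw [← hm₂]
      exact normSq_entry_compression_le hw' (hπn _)
    · have h6 := normSq_sub_entry_le hd0 htr hw hj (y := entry (star s * σ h * s) 0 0) (hΓ0 h) (hu h)
      change normSq ((φ (1, h) : A.Elt) - _) ≤ _ at h6
      refine h6.trans (le_of_eq ?_)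
      simp only [Γ]
      ring
  have h6 : ∫ g, normSq ((φ (g, 1) : A.Elt) - entry (star w * π g * w) 0 0) ∂μ₁ ≤ d₁ := hint
  have h7 := mul_le_mul_of_nonneg_left hbint (by positivity : 0 ≤ (1 + d₁) * (24 * κ))
  have h8 := mul_le_mul_of_nonneg_left hσint (by positivity : 0 ≤ (1 + d₁) * 2)
  -- The bound `d₁ ≤ 4` replaces the prefactor `1 + d₁` by `5`; it also turns the product of the two
  -- trace bounds into a linear one.
  have h9 : (1 + d₁) * (24 * κ) * (16 * ε) + (1 + d₁) * 2 * d₂ +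
      (1 + d₁) * (2 * (6 * d₁ + 72 * κ * d₁)) ≤
      5 * (384 * (κ * ε) + 2 * d₂ + 12 * d₁ + 144 * (κ * d₁)) := by
    have : (1 + d₁) * (384 * (κ * ε) + 2 * d₂ + 12 * d₁ + 144 * (κ * d₁)) ≤
      5 * (384 * (κ * ε) + 2 * d₂ + 12 * d₁ + 144 * (κ * d₁)) := by gcongr; linarith
    linarith
  linarith

end TracialVN

/-! ### Controls and moduli of flexible stability for products. -/

section Moduli

open TracialVN

variable {A : TracialVN.{u}}

theorem IsFlexiblyClose.mono {G : Type v} [Group G] [MeasurableSpace G] {μ : Measure G} {d d' : ℝ}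
    {φ : G → unitary A.Elt} (h : IsFlexiblyClose μ d φ) (hd : d ≤ d') : IsFlexiblyClose μ d' φ := by
  obtain ⟨P, w, π, h1, h2, h3, h4, h5, h6, h7⟩ := h
  exact ⟨P, w, π, h1, h2, h3, h4, h5, h6.trans (ENNReal.ofReal_le_ofReal (by linarith)),
    h7.trans hd⟩

/-- The trivial representation on `1_M` itself always does: elements of 2-norm at most one are at
squared distance at most four. -/
theorem isFlexiblyClose_four {G : Type v} [Group G] [MeasurableSpace G] [DiscreteMeasurableSpace G]
    [Countable G] (μ : Measure G) [IsProbabilityMeasure μ] (φ : G → unitary A.Elt) :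
    IsFlexiblyClose μ 4 φ := by
  have h1 := isStarProjection_corner_one (A := A)
  have h2 : corner (1 : A.Elt) * corner 1 = corner 1 := h1.isIdempotentElem.eq
  have h3 : star (corner (1 : A.Elt)) = corner 1 := h1.isSelfAdjoint.star_eq
  refine ⟨corner 1, corner 1, fun _ => corner 1, h1, fun g => ?_, fun g h => h2.symm, ?_, h2, ?_, ?_⟩
  · simp only [h3, h2, and_self]
  · rw [h3, h2]
  · rw [traceInf_corner_one, ← ENNReal.ofReal_one]
    exact ENNReal.ofReal_le_ofReal (by norm_num)
  · have h := integral_mono ((isBoundedFun_normSq (fun z => (normSq_unitary (φ z).2).le)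
      fun _ => normSq_entry_compression_le (w := corner (1 : A.Elt)) (by rw [h3, h2])
        h1.norm_le).integrable μ) (integrable_const 4)
      fun g => normSq_sub_le_four (normSq_unitary (φ g).2).le
        (normSq_entry_compression_le (by rw [h3, h2]) h1.norm_le)
    simpa using h

theorem isAlmostHom_four {G : Type v} [Group G] [MeasurableSpace G] [DiscreteMeasurableSpace G]
    [Countable G] (μ : Measure G) [IsProbabilityMeasure μ] (φ : G → unitary A.Elt) :
    IsAlmostHom μ 4 φ := by
  have hb : IsBoundedFun fun z : G × G =>
      normSq ((φ (z.1 * z.2) : A.Elt) - (φ z.1 : A.Elt) * (φ z.2 : A.Elt)) :=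
    isBoundedFun_normSq (fun z => (normSq_unitary (φ _).2).le)
      fun z => normSq_unitary_mul_le (φ _).2 (φ _).2
  have h := integral_mono (hb.integrable (μ.prod μ)) (integrable_const 4) fun z =>
    normSq_sub_le_four (normSq_unitary (φ _).2).le (normSq_unitary_mul_le (φ _).2 (φ _).2)
  rw [integral_prod _ (hb.integrable _)] at h
  simpa [IsAlmostHom] using h

theorem IsAlmostHom.min_four {G : Type v} [Group G] [MeasurableSpace G] [DiscreteMeasurableSpace G]
    [Countable G] {μ : Measure G} [IsProbabilityMeasure μ] {φ : G → unitary A.Elt} {ε : ℝ}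
    (h : IsAlmostHom μ ε φ) : IsAlmostHom μ (min 4 ε) φ :=
  le_min (isAlmostHom_four μ φ) h

variable {C : Set TracialVN.{u}} {G₁ : Type v} {G₂ : Type w} [Group G₁] [Group G₂]
  [MeasurableSpace G₁] [MeasurableSpace G₂] [DiscreteMeasurableSpace G₁] [Countable G₁]
  [DiscreteMeasurableSpace G₂] [Countable G₂]
  {μ₁ : Measure G₁} [IsProbabilityMeasure μ₁] {μ₂ : Measure G₂} [IsProbabilityMeasure μ₂]
  {δ₁ δ₂ : ℝ → ℝ} {κ : ℝ}

/-- Controls are meaningful on `[0, 4]` only. Defects above `4` are truncated, which is harmless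
because a squared defect never exceeds `4`, and neither does the best closeness constant. -/
theorem IsFlexibleControl.prod_close (hsub : ClosedUnderSubalgebras C) (hdil : ClosedUnderDilations C)
    (hκ : 0 ≤ κ) (hgap : HasSpectralGap.{u} G₁ fun f => κ / 2 * ∫ g, f g ∂μ₁)
    (h₁ : IsFlexibleControl C μ₁ δ₁) (h₂ : IsFlexibleControl C μ₂ δ₂) {ε E : ℝ} (hε : 0 ≤ ε)
    (hE : 10000 * (1 + κ) * (δ₁ (min 4 (4 * ε)) + ε) = E)
    (hA : A ∈ C) {φ : G₁ × G₂ → unitary A.Elt} (hφ : IsAlmostHom (averagedMeasure μ₁ μ₂) ε φ) :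
    IsFlexiblyClose (averagedMeasure μ₁ μ₂) (min 4 (20 * (E + δ₂ (min 4 E)))) φ := by
  have hmem : min 4 (4 * ε) ∈ Set.Icc (0 : ℝ) 4 := ⟨by positivity, min_le_left _ _⟩
  have hd := h₁.mapsTo hmem
  have hE0 : 0 ≤ E := by
    rw [← hE]
    exact mul_nonneg (by positivity) (add_nonneg hd.1 hε)
  have h3 := isFlexiblyClose_averagedMeasure (d₂ := δ₂ (min 4 E)) hsub hdil hA hκ hgap hε hd.2 hφ
    (h₁.close _ hmem A hA _ hφ.expand.1.min_four) fun N hN ψ hψ =>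
      h₂.close _ ⟨le_min (by norm_num) hE0, min_le_left _ _⟩ N hN ψ (hE ▸ hψ).min_four
  rw [hE] at h3
  rcases min_choice 4 (20 * (E + δ₂ (min 4 E))) with h | h
  · rw [h]; exact isFlexiblyClose_four _ _
  · rw [h]; exact h3

theorem tendsto_min_four {f : ℝ → ℝ} (hf : Tendsto f (𝓝[>] 0) (𝓝 0)) (hpos : ∀ᶠ x in 𝓝[>] 0, 0 < f x) :
    Tendsto (fun x => min 4 (f x)) (𝓝[>] 0) (𝓝[>] 0) := by
  refine tendsto_nhdsWithin_iff.2 ⟨?_, hpos.mono fun x hx => lt_min (by norm_num) hx⟩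
  have := (tendsto_const_nhds (x := (4 : ℝ))).min hf
  rwa [min_eq_right (by norm_num : (0 : ℝ) ≤ 4)] at this

theorem IsFlexiblyStable.prod (hsub : ClosedUnderSubalgebras C) (hdil : ClosedUnderDilations C)
    (hκ : 0 ≤ κ) (hgap : HasSpectralGap.{u} G₁ fun f => κ / 2 * ∫ g, f g ∂μ₁)
    (h₁ : IsFlexiblyStable C μ₁) (h₂ : IsFlexiblyStable C μ₂) :
    IsFlexiblyStable C (averagedMeasure μ₁ μ₂) := by
  obtain ⟨δ₁, h₁⟩ := h₁
  obtain ⟨δ₂, h₂⟩ := h₂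
  let E : ℝ → ℝ := fun ε => 10000 * (1 + κ) * (δ₁ (min 4 (4 * ε)) + ε)
  have hmem : ∀ x : ℝ, 0 ≤ x → min 4 x ∈ Set.Icc (0 : ℝ) 4 :=
    fun x hx => ⟨le_min (by norm_num) hx, min_le_left _ _⟩
  have hE0 : ∀ ε, 0 ≤ ε → 0 ≤ E ε := fun ε hε =>
    mul_nonneg (by positivity) (add_nonneg (h₁.mapsTo (hmem _ (by positivity))).1 hε)
  have hEmono : ∀ ε ε', 0 ≤ ε → ε ≤ ε' → E ε ≤ E ε' := fun ε ε' h0 h => by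
    have := h₁.monotoneOn (hmem (4 * ε) (by positivity)) (hmem (4 * ε') (by linarith))
      (min_le_min_left _ (by linarith))
    exact mul_le_mul_of_nonneg_left (by linarith) (by positivity)
  have hid : Tendsto (fun ε : ℝ => 4 * ε) (𝓝[>] 0) (𝓝 0) := by
    have : Tendsto (fun ε : ℝ => 4 * ε) (𝓝 0) (𝓝 (4 * 0)) := tendsto_id.const_mul 4
    rw [mul_zero] at this
    exact this.mono_left nhdsWithin_le_nhds
  have hself : ∀ᶠ x : ℝ in 𝓝[>] 0, 0 < x := self_mem_nhdsWithin
  have hEt : Tendsto E (𝓝[>] 0) (𝓝 0) := by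
    have h3 := h₁.tendsto.comp (tendsto_min_four hid (hself.mono fun x hx => by positivity))
    have h4 : Tendsto (fun ε : ℝ => ε) (𝓝[>] 0) (𝓝 0) := tendsto_id.mono_left nhdsWithin_le_nhds
    have := (h3.add h4).const_mul (10000 * (1 + κ))
    rwa [add_zero, mul_zero] at this
  -- `δ₂` tends to zero along positive arguments, so `E` must be positive; the summand `ε` ensures
  -- this even if `δ₁` vanishes.
  have hEpos : ∀ᶠ x : ℝ in 𝓝[>] 0, 0 < E x := hself.mono fun x hx =>
    mul_pos (by positivity) (add_pos_of_nonneg_of_pos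
      (h₁.mapsTo (hmem _ (by positivity))).1 hx)
  refine ⟨fun ε => min 4 (20 * (E ε + δ₂ (min 4 (E ε)))), fun ε hε => ?_, fun ε hε ε' hε' h => ?_,
    ?_, fun ε hε A hA φ hφ => h₁.prod_close hsub hdil hκ hgap h₂ hε.1 rfl hA hφ⟩
  · have := (h₂.mapsTo (hmem _ (hE0 ε hε.1))).1
    have := hE0 ε hε.1
    exact hmem _ (by positivity)
  · have h3 := hEmono ε ε' hε.1 h
    have := h₂.monotoneOn (hmem _ (hE0 ε hε.1)) (hmem _ (hE0 ε' hε'.1)) (min_le_min_left _ h3)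
    exact min_le_min_left _ (by linarith)
  · have h3 := (hEt.add (h₂.tendsto.comp (tendsto_min_four hEt hEpos))).const_mul 20
    have := (tendsto_const_nhds (x := (4 : ℝ))).min h3
    simpa using this

namespace IsFlexibleModulus

variable {G : Type v} [Group G] [MeasurableSpace G] {μ : Measure G} {δ : ℝ → ℝ}

/-- For a concave function nonnegative at `0`, the quotient `δ x / x` is nonincreasing. If `x = 0`,
then `y = 0`. -/
theorem le_mul (h : IsFlexibleModulus C μ δ) {x y L : ℝ} (hx : 0 ≤ x) (hxy : x ≤ y) (hy : y ≤ 4)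
    (hL : 1 ≤ L) (hyL : y ≤ L * x) : δ y ≤ L * δ x := by
  have hmx : x ∈ Set.Icc (0 : ℝ) 4 := ⟨hx, hxy.trans hy⟩
  have hδx := (h.mapsTo hmx).1
  have hδy := (h.mapsTo (⟨hx.trans hxy, hy⟩ : y ∈ Set.Icc (0 : ℝ) 4)).1
  rcases hx.eq_or_lt with rfl | hx0
  · obtain rfl : y = 0 := le_antisymm (by simpa using hyL) hxy
    exact le_mul_of_one_le_left hδx hL
  · have hy0 := hx0.trans_le hxy
    have h0 := (h.mapsTo (⟨le_rfl, by norm_num⟩ : (0 : ℝ) ∈ Set.Icc (0 : ℝ) 4)).1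
    have hc := h.concaveOn.2 (⟨hy0.le, hy⟩ : y ∈ Set.Icc (0 : ℝ) 4)
      (⟨le_rfl, by norm_num⟩ : (0 : ℝ) ∈ Set.Icc (0 : ℝ) 4)
      (show 0 ≤ x / y by positivity)
      (show 0 ≤ 1 - x / y by rw [sub_nonneg, div_le_one hy0]; exact hxy) (by ring)
    simp only [smul_eq_mul, mul_zero, add_zero, div_mul_cancel₀ x hy0.ne'] at hc
    have h1 : 0 ≤ (1 - x / y) * δ 0 :=
      mul_nonneg (by rw [sub_nonneg, div_le_one hy0]; exact hxy) h0
    have h2 : 1 ≤ L * (x / y) := by rw [← mul_div_assoc, le_div_iff₀ hy0]; linarith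
    nlinarith [mul_le_mul_of_nonneg_left hc (by linarith : 0 ≤ L)]

/-- The chord from `(0, δ 0)` to `(4, 4)` lies above the diagonal, and `δ` lies above the chord. -/
theorem le_apply (h : IsFlexibleModulus C μ δ) {x : ℝ} (hx : x ∈ Set.Icc (0 : ℝ) 4) : x ≤ δ x := by
  have h0 := (h.mapsTo (⟨le_rfl, by norm_num⟩ : (0 : ℝ) ∈ Set.Icc (0 : ℝ) 4)).1
  have hc := h.concaveOn.2 (⟨by norm_num, le_rfl⟩ : (4 : ℝ) ∈ Set.Icc (0 : ℝ) 4)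
    (⟨le_rfl, by norm_num⟩ : (0 : ℝ) ∈ Set.Icc (0 : ℝ) 4)
    (show 0 ≤ x / 4 by linarith [hx.1]) (show 0 ≤ 1 - x / 4 by linarith [hx.2]) (by ring)
  simp only [smul_eq_mul, mul_zero, add_zero, h.map_four] at hc
  have h1 : 0 ≤ (1 - x / 4) * δ 0 := mul_nonneg (by linarith [hx.2]) h0
  rw [div_mul_cancel₀ x (by norm_num)] at hc
  linarith

end IsFlexibleModulus

/-- A concave nondecreasing function of a concave function is concave, and truncation at `4`
preserves this. The constant is `20 * 2 * 150000`: the factor `2` absorbs `E` into `δ₂ E`. -/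
theorem IsFlexibleModulus.prod (hsub : ClosedUnderSubalgebras C) (hdil : ClosedUnderDilations C)
    (hκ : 1 / 2 ≤ κ) (hgap : HasSpectralGap.{u} G₁ fun f => κ / 2 * ∫ g, f g ∂μ₁)
    (h₁ : IsFlexibleModulus C μ₁ δ₁) (h₂ : IsFlexibleModulus C μ₂ δ₂) :
    IsFlexibleModulus C (averagedMeasure μ₁ μ₂)
      fun ε => min 4 (6000000 * δ₂ (min 4 (κ * δ₁ ε))) := by
  have hmem : ∀ x : ℝ, 0 ≤ x → min 4 x ∈ Set.Icc (0 : ℝ) 4 :=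
    fun x hx => ⟨le_min (by norm_num) hx, min_le_left _ _⟩
  have hκ0 : 0 ≤ κ := by linarith
  have hs : ∀ ε ∈ Set.Icc (0 : ℝ) 4, 0 ≤ κ * δ₁ ε := fun ε hε => mul_nonneg hκ0 (h₁.mapsTo hε).1
  have hδ : ∀ ε ∈ Set.Icc (0 : ℝ) 4, 0 ≤ δ₂ (min 4 (κ * δ₁ ε)) := fun ε hε =>
    (h₂.mapsTo (hmem _ (hs ε hε))).1
  refine ⟨⟨fun ε hε => ?_, fun ε hε ε' hε' h => ?_, ?_, fun ε hε A hA φ hφ => ?_⟩, ⟨convex_Icc _ _,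
    fun ε hε ε' hε' a b ha hb hab => ?_⟩, ?_⟩
  · have := hδ ε hε
    exact hmem _ (by positivity)
  · have h3 := mul_le_mul_of_nonneg_left (h₁.monotoneOn hε hε' h) hκ0
    have h4 := h₂.monotoneOn (hmem _ (hs ε hε)) (hmem _ (hs ε' hε')) (min_le_min_left _ h3)
    exact min_le_min_left _ (by linarith)
  · have h3 : Tendsto (fun ε => κ * δ₁ ε) (𝓝[>] 0) (𝓝 0) := by
      have := h₁.tendsto.const_mul κ
      rwa [mul_zero] at this
    have hpos : ∀ᶠ x in 𝓝[>] (0 : ℝ), 0 < κ * δ₁ x := by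
      filter_upwards [Ioc_mem_nhdsGT (show (0 : ℝ) < 4 by norm_num)] with x hx
      have := h₁.le_apply ⟨hx.1.le, hx.2⟩
      exact mul_pos (by linarith) (hx.1.trans_le this)
    have h4 := (h₂.tendsto.comp (tendsto_min_four h3 hpos)).const_mul 6000000
    have := (tendsto_const_nhds (x := (4 : ℝ))).min h4
    simpa using this
  · set E := 10000 * (1 + κ) * (δ₁ (min 4 (4 * ε)) + ε) with hE
    have h3 := h₁.prod_close hsub hdil hκ0 hgap h₂.toIsFlexibleControl hε.1 hE.symm hA hφ
    refine h3.mono (le_min (min_le_left _ _) ?_)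
    have hδ₁ := (h₁.mapsTo (hmem (4 * ε) (by linarith [hε.1]))).1
    have hE0 : 0 ≤ E := mul_nonneg (by positivity) (add_nonneg hδ₁ hε.1)
    have h4 : δ₁ (min 4 (4 * ε)) ≤ 4 * δ₁ ε :=
      h₁.le_mul hε.1 (le_min hε.2 (by linarith [hε.1])) (min_le_left _ _) (by norm_num)
        (min_le_right _ _)
    have h5 := h₁.le_apply hε
    -- `1 + κ ≤ 3 κ` because `κ ≥ 1/2`, and `δ₁ (4 ε) + ε ≤ 5 δ₁ ε`.
    have h6 : E ≤ 150000 * (κ * δ₁ ε) := by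
      have : E ≤ 10000 * (1 + κ) * (5 * δ₁ ε) :=
        mul_le_mul_of_nonneg_left (by linarith) (by positivity)
      nlinarith [(h₁.mapsTo hε).1]
    have h7 : δ₂ (min 4 E) ≤ 150000 * δ₂ (min 4 (κ * δ₁ ε)) := by
      rcases le_total (min 4 E) (min 4 (κ * δ₁ ε)) with h | h
      · have h8 := h₂.monotoneOn (hmem _ hE0) (hmem _ (hs ε hε)) h
        have := hδ ε hε
        linarith
      · refine h₂.le_mul (hmem _ (hs ε hε)).1 h (min_le_left _ _) (by norm_num) ?_
        rcases min_choice 4 (κ * δ₁ ε) with h9 | h9 <;> rw [h9]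
        · exact (min_le_left _ _).trans (by norm_num)
        · exact (min_le_right _ _).trans h6
    have h8 := h₂.le_apply (hmem _ hE0)
    have h9 := (h₂.mapsTo (hmem _ hE0)).1
    -- Beyond `4` the summand `E` cannot be absorbed, but then `δ₂ 4 ≥ 4` already makes the claimed
    -- modulus reach its cap.
    rcases le_total E 4 with h | h
    · rw [min_eq_right h] at h7 h8 ⊢
      exact (min_le_right _ _).trans (by linarith)
    · rw [min_eq_left h] at h7 h8
      exact (min_le_left _ _).trans (by linarith)
  · have hm := convex_Icc (0 : ℝ) 4 hε hε' ha hb hab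
    have h3 := h₁.concaveOn.2 hε hε' ha hb hab
    simp only [smul_eq_mul] at h3 hm ⊢
    have h4 := mul_le_mul_of_nonneg_left h3 hκ0
    have h5 : a * min 4 (κ * δ₁ ε) + b * min 4 (κ * δ₁ ε') ≤ min 4 (κ * δ₁ (a * ε + b * ε')) := by
      refine le_min ?_ ?_
      · have e1 := mul_le_mul_of_nonneg_left (min_le_left 4 (κ * δ₁ ε)) ha
        have e2 := mul_le_mul_of_nonneg_left (min_le_left 4 (κ * δ₁ ε')) hb
        nlinarith
      · have e1 := mul_le_mul_of_nonneg_left (min_le_right 4 (κ * δ₁ ε)) ha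
        have e2 := mul_le_mul_of_nonneg_left (min_le_right 4 (κ * δ₁ ε')) hb
        linarith
    have hm1 := hmem _ (hs ε hε)
    have hm2 := hmem _ (hs ε' hε')
    have h6 := h₂.concaveOn.2 hm1 hm2 ha hb hab
    have h7 := h₂.monotoneOn (convex_Icc (0 : ℝ) 4 hm1 hm2 ha hb hab) (hmem _ (hs _ hm)) h5
    simp only [smul_eq_mul] at h6 h7
    refine le_min ?_ ?_
    · have e1 := mul_le_mul_of_nonneg_left (min_le_left 4 (6000000 * δ₂ (min 4 (κ * δ₁ ε)))) ha
      have e2 := mul_le_mul_of_nonneg_left (min_le_left 4 (6000000 * δ₂ (min 4 (κ * δ₁ ε')))) hb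
      nlinarith
    · have e1 := mul_le_mul_of_nonneg_left (min_le_right 4 (6000000 * δ₂ (min 4 (κ * δ₁ ε)))) ha
      have e2 := mul_le_mul_of_nonneg_left (min_le_right 4 (6000000 * δ₂ (min 4 (κ * δ₁ ε')))) hb
      linarith
  · have h3 := h₂.le_apply (hmem (κ * 4) (by linarith))
    -- The bound `κ ≥ 1/2` keeps the argument of `δ₂` away from zero, so that the truncated modulus
    -- takes the value `4` at `4`.
    have h4 : (2 : ℝ) ≤ min 4 (κ * 4) := le_min (by norm_num) (by linarith)
    rw [h₁.map_four]
    exact min_eq_left (by linarith)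

end Moduli

/-! ### Unnormalized Hilbert–Schmidt norms of rectangular matrices. -/

section Matrices

open Matrix
open scoped Kronecker

variable {l m n : Type*} [Fintype l] [Fintype m] [Fintype n]

/-- The square of the Hilbert-Schmidt norm of a rectangular matrix. -/
def hsSq (X : Matrix m n ℂ) : ℝ := (trace (Xᴴ * X)).re

theorem hsSq_eq_sum (X : Matrix m n ℂ) : hsSq X = ∑ j, ∑ i, ‖X i j‖ ^ 2 := by
  simp only [hsSq, trace, diag_apply, mul_apply, conjTranspose_apply, Complex.re_sum]
  refine Finset.sum_congr rfl fun j _ => Finset.sum_congr rfl fun i _ => ?_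
  rw [Complex.star_def, ← Complex.normSq_eq_conj_mul_self, Complex.ofReal_re,
    Complex.normSq_eq_norm_sq]

theorem hsSq_nonneg (X : Matrix m n ℂ) : 0 ≤ hsSq X := by
  rw [hsSq_eq_sum]; positivity

theorem hsSq_conjTranspose (X : Matrix m n ℂ) : hsSq Xᴴ = hsSq X := by
  rw [hsSq, hsSq, conjTranspose_conjTranspose, trace_mul_comm]

theorem hsSq_neg (X : Matrix m n ℂ) : hsSq (-X) = hsSq X := by simp [hsSq]

theorem hsSq_sub_comm (X Y : Matrix m n ℂ) : hsSq (X - Y) = hsSq (Y - X) := by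
  rw [← hsSq_neg, neg_sub]

theorem hsSq_add_le (X Y : Matrix m n ℂ) : hsSq (X + Y) ≤ 2 * hsSq X + 2 * hsSq Y := by
  simp only [hsSq_eq_sum, Finset.mul_sum, ← Finset.sum_add_distrib]
  refine Finset.sum_le_sum fun j _ => Finset.sum_le_sum fun i _ => ?_
  have := norm_add_le (X i j) (Y i j)
  rw [Matrix.add_apply]
  nlinarith [norm_nonneg (X i j + Y i j), sq_nonneg (‖X i j‖ - ‖Y i j‖)]

theorem hsSq_sub_le (X Y Z : Matrix m n ℂ) : hsSq (X - Z) ≤ 2 * hsSq (X - Y) + 2 * hsSq (Y - Z) := by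
  rw [← sub_add_sub_cancel X Y Z]
  exact hsSq_add_le _ _

theorem hsSq_eq_zero {X : Matrix m n ℂ} (h : hsSq X = 0) : X = 0 := by
  rw [hsSq_eq_sum] at h
  ext i j
  have h1 := (Finset.sum_eq_zero_iff_of_nonneg fun j _ => by positivity).1 h j (Finset.mem_univ j)
  have h2 := (Finset.sum_eq_zero_iff_of_nonneg fun i _ => by positivity).1 h1 i (Finset.mem_univ i)
  simpa using h2

theorem hsSq_isometry_mul [DecidableEq m] {V : Matrix l m ℂ} (hV : Vᴴ * V = 1) (X : Matrix m n ℂ) :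
    hsSq (V * X) = hsSq X := by
  rw [hsSq, conjTranspose_mul, Matrix.mul_assoc, ← Matrix.mul_assoc Vᴴ, hV, Matrix.one_mul, hsSq]

theorem hsSq_mul_isometry [DecidableEq m] {V : Matrix l m ℂ} (hV : Vᴴ * V = 1) (X : Matrix n m ℂ) :
    hsSq (X * Vᴴ) = hsSq X := by
  rw [← hsSq_conjTranspose, conjTranspose_mul, conjTranspose_conjTranspose, hsSq_isometry_mul hV,
    hsSq_conjTranspose]

/-- The difference is the squared norm of the part of `X` outside the range of `V`. -/
theorem hsSq_compress_le [DecidableEq m] {V : Matrix l m ℂ} (hV : Vᴴ * V = 1)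
    (X : Matrix l n ℂ) : hsSq (Vᴴ * X) ≤ hsSq X := by
  classical
  have h1 : hsSq X - hsSq (Vᴴ * X) = hsSq (X - V * (Vᴴ * X)) := by
    have h2 : (X - V * (Vᴴ * X))ᴴ * (X - V * (Vᴴ * X)) = Xᴴ * X - (Vᴴ * X)ᴴ * (Vᴴ * X) := by
      simp only [conjTranspose_sub, conjTranspose_mul, conjTranspose_conjTranspose, Matrix.sub_mul,
        Matrix.mul_sub, Matrix.mul_assoc]
      rw [← Matrix.mul_assoc Vᴴ V, hV, Matrix.one_mul]
      abel
    rw [hsSq, hsSq, hsSq, h2, trace_sub, Complex.sub_re]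
  linarith [hsSq_nonneg (X - V * (Vᴴ * X))]

theorem hsSq_mul_compress_le [DecidableEq m] {V : Matrix l m ℂ} (hV : Vᴴ * V = 1)
    (X : Matrix n l ℂ) : hsSq (X * V) ≤ hsSq X := by
  rw [← hsSq_conjTranspose, conjTranspose_mul, ← hsSq_conjTranspose X]
  exact hsSq_compress_le hV _

theorem hsSq_unitary_mul [DecidableEq m] {U : Matrix m m ℂ} (hU : U ∈ unitaryGroup m ℂ)
    (X : Matrix m n ℂ) : hsSq (U * X) = hsSq X :=
  hsSq_isometry_mul (mem_unitaryGroup_iff'.1 hU) X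

theorem hsSq_mul_unitary [DecidableEq m] {U : Matrix m m ℂ} (hU : U ∈ unitaryGroup m ℂ)
    (X : Matrix n m ℂ) : hsSq (X * U) = hsSq X := by
  have h : Uᴴᴴ * Uᴴ = 1 := by
    rw [conjTranspose_conjTranspose]; exact mem_unitaryGroup_iff.1 hU
  have := hsSq_mul_isometry h X
  rwa [conjTranspose_conjTranspose] at this

theorem hsSq_unitary [DecidableEq m] {U : Matrix m m ℂ} (hU : U ∈ unitaryGroup m ℂ) :
    hsSq U = Fintype.card m := by
  have h := mem_unitaryGroup_iff'.1 hU
  rw [star_eq_conjTranspose] at h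
  rw [hsSq, h, trace_one]; simp

theorem hsSq_unitary_sub_le [DecidableEq m] {U U' : Matrix m m ℂ} (hU : U ∈ unitaryGroup m ℂ)
    (hU' : U' ∈ unitaryGroup m ℂ) : hsSq (U - U') ≤ 4 * Fintype.card m := by
  have := hsSq_sub_le U 0 U'
  rw [sub_zero, zero_sub, hsSq_neg, hsSq_unitary hU, hsSq_unitary hU'] at this
  linarith

theorem hsSq_kronecker_one [DecidableEq m] (X : Matrix l n ℂ) :
    hsSq (X ⊗ₖ (1 : Matrix m m ℂ)) = Fintype.card m * hsSq X := by
  rw [hsSq, conjTranspose_kronecker, conjTranspose_one, ← mul_kronecker_mul, Matrix.one_mul,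
    trace_kronecker, trace_one, hsSq, mul_comm]
  simp

theorem hsNormSq_eq {d : ℕ} (X : Matrix (Fin d) (Fin d) ℂ) : hsNormSq X = hsSq X / d := rfl

end Matrices

/-! ### Subrepresentations cut out by intertwiners. -/

section Intertwiners

open Matrix
open scoped Kronecker

variable {G : Type v} [Group G] {n : Type} [Fintype n] [DecidableEq n]

/-- The kernel of an intertwiner of a unitary representation, as the range of an isometry. -/
theorem exists_isometry_ker (π : G →* unitaryGroup n ℂ) {B : Matrix n n ℂ}
    (hB : ∀ g, B * (π g : Matrix n n ℂ) = (π g : Matrix n n ℂ) * B) :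
    ∃ (m : ℕ) (R : Matrix n (Fin m) ℂ) (ρ : G →* unitaryGroup (Fin m) ℂ), Rᴴ * R = 1 ∧ B * R = 0 ∧
      (∀ x : n → ℂ, B *ᵥ x = 0 → (R * Rᴴ) *ᵥ x = x) ∧
      ∀ g, (π g : Matrix n n ℂ) * R = R * (ρ g : Matrix (Fin m) (Fin m) ℂ) := by
  let Y : Submodule ℂ (EuclideanSpace ℂ n) := LinearMap.ker (Matrix.toEuclideanLin B)
  let b := stdOrthonormalBasis ℂ Y
  let R : Matrix n (Fin (Module.finrank ℂ Y)) ℂ := of fun x l => (b l : EuclideanSpace ℂ n) x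
  have hY : ∀ x : EuclideanSpace ℂ n, x ∈ Y ↔ B *ᵥ x.ofLp = 0 := fun x => by
    rw [LinearMap.mem_ker, toLpLin_apply]
    simp
  have hR1 : Rᴴ * R = 1 := by
    ext i j
    have h := orthonormal_iff_ite.1 b.orthonormal i j
    rw [Submodule.coe_inner, PiLp.inner_apply] at h
    simp only [mul_apply, conjTranspose_apply, R, of_apply, one_apply]
    rw [← h]
    refine Finset.sum_congr rfl fun x _ => ?_
    rw [RCLike.inner_apply, mul_comm]; rfl
  have hR2 : ∀ x : n → ℂ, B *ᵥ x = 0 → (R * Rᴴ) *ᵥ x = x := by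
    intro x hx
    have h := congrArg (fun y : Y => (y : EuclideanSpace ℂ n)) (b.sum_repr' ⟨WithLp.toLp 2 x, (hY _).2 hx⟩)
    ext i
    have h2 := congrArg (fun y : EuclideanSpace ℂ n => y i) h
    simp only [Submodule.coe_sum, Submodule.coe_smul, WithLp.ofLp_sum, Finset.sum_apply,
      WithLp.ofLp_smul, Pi.smul_apply, smul_eq_mul] at h2
    rw [← mulVec_mulVec, ← h2]
    simp only [mulVec, dotProduct, conjTranspose_apply, R, of_apply]
    refine Finset.sum_congr rfl fun j _ => ?_
    rw [mul_comm]
    congr 1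
    rw [Submodule.coe_inner, PiLp.inner_apply]
    refine Finset.sum_congr rfl fun y _ => ?_
    rw [RCLike.inner_apply, mul_comm]; rfl
  have hR3 : B * R = 0 := by
    ext i j
    exact congrFun ((hY _).1 (b j).2) i
  have hR4 : ∀ g, R * Rᴴ * ((π g : Matrix n n ℂ) * R) = (π g : Matrix n n ℂ) * R := by
    intro g
    have h3 : B * ((π g : Matrix n n ℂ) * R) = 0 := by
      rw [← Matrix.mul_assoc, hB, Matrix.mul_assoc, hR3, Matrix.mul_zero]
    ext i j
    have := congrFun (hR2 (fun x => ((π g : Matrix n n ℂ) * R) x j) (by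
      ext i; exact congrFun (congrFun h3 i) j)) i
    exact this
  have hmem : ∀ g, Rᴴ * (π g : Matrix n n ℂ) * R ∈ unitaryGroup (Fin (Module.finrank ℂ Y)) ℂ := by
    intro g
    rw [mem_unitaryGroup_iff', star_eq_conjTranspose]
    have h4 := mem_unitaryGroup_iff'.1 (π g).2
    rw [star_eq_conjTranspose] at h4
    calc _ = Rᴴ * (π g : Matrix n n ℂ)ᴴ * (R * Rᴴ * ((π g : Matrix n n ℂ) * R)) := by
          simp only [conjTranspose_mul, conjTranspose_conjTranspose, Matrix.mul_assoc]
      _ = Rᴴ * ((π g : Matrix n n ℂ)ᴴ * (π g : Matrix n n ℂ)) * R := by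
          rw [hR4]; simp only [Matrix.mul_assoc]
      _ = 1 := by rw [h4, Matrix.mul_one, hR1]
  refine ⟨_, R, MonoidHom.mk' (fun g => ⟨Rᴴ * (π g : Matrix n n ℂ) * R, hmem g⟩) fun g h => ?_, hR1,
    hR3, hR2, fun g => ?_⟩
  · refine Subtype.ext ?_
    change Rᴴ * ((π (g * h) : unitaryGroup n ℂ) : Matrix n n ℂ) * R =
      Rᴴ * (π g : Matrix n n ℂ) * R * (Rᴴ * (π h : Matrix n n ℂ) * R)
    calc _ = Rᴴ * (π g : Matrix n n ℂ) * ((π h : Matrix n n ℂ) * R) := by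
          rw [map_mul, Submonoid.coe_mul]; simp only [Matrix.mul_assoc]
      _ = _ := by rw [← hR4 h]; simp only [Matrix.mul_assoc]
  · change _ = R * (Rᴴ * (π g : Matrix n n ℂ) * R)
    rw [← hR4 g]; simp only [Matrix.mul_assoc]

end Intertwiners

/-! ### Irreducible and isotypic parts of finite-dimensional representations. -/

section Intertwiners

open Matrix
open scoped Kronecker

variable {G : Type v} [Group G] {n : Type} [Fintype n] [DecidableEq n]

/-- `1 - R R*` is a projection whose trace is the difference of the dimensions, hence nonpositive.
-/
theorem mul_conjTranspose_eq_one_of_card_le {m : Type} [Fintype m] [DecidableEq m] {R : Matrix n m ℂ}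
    (hR : Rᴴ * R = 1) (h : Fintype.card n ≤ Fintype.card m) : R * Rᴴ = 1 := by
  have h1 : (1 - R * Rᴴ)ᴴ * (1 - R * Rᴴ) = 1 - R * Rᴴ := by
    have h0 : R * Rᴴ * (R * Rᴴ) = R * Rᴴ := by
      rw [Matrix.mul_assoc, ← Matrix.mul_assoc Rᴴ, hR, Matrix.one_mul]
    rw [conjTranspose_sub, conjTranspose_one, conjTranspose_mul, conjTranspose_conjTranspose,
      sub_mul, one_mul, mul_sub, mul_one, h0, sub_self, sub_zero]
  have h2 : hsSq (1 - R * Rᴴ) = Fintype.card n - Fintype.card m := by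
    rw [hsSq, h1, trace_sub, trace_mul_comm, hR, trace_one, trace_one]
    simp
  have h3 : ((Fintype.card n : ℕ) : ℝ) ≤ (Fintype.card m : ℕ) := by exact_mod_cast h
  have h4 := hsSq_eq_zero (le_antisymm (by linarith) (hsSq_nonneg (1 - R * Rᴴ)))
  exact (sub_eq_zero.1 h4).symm

/-- An irreducible subrepresentation of the range of a projection. -/
theorem exists_irreducible_isometry (π : G →* unitaryGroup n ℂ) {p : Matrix n n ℂ} (hp : p * p = p)
    (hp0 : p ≠ 0) (hcomm : ∀ g, p * (π g : Matrix n n ℂ) = (π g : Matrix n n ℂ) * p) :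
    ∃ (m : ℕ) (T : Matrix n (Fin m) ℂ) (ρ : G →* unitaryGroup (Fin m) ℂ), 0 < m ∧ Tᴴ * T = 1 ∧
      p * T = T ∧ (∀ g, (π g : Matrix n n ℂ) * T = T * (ρ g : Matrix (Fin m) (Fin m) ℂ)) ∧
      ∀ A : Matrix (Fin m) (Fin m) ℂ,
        (∀ g, A * (ρ g : Matrix (Fin m) (Fin m) ℂ) = (ρ g : Matrix (Fin m) (Fin m) ℂ) * A) →
        ∃ c : ℂ, A = c • 1 := by
  classical
  have hex : ∃ m : ℕ, 0 < m ∧ ∃ (T : Matrix n (Fin m) ℂ) (ρ : G →* unitaryGroup (Fin m) ℂ),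
      Tᴴ * T = 1 ∧ p * T = T ∧
      ∀ g, (π g : Matrix n n ℂ) * T = T * (ρ g : Matrix (Fin m) (Fin m) ℂ) := by
    obtain ⟨m, R, ρ, h1, h2, h3, h4⟩ := exists_isometry_ker π (B := 1 - p) fun g => by
      rw [Matrix.sub_mul, Matrix.mul_sub, hcomm, Matrix.one_mul, Matrix.mul_one]
    refine ⟨m, Nat.pos_of_ne_zero ?_, R, ρ, h1, ?_, h4⟩
    · rintro rfl
      refine hp0 (ext_of_mulVec_single fun i => ?_)
      have h5 := h3 (p *ᵥ Pi.single i 1) (by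
        rw [mulVec_mulVec, Matrix.sub_mul, Matrix.one_mul, hp, sub_self, zero_mulVec])
      rw [← h5, show R * Rᴴ = 0 by ext; simp [mul_apply], zero_mulVec, zero_mulVec]
    · rw [Matrix.sub_mul, Matrix.one_mul, sub_eq_zero] at h2
      exact h2.symm
  -- A nonzero subrepresentation of least dimension. For an intertwiner `A` with eigenvalue `c`, the
  -- kernel of `A - c` is a nonzero subrepresentation, so it is everything: this is Schur's lemma.
  obtain ⟨hm, T, ρ, h1, h2, h3⟩ := Nat.find_spec hex
  have hmin := fun k => Nat.find_min hex (m := k)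
  generalize Nat.find hex = m at *
  refine ⟨m, T, ρ, hm, h1, h2, h3, fun A hA => ?_⟩
  have : Nonempty (Fin m) := ⟨⟨0, hm⟩⟩
  obtain ⟨c, hc⟩ := Module.End.exists_eigenvalue (Matrix.toLin' A)
  obtain ⟨x, hx⟩ := hc.exists_hasEigenvector
  have hx1 : A *ᵥ x = c • x := by simpa using hx.apply_eq_smul
  obtain ⟨k, R, σ, k1, k2, k3, k4⟩ := exists_isometry_ker ρ (B := A - c • 1) fun g => by
    rw [Matrix.sub_mul, Matrix.mul_sub, hA]; simp
  have hk : 0 < k := by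
    refine Nat.pos_of_ne_zero ?_
    rintro rfl
    have h5 := k3 x (by rw [sub_mulVec, hx1, smul_mulVec, one_mulVec, sub_self])
    rw [show R * Rᴴ = 0 by ext; simp [mul_apply], zero_mulVec] at h5
    exact hx.2 h5.symm
  have hle : m ≤ k := by
    by_contra! hlt
    refine hmin k hlt ⟨hk, T * R, σ, ?_, ?_, fun g => ?_⟩
    · rw [conjTranspose_mul, Matrix.mul_assoc, ← Matrix.mul_assoc Tᴴ, h1, Matrix.one_mul, k1]
    · rw [← Matrix.mul_assoc, h2]
    · rw [← Matrix.mul_assoc, h3, Matrix.mul_assoc, k4, Matrix.mul_assoc]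
  have hRR := mul_conjTranspose_eq_one_of_card_le k1 (by simpa using hle)
  refine ⟨c, sub_eq_zero.1 ?_⟩
  calc A - c • 1 = (A - c • 1) * (R * Rᴴ) := by rw [hRR, Matrix.mul_one]
    _ = 0 := by rw [← Matrix.mul_assoc, k2, Matrix.zero_mul]

theorem conjTranspose_intertwine {m : Type} [Fintype m] [DecidableEq m] {U : Matrix n n ℂ}
    {V : Matrix m m ℂ} (hU : U ∈ unitaryGroup n ℂ) (hV : V ∈ unitaryGroup m ℂ) {T : Matrix n m ℂ}
    (h : U * T = T * V) : Tᴴ * U = V * Tᴴ := by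
  have hU' := mem_unitaryGroup_iff'.1 hU
  have hV' := mem_unitaryGroup_iff.1 hV
  rw [star_eq_conjTranspose] at hU' hV'
  have h1 := congrArg conjTranspose h
  rw [conjTranspose_mul, conjTranspose_mul] at h1
  calc Tᴴ * U = V * (Vᴴ * Tᴴ) * U := by rw [← Matrix.mul_assoc V, hV', Matrix.one_mul]
    _ = V * Tᴴ * (Uᴴ * U) := by rw [← h1]; simp only [Matrix.mul_assoc]
    _ = V * Tᴴ := by rw [hU', Matrix.mul_one]

/-- An isotypic part of the range of a projection `p` commuting with a representation `π` and with
unitaries `u h` of its commutant: a subspace on which `π` is `1 ⊗ ρ` and `u` is `c ⊗ 1`. -/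
theorem exists_isotypic {H : Type w} (π : G →* unitaryGroup n ℂ) (u : H → unitaryGroup n ℂ)
    (hu : ∀ g h, (π g : Matrix n n ℂ) * (u h : Matrix n n ℂ) = (u h : Matrix n n ℂ) * π g)
    {p : Matrix n n ℂ} (hp : p * p = p) (hp0 : p ≠ 0)
    (hcomm : ∀ g, p * (π g : Matrix n n ℂ) = (π g : Matrix n n ℂ) * p)
    (hcomm' : ∀ h, p * (u h : Matrix n n ℂ) = (u h : Matrix n n ℂ) * p) :
    ∃ (k m : ℕ) (S : Matrix (Fin k × Fin m) n ℂ) (c : H → unitaryGroup (Fin k) ℂ)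
      (ρ : G →* unitaryGroup (Fin m) ℂ), 0 < k ∧ 0 < m ∧ S * Sᴴ = 1 ∧ p * Sᴴ = Sᴴ ∧
      (∀ h, S * (u h : Matrix n n ℂ) =
        ((c h : Matrix (Fin k) (Fin k) ℂ) ⊗ₖ (1 : Matrix (Fin m) (Fin m) ℂ)) * S) ∧
      ∀ g, S * (π g : Matrix n n ℂ) =
        ((1 : Matrix (Fin k) (Fin k) ℂ) ⊗ₖ (ρ g : Matrix (Fin m) (Fin m) ℂ)) * S := by
  obtain ⟨m, T₀, ρ, hm, hT1, hT2, hT3, hschur⟩ := exists_irreducible_isometry π hp hp0 hcomm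
  let l₀ : Fin m := ⟨0, hm⟩
  -- The space of intertwiners from `ρ` into the range of `p`. By Schur's lemma `S* T` is scalar for
  -- `S`, `T` in it, so `𝒦` is a Hilbert space, realized faithfully by one column through `ev`. An
  -- orthonormal basis consists of isometries with orthogonal ranges, whose adjoints stack up to
  -- `S`.
  let 𝒦 : Submodule ℂ (Matrix n (Fin m) ℂ) :=
    { carrier := {T | p * T = T ∧ ∀ g, (π g : Matrix n n ℂ) * T = T * (ρ g : Matrix (Fin m) (Fin m) ℂ)}
      add_mem' := fun {S T} hS hT => ⟨by rw [Matrix.mul_add, hS.1, hT.1], fun g => by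
        rw [Matrix.mul_add, Matrix.add_mul, hS.2, hT.2]⟩
      zero_mem' := ⟨by simp, fun g => by simp⟩
      smul_mem' := fun c T hT => ⟨by rw [Matrix.mul_smul, hT.1], fun g => by
        rw [Matrix.mul_smul, Matrix.smul_mul, hT.2]⟩ }
  have hscal : ∀ S ∈ 𝒦, ∀ T ∈ 𝒦, Sᴴ * T = (Sᴴ * T) l₀ l₀ • (1 : Matrix (Fin m) (Fin m) ℂ) := by
    intro S hS T hT
    obtain ⟨c, hc⟩ := hschur (Sᴴ * T) fun g => by
      rw [Matrix.mul_assoc, ← hT.2, ← Matrix.mul_assoc,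
        conjTranspose_intertwine (π g).2 (ρ g).2 (hS.2 g), Matrix.mul_assoc]
    rw [hc]; simp
  let ev : Matrix n (Fin m) ℂ →ₗ[ℂ] EuclideanSpace ℂ n :=
    { toFun := fun T => WithLp.toLp 2 fun x => T x l₀
      map_add' := fun S T => rfl
      map_smul' := fun c T => rfl }
  have hev : ∀ S T, inner ℂ (ev S) (ev T) = (Sᴴ * T) l₀ l₀ := fun S T => by
    rw [PiLp.inner_apply, mul_apply]
    refine Finset.sum_congr rfl fun x _ => ?_
    rw [RCLike.inner_apply, mul_comm]; rfl
  have hinj : ∀ T ∈ 𝒦, ev T = 0 → T = 0 := by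
    intro T hT h0
    have h1 := hscal T hT T hT
    rw [← hev, h0, inner_zero_left, zero_smul] at h1
    exact Matrix.conjTranspose_mul_self_eq_zero.1 h1
  let b := stdOrthonormalBasis ℂ (𝒦.map ev)
  choose T hT hTb using fun i => Submodule.mem_map.1 (b i).2
  have horth : ∀ i j, (T i)ᴴ * T j = (if i = j then (1 : ℂ) else 0) • (1 : Matrix (Fin m) (Fin m) ℂ) := by
    intro i j
    rw [hscal _ (hT i) _ (hT j), ← hev, hTb, hTb, ← orthonormal_iff_ite.1 b.orthonormal i j,
      Submodule.coe_inner]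
  have hexp : ∀ X ∈ 𝒦, X = ∑ i, (T i) * ((T i)ᴴ * X) := by
    intro X hX
    have h1 : ∀ i, (T i) * ((T i)ᴴ * X) = ((T i)ᴴ * X) l₀ l₀ • T i := fun i => by
      rw [hscal _ (hT i) _ hX]; simp
    simp_rw [h1]
    refine sub_eq_zero.1 (hinj _ (sub_mem hX (sum_mem fun i _ => 𝒦.smul_mem _ (hT i))) ?_)
    have h2 := congrArg (fun y : 𝒦.map ev => (y : EuclideanSpace ℂ n))
      (b.sum_repr' ⟨ev X, Submodule.mem_map_of_mem hX⟩)
    simp only [Submodule.coe_sum, Submodule.coe_smul] at h2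
    rw [_root_.map_sub, _root_.map_sum, sub_eq_zero]
    refine h2.symm.trans (Finset.sum_congr rfl fun i _ => ?_)
    rw [map_smul, hTb, ← hev, hTb, Submodule.coe_inner]
  -- The unitaries `u h` commute with `π` and `p`, so they act on the multiplicity space `𝒦`; the
  -- matrix `c₀ h` of this action gives `u` the form `c ⊗ 1`.
  have hu𝒦 : ∀ h, ∀ X ∈ 𝒦, (u h : Matrix n n ℂ)ᴴ * X ∈ 𝒦 := by
    intro h X hX
    have e1 : ∀ A : Matrix n n ℂ, (A * (u h : Matrix n n ℂ) = (u h : Matrix n n ℂ) * A) →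
        (u h : Matrix n n ℂ)ᴴ * A = A * (u h : Matrix n n ℂ)ᴴ := fun A hA => by
      have h1 := mem_unitaryGroup_iff'.1 (u h).2
      have h2 := mem_unitaryGroup_iff.1 (u h).2
      rw [star_eq_conjTranspose] at h1 h2
      calc _ = (u h : Matrix n n ℂ)ᴴ * (A * (u h : Matrix n n ℂ)) * (u h : Matrix n n ℂ)ᴴ := by
            rw [Matrix.mul_assoc, Matrix.mul_assoc A, h2, Matrix.mul_one]
        _ = ((u h : Matrix n n ℂ)ᴴ * (u h : Matrix n n ℂ)) * A * (u h : Matrix n n ℂ)ᴴ := by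
            rw [hA]; simp only [Matrix.mul_assoc]
        _ = _ := by rw [h1, Matrix.one_mul]
    refine ⟨?_, fun g => ?_⟩
    · rw [← Matrix.mul_assoc, ← e1 p (hcomm' h), Matrix.mul_assoc, hX.1]
    · rw [← Matrix.mul_assoc, ← e1 _ (hu g h), Matrix.mul_assoc, hX.2, Matrix.mul_assoc]
  let k := Module.finrank ℂ (𝒦.map ev)
  let S : Matrix (Fin k × Fin m) n ℂ := of fun a x => star (T a.1 x a.2)
  have hS1 : S * Sᴴ = 1 := by
    ext ⟨i, l⟩ ⟨j, l'⟩
    have h1 := congrFun (congrFun (horth i j) l) l'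
    have h2 : (S * Sᴴ) (i, l) (j, l') = ((T i)ᴴ * T j) l l' := by
      simp [mul_apply, S]
    rw [h2, h1]
    by_cases hij : i = j <;> by_cases hl : l = l' <;> simp [hij, hl, one_apply]
  have hrow : ∀ (M : Matrix n n ℂ) (i : Fin k) (l : Fin m) (x : n),
      (S * M) (i, l) x = ((T i)ᴴ * M) l x := fun M i l x => rfl
  let c₀ : H → Matrix (Fin k) (Fin k) ℂ := fun h => of fun i j => ((T i)ᴴ * ((u h : Matrix n n ℂ) * T j)) l₀ l₀
  have hSu : ∀ h, S * (u h : Matrix n n ℂ) = (c₀ h ⊗ₖ (1 : Matrix (Fin m) (Fin m) ℂ)) * S := by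
    intro h
    ext ⟨i, l⟩ x
    have h1 := congrArg conjTranspose (hexp _ (hu𝒦 h _ (hT i)))
    rw [conjTranspose_sum, conjTranspose_mul, conjTranspose_conjTranspose] at h1
    rw [hrow, h1, Matrix.sum_apply, mul_apply, Fintype.sum_prod_type]
    refine Finset.sum_congr rfl fun j _ => ?_
    have h2 := hscal _ (hu𝒦 h _ (hT i)) _ (hT j)
    rw [conjTranspose_mul, conjTranspose_conjTranspose, Matrix.mul_assoc] at h2
    have h3 : (T j * ((T j)ᴴ * ((u h : Matrix n n ℂ)ᴴ * T i)))ᴴ = c₀ h i j • (T j)ᴴ := by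
      rw [conjTranspose_mul, conjTranspose_mul, conjTranspose_mul, conjTranspose_conjTranspose,
        conjTranspose_conjTranspose, Matrix.mul_assoc (T i)ᴴ, h2, Matrix.smul_mul, Matrix.one_mul]
      rfl
    rw [h3, Finset.sum_eq_single l]
    · simp [S]
    · intro l' _ hl'; simp [one_apply_ne (Ne.symm hl')]
    · simp
  have hc₀ : ∀ h, c₀ h ∈ unitaryGroup (Fin k) ℂ := by
    intro h
    have h2 := mem_unitaryGroup_iff.1 (u h).2
    rw [star_eq_conjTranspose] at h2
    rw [mem_unitaryGroup_iff, star_eq_conjTranspose]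
    have h3 : (c₀ h * (c₀ h)ᴴ) ⊗ₖ (1 : Matrix (Fin m) (Fin m) ℂ) = 1 := by
      calc _ = (c₀ h ⊗ₖ (1 : Matrix (Fin m) (Fin m) ℂ)) * S *
            ((c₀ h ⊗ₖ (1 : Matrix (Fin m) (Fin m) ℂ)) * S)ᴴ := by
            rw [conjTranspose_mul, Matrix.mul_assoc, ← Matrix.mul_assoc S, hS1, Matrix.one_mul,
              conjTranspose_kronecker, conjTranspose_one, ← mul_kronecker_mul, Matrix.one_mul]
        _ = 1 := by
            rw [← hSu, conjTranspose_mul, Matrix.mul_assoc, ← Matrix.mul_assoc _ _ Sᴴ, h2,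
              Matrix.one_mul, hS1]
    ext i j
    have h4 := congrFun (congrFun h3 (i, l₀)) (j, l₀)
    simpa [one_apply] using h4
  refine ⟨k, m, S, fun h => ⟨c₀ h, hc₀ h⟩, ρ, ?_, hm, hS1, ?_, hSu, fun g => ?_⟩
  · by_contra! hk
    have h1 := hexp T₀ ⟨hT2, hT3⟩
    have : IsEmpty (Fin k) := by rw [Nat.le_zero.1 hk]; infer_instance
    rw [Finset.univ_eq_empty (α := Fin k), Finset.sum_empty] at h1
    rw [h1] at hT1
    have := congrFun (congrFun hT1 l₀) l₀
    simp at this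
  · ext x ⟨i, l⟩
    have h1 := congrFun (congrFun (hT i).1 x) l
    simpa [mul_apply, S] using h1
  · ext ⟨i, l⟩ x
    rw [hrow, conjTranspose_intertwine (π g).2 (ρ g).2 ((hT i).2 g), mul_apply, mul_apply,
      Fintype.sum_prod_type, Finset.sum_eq_single i]
    · simp [S]
    · intro j _ hj; simp [one_apply_ne (Ne.symm hj)]
    · simp

end Intertwiners

/-! ### Finitary and linear forms of Hilbert–Schmidt stability. -/

section UniformStability

open Matrix
open scoped Kronecker

variable {G : Type v} [Group G] {H : Type w} [Group H]

/-- A finitary form of flexible Hilbert-Schmidt stability. -/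
theorem FlexiblyHSStable.exists_finite [Countable H] (hH : FlexiblyHSStable H) (F : Finset H) {η : ℝ}
    (hη : 0 < η) : ∃ (E : Finset (H × H)) (δ : ℝ), 0 < δ ∧ ∀ (d : ℕ), 0 < d →
      ∀ φ : H → unitaryGroup (Fin d) ℂ,
      (∀ e ∈ E, hsNormSq ((φ (e.1 * e.2) : Matrix (Fin d) (Fin d) ℂ) -
        (φ e.1 : Matrix (Fin d) (Fin d) ℂ) * (φ e.2 : Matrix (Fin d) (Fin d) ℂ)) < δ) →
      ∃ (D : ℕ) (σ : H →* unitaryGroup (Fin D) ℂ) (W : Matrix (Fin D) (Fin d) ℂ), Wᴴ * W = 1 ∧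
        (D : ℝ) - d ≤ η * d ∧ ∀ h ∈ F, hsNormSq ((φ h : Matrix (Fin d) (Fin d) ℂ) -
          Wᴴ * (σ h : Matrix (Fin D) (Fin D) ℂ) * W) ≤ η := by
  classical
  by_contra! hcon
  obtain ⟨e, he⟩ := exists_surjective_nat (H × H)
  -- Countability of `H × H` gives increasing finite sets of test pairs; counterexamples for these
  -- sets with tolerance `1 / (n + 1)` form an asymptotically multiplicative sequence.
  choose d hd φ hφ hbad using fun n : ℕ =>
    hcon ((Finset.range n).image e) (1 / ((n : ℝ) + 1)) (by positivity)
  obtain ⟨D, π, W, hW, hD, hπ⟩ := hH d hd φ fun g h => by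
    obtain ⟨k, hk⟩ := he (g, h)
    refine squeeze_zero' (Eventually.of_forall fun n => ?_) ?_ tendsto_one_div_add_atTop_nhds_zero_nat
    · rw [hsNormSq_eq]
      exact div_nonneg (hsSq_nonneg _) (Nat.cast_nonneg _)
    · filter_upwards [eventually_gt_atTop k] with n hn
      have := hφ n (g, h) (Finset.mem_image.2 ⟨k, Finset.mem_range.2 hn, hk⟩)
      exact this.le
  have h1 : ∀ᶠ n in atTop, (D n : ℝ) / d n < 1 + η := hD.eventually_lt_const (by linarith)
  have h2 : ∀ᶠ n in atTop, ∀ h ∈ F, hsNormSq ((φ n h : Matrix (Fin (d n)) (Fin (d n)) ℂ) -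
      (W n)ᴴ * (π n h : Matrix (Fin (D n)) (Fin (D n)) ℂ) * W n) < η :=
    (Filter.eventually_all_finset F).2 fun h _ => (hπ h).eventually_lt_const hη
  obtain ⟨n, hn1, hn2⟩ := (h1.and h2).exists
  have hd0 : (0 : ℝ) < d n := by exact_mod_cast hd n
  rw [div_lt_iff₀ hd0] at hn1
  obtain ⟨h, hF, hlt⟩ := hbad n (D n) (π n) (W n) (hW n) (by linarith)
  exact absurd (hn2 h hF) (not_lt.2 hlt.le)

/-- Either all defects are below `δ` and the finitary form applies, or some defect is at least `δ
d`. In the second case the trivial representation in the same dimension has error at most `4 d` for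
each element of `F`, which `4 |F| / δ` times the defect dominates. Both sides are unnormalized, so
that such bounds can be added. -/
theorem FlexiblyHSStable.exists_linear_bound [Countable H] (hH : FlexiblyHSStable H) (F : Finset H)
    {η : ℝ} (hη : 0 < η) : ∃ (E : Finset (H × H)) (C : ℝ), 0 ≤ C ∧ ∀ (d : ℕ), 0 < d →
      ∀ φ : H → unitaryGroup (Fin d) ℂ,
      ∃ (D : ℕ) (σ : H →* unitaryGroup (Fin D) ℂ) (W : Matrix (Fin D) (Fin d) ℂ), Wᴴ * W = 1 ∧
        (D : ℝ) - d + ∑ h ∈ F, hsSq ((φ h : Matrix (Fin d) (Fin d) ℂ) -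
          Wᴴ * (σ h : Matrix (Fin D) (Fin D) ℂ) * W) ≤
        η * d + C * ∑ e ∈ E, hsSq ((φ (e.1 * e.2) : Matrix (Fin d) (Fin d) ℂ) -
          (φ e.1 : Matrix (Fin d) (Fin d) ℂ) * (φ e.2 : Matrix (Fin d) (Fin d) ℂ)) := by
  have hF : (0 : ℝ) < 1 + F.card := by positivity
  obtain ⟨E, δ, hδ, hE⟩ := hH.exists_finite F (div_pos hη hF)
  refine ⟨E, 4 * F.card / δ, by positivity, fun d hd φ => ?_⟩
  have hd0 : (0 : ℝ) < d := by exact_mod_cast hd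
  have hsum : 0 ≤ ∑ e ∈ E, hsSq ((φ (e.1 * e.2) : Matrix (Fin d) (Fin d) ℂ) -
          (φ e.1 : Matrix (Fin d) (Fin d) ℂ) * (φ e.2 : Matrix (Fin d) (Fin d) ℂ)) :=
    Finset.sum_nonneg fun e _ => hsSq_nonneg _
  by_cases hgood : ∀ e ∈ E, hsNormSq ((φ (e.1 * e.2) : Matrix (Fin d) (Fin d) ℂ) -
        (φ e.1 : Matrix (Fin d) (Fin d) ℂ) * (φ e.2 : Matrix (Fin d) (Fin d) ℂ)) < δ
  · obtain ⟨D, σ, W, hW, hD, hσ⟩ := hE d hd φ hgood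
    refine ⟨D, σ, W, hW, ?_⟩
    have h1 : ∑ h ∈ F, hsSq ((φ h : Matrix (Fin d) (Fin d) ℂ) -
        Wᴴ * (σ h : Matrix (Fin D) (Fin D) ℂ) * W) ≤ ∑ h ∈ F, η / (1 + F.card) * d :=
      Finset.sum_le_sum fun h hh => (div_le_iff₀ hd0).1 (hσ h hh)
    rw [Finset.sum_const, nsmul_eq_mul] at h1
    have h2 : η / (1 + F.card) * d + F.card * (η / (1 + F.card) * d) = η * d := by
      field_simp
    have h3 : 0 ≤ 4 * F.card / δ * ∑ e ∈ E, hsSq ((φ (e.1 * e.2) : Matrix (Fin d) (Fin d) ℂ) -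
          (φ e.1 : Matrix (Fin d) (Fin d) ℂ) * (φ e.2 : Matrix (Fin d) (Fin d) ℂ)) := by positivity
    linarith
  · push Not at hgood
    obtain ⟨e, he, hle⟩ := hgood
    refine ⟨d, 1, 1, by simp, ?_⟩
    have h1 : ∑ h ∈ F, hsSq ((φ h : Matrix (Fin d) (Fin d) ℂ) -
        (1 : Matrix (Fin d) (Fin d) ℂ)ᴴ * ((1 : H →* unitaryGroup (Fin d) ℂ) h :
          Matrix (Fin d) (Fin d) ℂ) * 1) ≤ ∑ h ∈ F, 4 * (d : ℝ) :=
      Finset.sum_le_sum fun h _ => by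
        have := hsSq_unitary_sub_le (φ h).2 (one_mem (unitaryGroup (Fin d) ℂ))
        rw [Fintype.card_fin] at this
        simpa using this
    rw [Finset.sum_const, nsmul_eq_mul] at h1
    rw [hsNormSq_eq, le_div_iff₀ hd0] at hle
    have h2 := hle.trans (Finset.single_le_sum (f := fun e : H × H =>
      hsSq ((φ (e.1 * e.2) : Matrix (Fin d) (Fin d) ℂ) - (φ e.1 : Matrix (Fin d) (Fin d) ℂ) *
        (φ e.2 : Matrix (Fin d) (Fin d) ℂ))) (fun e _ => hsSq_nonneg _) he)
    have h3 := mul_le_mul_of_nonneg_left h2 (by positivity : 0 ≤ 4 * F.card / δ)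
    have h4 : 4 * F.card / δ * (δ * d) = F.card * (4 * d) := by field_simp
    have h5 : 0 ≤ η * d := by positivity
    linarith

end UniformStability

/-! ### Tensor products and direct sums of unitary representations. -/

section BlockSums

open Matrix
open scoped Kronecker

variable {G : Type v} [Group G] {a b : Type} [Fintype a] [DecidableEq a] [Fintype b] [DecidableEq b]

theorem kronecker_mem_unitaryGroup {A : Matrix a a ℂ} {B : Matrix b b ℂ}
    (hA : A ∈ unitaryGroup a ℂ) (hB : B ∈ unitaryGroup b ℂ) : A ⊗ₖ B ∈ unitaryGroup (a × b) ℂ :=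
  kronecker_mem_unitary hA hB

/-- The tensor product of two commuting unitary representations on the two tensor factors. -/
def kroneckerRep (ρ : G →* unitaryGroup a ℂ) (σ : G →* unitaryGroup b ℂ) :
    G →* unitaryGroup (a × b) ℂ :=
  MonoidHom.mk' (fun g => ⟨(ρ g : Matrix a a ℂ) ⊗ₖ (σ g : Matrix b b ℂ),
    kronecker_mem_unitaryGroup (ρ g).2 (σ g).2⟩) fun g h => Subtype.ext (by
      simp only [map_mul, Submonoid.coe_mul, mul_kronecker_mul])

theorem coe_kroneckerRep (ρ : G →* unitaryGroup a ℂ) (σ : G →* unitaryGroup b ℂ) (g : G) :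
    (kroneckerRep ρ σ g : Matrix (a × b) (a × b) ℂ) =
      (ρ g : Matrix a a ℂ) ⊗ₖ (σ g : Matrix b b ℂ) := rfl

theorem fromBlocks_mem_unitaryGroup {A : Matrix a a ℂ} {B : Matrix b b ℂ}
    (hA : A ∈ unitaryGroup a ℂ) (hB : B ∈ unitaryGroup b ℂ) :
    fromBlocks A 0 0 B ∈ unitaryGroup (a ⊕ b) ℂ := by
  rw [mem_unitaryGroup_iff', star_eq_conjTranspose] at *
  rw [fromBlocks_conjTranspose, fromBlocks_multiply]
  simp [hA, hB, fromBlocks_one]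

/-- The direct sum of two unitary representations. -/
def blockRep (ρ : G →* unitaryGroup a ℂ) (σ : G →* unitaryGroup b ℂ) :
    G →* unitaryGroup (a ⊕ b) ℂ :=
  MonoidHom.mk' (fun g => ⟨fromBlocks (ρ g) 0 0 (σ g),
    fromBlocks_mem_unitaryGroup (ρ g).2 (σ g).2⟩) fun g h => Subtype.ext (by
      simp [fromBlocks_multiply])

theorem coe_blockRep (ρ : G →* unitaryGroup a ℂ) (σ : G →* unitaryGroup b ℂ) (g : G) :
    (blockRep ρ σ g : Matrix (a ⊕ b) (a ⊕ b) ℂ) = fromBlocks (ρ g) 0 0 (σ g) := rfl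

variable {m n : Type*} [Fintype m] [Fintype n]

theorem hsSq_add_of_orthogonal {X Z : Matrix m n ℂ} (h : Xᴴ * Z = 0) :
    hsSq (X + Z) = hsSq X + hsSq Z := by
  have h' : Zᴴ * X = 0 := by
    have := congrArg conjTranspose h
    rwa [conjTranspose_mul, conjTranspose_conjTranspose, conjTranspose_zero] at this
  rw [hsSq, conjTranspose_add, Matrix.add_mul, Matrix.mul_add, Matrix.mul_add, h, h', add_zero,
    zero_add, trace_add, Complex.add_re, hsSq, hsSq]

theorem hsSq_add_of_orthogonal' {X Z : Matrix m n ℂ} (h : X * Zᴴ = 0) :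
    hsSq (X + Z) = hsSq X + hsSq Z := by
  rw [← hsSq_conjTranspose, conjTranspose_add, hsSq_add_of_orthogonal
    (by rw [conjTranspose_conjTranspose, h]), hsSq_conjTranspose, hsSq_conjTranspose]

/-- `V` is a partial isometry with initial projection `p`: the Gram matrix of `V p - V` vanishes. -/
theorem mul_eq_self_of_conjTranspose_mul_self [DecidableEq n] {V : Matrix m n ℂ} {p : Matrix n n ℂ}
    (hV : Vᴴ * V = p) (hp : p * p = p) : V * p = V := by
  have hps : pᴴ = p := by rw [← hV, conjTranspose_mul, conjTranspose_conjTranspose]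
  have h : (V * p - V)ᴴ * (V * p - V) = 0 := by
    simp only [conjTranspose_sub, conjTranspose_mul, Matrix.sub_mul, Matrix.mul_sub,
      Matrix.mul_assoc, hps]
    rw [← Matrix.mul_assoc Vᴴ V p, hV, hp, hp, sub_self]
  exact sub_eq_zero.1 (Matrix.conjTranspose_mul_self_eq_zero.1 h)

end BlockSums

/-! ### Stability inside the commutant of a representation. -/

section CommutingRep

open Matrix
open scoped Kronecker

variable {H : Type w} [Group H]

/-- Isotypic pieces are split off `p` one at a time, by induction on a bound `N` of its rank. On a
piece, `π` is `1 ⊗ ρ` and `u` is `c ⊗ 1`; the linear bound applied to `c` gives `σ₀ ⊗ 1`, which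
commutes with `1 ⊗ ρ`. All terms of the estimate add up over orthogonal pieces and are multiplied by
`m` on a piece of multiplicity space `ℂ^k` and irreducible dimension `m`. -/
theorem FlexiblyHSStable.exists_commuting_of_projection {F : Finset H} {η C : ℝ} {E : Finset (H × H)}
    (hE : ∀ (d : ℕ), 0 < d → ∀ φ : H → unitaryGroup (Fin d) ℂ,
      ∃ (D : ℕ) (σ : H →* unitaryGroup (Fin D) ℂ) (W : Matrix (Fin D) (Fin d) ℂ), Wᴴ * W = 1 ∧
        (D : ℝ) - d + ∑ h ∈ F, hsSq ((φ h : Matrix (Fin d) (Fin d) ℂ) -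
          Wᴴ * (σ h : Matrix (Fin D) (Fin D) ℂ) * W) ≤
        η * d + C * ∑ e ∈ E, hsSq ((φ (e.1 * e.2) : Matrix (Fin d) (Fin d) ℂ) -
          (φ e.1 : Matrix (Fin d) (Fin d) ℂ) * (φ e.2 : Matrix (Fin d) (Fin d) ℂ)))
    {G : Type v} [Group G] {n : Type} [Fintype n] [DecidableEq n]
    (π : G →* unitaryGroup n ℂ) (u : H → unitaryGroup n ℂ)
    (hu : ∀ g h, (π g : Matrix n n ℂ) * (u h : Matrix n n ℂ) = (u h : Matrix n n ℂ) * π g) (N : ℕ) :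
    ∀ p : Matrix n n ℂ, pᴴ = p → p * p = p →
      (∀ g, p * (π g : Matrix n n ℂ) = (π g : Matrix n n ℂ) * p) →
      (∀ h, p * (u h : Matrix n n ℂ) = (u h : Matrix n n ℂ) * p) → hsSq p ≤ N →
      ∃ (ι : Type) (_ : Fintype ι) (_ : DecidableEq ι) (Q : G →* unitaryGroup ι ℂ)
        (σ : H →* unitaryGroup ι ℂ) (V : Matrix ι n ℂ),
        (∀ g h, (Q g : Matrix ι ι ℂ) * (σ h : Matrix ι ι ℂ) = (σ h : Matrix ι ι ℂ) * Q g) ∧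
        Vᴴ * V = p ∧ (∀ g, (Q g : Matrix ι ι ℂ) * V = V * (π g : Matrix n n ℂ)) ∧
        (Fintype.card ι : ℝ) - hsSq p + ∑ h ∈ F, hsSq ((u h : Matrix n n ℂ) * p -
          Vᴴ * (σ h : Matrix ι ι ℂ) * V) ≤
        η * hsSq p + C * ∑ e ∈ E, hsSq (((u (e.1 * e.2) : Matrix n n ℂ) -
          (u e.1 : Matrix n n ℂ) * (u e.2 : Matrix n n ℂ)) * p) := by
  induction N with
  | zero =>
    intro p _ _ _ _ hN
    obtain rfl := hsSq_eq_zero (le_antisymm (by simpa using hN) (hsSq_nonneg p))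
    exact ⟨Empty, inferInstance, inferInstance, 1, 1, 0, by simp, by simp, by simp, by simp [hsSq]⟩
  | succ N ih =>
    intro p hps hp hpπ hpu hN
    by_cases hp0 : p = 0
    · subst hp0
      exact ⟨Empty, inferInstance, inferInstance, 1, 1, 0, by simp, by simp, by simp, by simp [hsSq]⟩
    obtain ⟨k, m, S, c, ρ, hk, hm, hS, hpS, hSu, hSπ⟩ := exists_isotypic π u hu hp hp0 hpπ hpu
    have hS' : Sᴴᴴ * Sᴴ = 1 := by rw [conjTranspose_conjTranspose, hS]
    have hadj : ∀ {U : Matrix n n ℂ} {V : Matrix (Fin k × Fin m) (Fin k × Fin m) ℂ},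
        U ∈ unitaryGroup n ℂ → V ∈ unitaryGroup (Fin k × Fin m) ℂ → S * U = V * S →
        U * Sᴴ = Sᴴ * V := fun {U V} hU hV h => by
      have h1 := congrArg conjTranspose h
      rw [conjTranspose_mul, conjTranspose_mul] at h1
      have h2 := conjTranspose_intertwine (Unitary.star_mem hU) (Unitary.star_mem hV) h1
      have h3 := congrArg conjTranspose h2
      simpa [star_eq_conjTranspose, conjTranspose_mul] using h3
    have huS : ∀ h, (u h : Matrix n n ℂ) * Sᴴ = Sᴴ * ((c h : Matrix (Fin k) (Fin k) ℂ) ⊗ₖ (1 : Matrix (Fin m) (Fin m) ℂ)) :=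
      fun h => hadj (u h).2 (kronecker_mem_unitaryGroup (c h).2 (one_mem _)) (hSu h)
    have hπS : ∀ g, (π g : Matrix n n ℂ) * Sᴴ = Sᴴ * ((1 : Matrix (Fin k) (Fin k) ℂ) ⊗ₖ (ρ g : Matrix (Fin m) (Fin m) ℂ)) :=
      fun g => hadj (π g).2 (kronecker_mem_unitaryGroup (one_mem _) (ρ g).2) (hSπ g)
    set q := Sᴴ * S with hq
    have hqs : qᴴ = q := by rw [hq, conjTranspose_mul, conjTranspose_conjTranspose]
    have hpq : p * q = q := by rw [hq, ← Matrix.mul_assoc, hpS]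
    have hqp : q * p = q := by
      have := congrArg conjTranspose hpq
      rwa [conjTranspose_mul, hps, hqs] at this
    have hqq : q * q = q := by
      rw [hq, Matrix.mul_assoc, ← Matrix.mul_assoc S, hS, Matrix.one_mul]
    have hSq : S * q = S := by rw [hq, ← Matrix.mul_assoc, hS, Matrix.one_mul]
    have hqu : ∀ h, q * (u h : Matrix n n ℂ) = (u h : Matrix n n ℂ) * q := fun h => by
      rw [hq, Matrix.mul_assoc, hSu, ← Matrix.mul_assoc, ← Matrix.mul_assoc, huS]
    have hqπ : ∀ g, q * (π g : Matrix n n ℂ) = (π g : Matrix n n ℂ) * q := fun g => by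
      rw [hq, Matrix.mul_assoc, hSπ, ← Matrix.mul_assoc, ← Matrix.mul_assoc, hπS]
    have hcard : hsSq q = k * m := by
      rw [hsSq, hqs, hqq, hq, trace_mul_comm, hS, trace_one]; simp
    have horth : ∀ X : Matrix n n ℂ, hsSq (X * p) = hsSq (X * q) + hsSq (X * (p - q)) := fun X => by
      rw [← hsSq_add_of_orthogonal', ← Matrix.mul_add, add_sub_cancel]
      rw [conjTranspose_mul, conjTranspose_sub, hps, hqs, Matrix.mul_assoc, ← Matrix.mul_assoc q,
        Matrix.mul_sub, hqp, hqq, sub_self, Matrix.zero_mul, Matrix.mul_zero]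
    have hpp : hsSq p = k * m + hsSq (p - q) := by
      have := horth 1
      rwa [Matrix.one_mul, Matrix.one_mul, Matrix.one_mul, hcard] at this
    have hkm : (1 : ℝ) ≤ k * m := by exact_mod_cast Nat.mul_pos hk hm
    -- The piece `q` has rank `k m ≥ 1`, so the remaining rank is at most `N`.
    obtain ⟨ι, _, _, Q, σ, V, hQσ, hV, hQV, hle⟩ := ih (p - q)
      (by rw [conjTranspose_sub, hps, hqs])
      (by rw [Matrix.mul_sub, Matrix.sub_mul, Matrix.sub_mul, hp, hpq, hqp, hqq]; simp)
      (fun g => by rw [Matrix.sub_mul, Matrix.mul_sub, hpπ, hqπ])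
      (fun h => by rw [Matrix.sub_mul, Matrix.mul_sub, hpu, hqu])
      (by push_cast at hN; linarith)
    obtain ⟨D, σ₀, W, hW, hle₀⟩ := hE k hk c
    let V₀ : Matrix (Fin D × Fin m) n ℂ := (W ⊗ₖ (1 : Matrix (Fin m) (Fin m) ℂ)) * S
    have hV₀ : ∀ Y : Matrix (Fin D) (Fin D) ℂ, V₀ᴴ * (Y ⊗ₖ (1 : Matrix (Fin m) (Fin m) ℂ)) * V₀ =
        Sᴴ * ((Wᴴ * Y * W) ⊗ₖ (1 : Matrix (Fin m) (Fin m) ℂ)) * S := fun Y => by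
      have : (Wᴴ * Y * W) ⊗ₖ (1 : Matrix (Fin m) (Fin m) ℂ) =
          (W ⊗ₖ (1 : Matrix (Fin m) (Fin m) ℂ))ᴴ * (Y ⊗ₖ (1 : Matrix (Fin m) (Fin m) ℂ)) *
            (W ⊗ₖ (1 : Matrix (Fin m) (Fin m) ℂ)) := by
        rw [conjTranspose_kronecker, conjTranspose_one, ← mul_kronecker_mul, ← mul_kronecker_mul,
          Matrix.one_mul, Matrix.one_mul]
      rw [this]
      simp only [V₀, conjTranspose_mul, Matrix.mul_assoc]
    refine ⟨(Fin D × Fin m) ⊕ ι, inferInstance, inferInstance, blockRep (kroneckerRep 1 ρ) Q,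
      blockRep (kroneckerRep σ₀ 1) σ, fromRows V₀ V, fun g h => ?_, ?_, fun g => ?_, ?_⟩
    · rw [coe_blockRep, coe_blockRep, fromBlocks_multiply, fromBlocks_multiply, coe_kroneckerRep,
        coe_kroneckerRep, ← mul_kronecker_mul, ← mul_kronecker_mul, hQσ]
      simp
    · rw [conjTranspose_fromRows_eq_fromCols_conjTranspose, fromCols_mul_fromRows, hV]
      have h1 := hV₀ 1
      rw [one_kronecker_one, Matrix.mul_one, Matrix.mul_one, hW, one_kronecker_one,
        Matrix.mul_one, ← hq] at h1
      rw [h1, add_sub_cancel]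
    · rw [coe_blockRep, fromBlocks_mul_fromRows, fromRows_mul, coe_kroneckerRep, Matrix.zero_mul,
        Matrix.zero_mul, add_zero, zero_add, hQV]
      congr 1
      simp only [V₀, Matrix.mul_assoc]
      rw [hSπ, ← Matrix.mul_assoc, ← Matrix.mul_assoc, ← mul_kronecker_mul, ← mul_kronecker_mul]
      simp
    · have hVq : V * (p - q) = V := mul_eq_self_of_conjTranspose_mul_self hV
        (by rw [Matrix.mul_sub, Matrix.sub_mul, Matrix.sub_mul, hp, hpq, hqp, hqq]; simp)
      have hqV : q * Vᴴ = 0 := by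
        have h1 := congrArg conjTranspose hVq
        rw [conjTranspose_mul, conjTranspose_sub, hps, hqs] at h1
        rw [← h1, ← Matrix.mul_assoc, Matrix.mul_sub, hqp, hqq, sub_self, Matrix.zero_mul]
      have hnorm : ∀ Y : Matrix (Fin k) (Fin k) ℂ,
          hsSq (Sᴴ * (Y ⊗ₖ (1 : Matrix (Fin m) (Fin m) ℂ)) * S) = m * hsSq Y := fun Y => by
        have h1 := hsSq_mul_isometry hS' (Sᴴ * (Y ⊗ₖ (1 : Matrix (Fin m) (Fin m) ℂ)))
        rw [conjTranspose_conjTranspose] at h1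
        rw [h1, hsSq_isometry_mul hS', hsSq_kronecker_one, Fintype.card_fin]
      have hsub : ∀ A B : Matrix (Fin k) (Fin k) ℂ, (A - B) ⊗ₖ (1 : Matrix (Fin m) (Fin m) ℂ) =
          A ⊗ₖ (1 : Matrix (Fin m) (Fin m) ℂ) - B ⊗ₖ (1 : Matrix (Fin m) (Fin m) ℂ) := fun A B => by
        rw [sub_eq_add_neg, ← neg_one_smul ℂ B, add_kronecker, smul_kronecker, neg_one_smul,
          sub_eq_add_neg]
      have huq : ∀ h, (u h : Matrix n n ℂ) * q =
          Sᴴ * ((c h : Matrix (Fin k) (Fin k) ℂ) ⊗ₖ (1 : Matrix (Fin m) (Fin m) ℂ)) * S := fun h => by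
        rw [hq, ← Matrix.mul_assoc, huS]
      -- The error is block diagonal: the two contributions have orthogonal ranges, in `q` and in `p
      -- - q`, so their squared norms add without cross terms.
      have hF : ∀ h, hsSq ((u h : Matrix n n ℂ) * p - (fromRows V₀ V)ᴴ *
          (blockRep (kroneckerRep σ₀ (1 : H →* unitaryGroup (Fin m) ℂ)) σ h :
            Matrix ((Fin D × Fin m) ⊕ ι) ((Fin D × Fin m) ⊕ ι) ℂ) * fromRows V₀ V) =
          m * hsSq ((c h : Matrix (Fin k) (Fin k) ℂ) - Wᴴ * (σ₀ h : Matrix (Fin D) (Fin D) ℂ) * W) +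
          hsSq ((u h : Matrix n n ℂ) * (p - q) - Vᴴ * (σ h : Matrix ι ι ℂ) * V) := by
        intro h
        rw [← hnorm, ← hsSq_add_of_orthogonal]
        · congr 1
          rw [conjTranspose_fromRows_eq_fromCols_conjTranspose, Matrix.mul_assoc, coe_blockRep,
            fromBlocks_mul_fromRows, fromCols_mul_fromRows, coe_kroneckerRep, MonoidHom.one_apply,
            OneMemClass.coe_one, Matrix.zero_mul, Matrix.zero_mul, add_zero, zero_add,
            ← Matrix.mul_assoc, hV₀, hsub, Matrix.mul_sub, Matrix.sub_mul, ← huq,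
            Matrix.mul_sub, Matrix.mul_assoc Vᴴ]
          abel
        · have h1 : ∀ Y : Matrix (Fin k × Fin m) (Fin k × Fin m) ℂ, (Sᴴ * Y * S)ᴴ = (Sᴴ * Y * S)ᴴ * q := fun Y => by
            rw [conjTranspose_mul, conjTranspose_mul, conjTranspose_conjTranspose]
            simp only [Matrix.mul_assoc]
            rw [hSq]
          have h2 : q * ((u h : Matrix n n ℂ) * (p - q) - Vᴴ * (σ h : Matrix ι ι ℂ) * V) = 0 := by
            rw [Matrix.mul_sub, ← Matrix.mul_assoc q (u h : Matrix n n ℂ), hqu,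
              Matrix.mul_assoc (u h : Matrix n n ℂ) q, Matrix.mul_sub q p q, hqp, hqq, sub_self,
              Matrix.mul_zero, ← Matrix.mul_assoc q (_ * _), ← Matrix.mul_assoc q Vᴴ, hqV,
              Matrix.zero_mul, Matrix.zero_mul, sub_zero]
          rw [h1, Matrix.mul_assoc, h2, Matrix.mul_zero]
      have hEe : ∀ e : H × H, hsSq (((u (e.1 * e.2) : Matrix n n ℂ) -
          (u e.1 : Matrix n n ℂ) * (u e.2 : Matrix n n ℂ)) * p) =
          m * hsSq ((c (e.1 * e.2) : Matrix (Fin k) (Fin k) ℂ) -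
            (c e.1 : Matrix (Fin k) (Fin k) ℂ) * (c e.2 : Matrix (Fin k) (Fin k) ℂ)) +
          hsSq (((u (e.1 * e.2) : Matrix n n ℂ) -
          (u e.1 : Matrix n n ℂ) * (u e.2 : Matrix n n ℂ)) * (p - q)) := by
        intro e
        rw [horth, ← hnorm]
        congr 2
        have h1 : (u e.1 : Matrix n n ℂ) * (u e.2 : Matrix n n ℂ) * q =
            Sᴴ * (((c e.1 : Matrix (Fin k) (Fin k) ℂ) * (c e.2 : Matrix (Fin k) (Fin k) ℂ)) ⊗ₖ
              (1 : Matrix (Fin m) (Fin m) ℂ)) * S := by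
          rw [Matrix.mul_assoc, huq, ← Matrix.mul_assoc, ← Matrix.mul_assoc, huS,
            Matrix.mul_assoc Sᴴ (_ ⊗ₖ _) (_ ⊗ₖ _), ← mul_kronecker_mul, Matrix.one_mul]
        rw [Matrix.sub_mul, huq, h1, hsub, Matrix.mul_sub, Matrix.sub_mul]
      simp only [hF, hEe]
      rw [Finset.sum_add_distrib, Finset.sum_add_distrib, ← Finset.mul_sum, ← Finset.mul_sum]
      have h2 := mul_le_mul_of_nonneg_left hle₀ (Nat.cast_nonneg m : (0 : ℝ) ≤ m)
      simp only [Fintype.card_sum, Fintype.card_prod, Fintype.card_fin]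
      push_cast
      rw [hpp]
      linarith

/-- Flexible stability of `H`, applied inside the commutant of a representation of `G`. -/
theorem FlexiblyHSStable.exists_commuting [Countable H] (hH : FlexiblyHSStable H) (F : Finset H)
    {η : ℝ} (hη : 0 < η) : ∃ (E : Finset (H × H)) (C : ℝ), 0 ≤ C ∧
      ∀ {G : Type v} [Group G] {n : ℕ} (π : G →* unitaryGroup (Fin n) ℂ)
        (u : H → unitaryGroup (Fin n) ℂ), (∀ g h, (π g : Matrix (Fin n) (Fin n) ℂ) *
          (u h : Matrix (Fin n) (Fin n) ℂ) = (u h : Matrix (Fin n) (Fin n) ℂ) * π g) →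
      ∃ (D : ℕ) (Q : G →* unitaryGroup (Fin D) ℂ) (σ : H →* unitaryGroup (Fin D) ℂ)
        (V : Matrix (Fin D) (Fin n) ℂ),
        (∀ g h, (Q g : Matrix (Fin D) (Fin D) ℂ) * (σ h : Matrix (Fin D) (Fin D) ℂ) =
          (σ h : Matrix (Fin D) (Fin D) ℂ) * Q g) ∧ Vᴴ * V = 1 ∧
        (∀ g, (Q g : Matrix (Fin D) (Fin D) ℂ) * V = V * (π g : Matrix (Fin n) (Fin n) ℂ)) ∧
        (D : ℝ) - n + ∑ h ∈ F, hsSq ((u h : Matrix (Fin n) (Fin n) ℂ) -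
          Vᴴ * (σ h : Matrix (Fin D) (Fin D) ℂ) * V) ≤
        η * n + C * ∑ e ∈ E, hsSq ((u (e.1 * e.2) : Matrix (Fin n) (Fin n) ℂ) -
          (u e.1 : Matrix (Fin n) (Fin n) ℂ) * (u e.2 : Matrix (Fin n) (Fin n) ℂ)) := by
  obtain ⟨E, C, hC, hE⟩ := hH.exists_linear_bound F hη
  refine ⟨E, C, hC, fun {G} _ {n} π u hu => ?_⟩
  have h1 : hsSq (1 : Matrix (Fin n) (Fin n) ℂ) = n := by
    rw [hsSq_unitary (one_mem _), Fintype.card_fin]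
  obtain ⟨ι, _, _, Q, σ, V, hQσ, hV, hQV, hle⟩ := FlexiblyHSStable.exists_commuting_of_projection hE π u hu n 1
    (by simp) (by simp) (fun g => by simp) (fun h => by simp) h1.le
  let e := Fintype.equivFin ι
  have hmul : ∀ A B : Matrix ι ι ℂ, A.submatrix e.symm e.symm * B.submatrix e.symm e.symm =
      (A * B).submatrix e.symm e.symm := fun A B => submatrix_mul_equiv A B e.symm e.symm e.symm
  let r : unitaryGroup ι ℂ →* unitaryGroup (Fin (Fintype.card ι)) ℂ :=
    MonoidHom.mk' (fun U => ⟨(U : Matrix ι ι ℂ).submatrix e.symm e.symm, by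
      rw [mem_unitaryGroup_iff', star_eq_conjTranspose, conjTranspose_submatrix, hmul,
        ← star_eq_conjTranspose, mem_unitaryGroup_iff'.1 U.2, submatrix_one_equiv]⟩)
      fun A B => Subtype.ext (hmul A B).symm
  have hr : ∀ U, (r U : Matrix (Fin (Fintype.card ι)) (Fin (Fintype.card ι)) ℂ) =
      (U : Matrix ι ι ℂ).submatrix e.symm e.symm := fun _ => rfl
  have hrV : ∀ A : Matrix ι ι ℂ, A.submatrix e.symm e.symm * V.submatrix e.symm id =
      (A * V).submatrix e.symm id := fun A => submatrix_mul_equiv A V e.symm e.symm id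
  have hVr : ∀ Z : Matrix ι (Fin n) ℂ, (V.submatrix e.symm id)ᴴ * Z.submatrix e.symm id =
      Vᴴ * Z := fun Z => by
    rw [conjTranspose_submatrix, submatrix_mul_equiv, submatrix_id_id]
  refine ⟨Fintype.card ι, r.comp Q, r.comp σ, V.submatrix e.symm id, fun g h => ?_, ?_, fun g => ?_, ?_⟩
  · rw [MonoidHom.comp_apply, MonoidHom.comp_apply, hr, hr, hmul, hQσ, hmul]
  · rw [hVr, hV]
  · rw [MonoidHom.comp_apply, hr, hrV, hQV]
    rfl
  · simp only [MonoidHom.comp_apply, hr, Matrix.mul_assoc, hrV, hVr]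
    simpa only [h1, Matrix.mul_one, Matrix.mul_assoc] using hle

end CommutingRep

/-! ### Matrix algebras as tracial von Neumann algebras. -/

section MatrixAlgebra

open Matrix

theorem exists_toEuclideanCLM {D : ℕ} (x : EuclideanSpace ℂ (Fin D) →L[ℂ] EuclideanSpace ℂ (Fin D)) :
    ∃ X, toEuclideanCLM (n := Fin D) (𝕜 := ℂ) X = x :=
  ⟨_, (toEuclideanCLM (n := Fin D) (𝕜 := ℂ)).apply_symm_apply x⟩

/-- The normalized trace, as a functional on operators. -/
def operatorTrace (D : ℕ) : (EuclideanSpace ℂ (Fin D) →L[ℂ] EuclideanSpace ℂ (Fin D)) →ₗ[ℂ] ℂ :=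
  (D : ℂ)⁻¹ • (traceLinearMap (Fin D) ℂ ℂ ∘ₗ
    (toEuclideanCLM (n := Fin D) (𝕜 := ℂ)).symm.toAlgEquiv.toLinearMap)

theorem operatorTrace_toEuclideanCLM {D : ℕ} (X : Matrix (Fin D) (Fin D) ℂ) :
    operatorTrace D (toEuclideanCLM (n := Fin D) (𝕜 := ℂ) X) = (D : ℂ)⁻¹ * trace X := by
  change (D : ℂ)⁻¹ * trace ((toEuclideanCLM (n := Fin D) (𝕜 := ℂ)).symm _) = _
  rw [StarAlgEquiv.symm_apply_apply]

theorem operatorTrace_star_mul_self {D : ℕ} (X : Matrix (Fin D) (Fin D) ℂ) :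
    operatorTrace D (star (toEuclideanCLM (n := Fin D) (𝕜 := ℂ) X) *
      toEuclideanCLM (n := Fin D) (𝕜 := ℂ) X) = (hsNormSq X : ℂ) := by
  have h1 : 0 ≤ trace (Xᴴ * X) := (posSemidef_conjTranspose_mul_self X).trace_nonneg
  have h2 : ((trace (Xᴴ * X)).re : ℂ) = trace (Xᴴ * X) :=
    Complex.ext (Complex.ofReal_re _) ((Complex.ofReal_im _).trans (Complex.nonneg_iff.1 h1).2)
  rw [← map_star, ← map_mul, operatorTrace_toEuclideanCLM, hsNormSq, Complex.ofReal_div, h2,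
    star_eq_conjTranspose, Complex.ofReal_natCast, div_eq_inv_mul]

/-- The standard basis, extended by zero to a sequence, with `1 / D` put on one side. -/
theorem exists_hasSum_operatorTrace (D : ℕ) : ∃ ξ η : ℕ → EuclideanSpace ℂ (Fin D),
    Summable (fun n => ‖ξ n‖ ^ 2) ∧ Summable (fun n => ‖η n‖ ^ 2) ∧
      ∀ x, HasSum (fun n => inner ℂ (η n) (x (ξ n))) (operatorTrace D x) := by
  let b : ℕ → EuclideanSpace ℂ (Fin D) := fun n =>
    if h : n < D then EuclideanSpace.basisFun (Fin D) ℂ ⟨n, h⟩ else 0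
  have hb : ∀ n ∉ Finset.range D, b n = 0 := fun n hn => dif_neg (by simpa using hn)
  refine ⟨b, fun n => (D : ℂ)⁻¹ • b n,
    summable_of_ne_finset_zero (s := Finset.range D) fun n hn => by simp [hb n hn],
    summable_of_ne_finset_zero (s := Finset.range D) fun n hn => by simp [hb n hn], fun x => ?_⟩
  have h1 : HasSum (fun n => inner ℂ ((D : ℂ)⁻¹ • b n) (x (b n)))
      (∑ n ∈ Finset.range D, inner ℂ ((D : ℂ)⁻¹ • b n) (x (b n))) :=
    hasSum_sum_of_ne_finset_zero fun n hn => by simp [hb n hn]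
  convert h1 using 1
  obtain ⟨X, rfl⟩ := exists_toEuclideanCLM x
  rw [operatorTrace_toEuclideanCLM, Finset.sum_range, trace, Finset.mul_sum]
  refine Finset.sum_congr rfl fun i _ => ?_
  simp [b, EuclideanSpace.inner_single_left, mul_comm]

variable (D : ℕ) [NeZero D]

/-- The full matrix algebra with its normalized trace. -/
def matrixVN : TracialVN.{0} where
  Space := EuclideanSpace ℂ (Fin D)
  alg := commutantOf ∅
  τ := operatorTrace D ∘ₗ (commutantOf
    (∅ : Set (EuclideanSpace ℂ (Fin D) →L[ℂ] EuclideanSpace ℂ (Fin D)))).toStarSubalgebra.subtype.toLinearMap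
  normal := by
    obtain ⟨ξ, η, h1, h2, h3⟩ := exists_hasSum_operatorTrace D
    exact ⟨ξ, η, h1, h2, fun x => h3 x.1⟩
  nonneg x := by
    obtain ⟨X, hX⟩ := exists_toEuclideanCLM x.1
    change 0 ≤ operatorTrace D (star x.1 * x.1)
    rw [← hX, operatorTrace_star_mul_self, hsNormSq_eq]
    exact_mod_cast div_nonneg (hsSq_nonneg X) (Nat.cast_nonneg _)
  map_one := by
    change operatorTrace D 1 = 1
    rw [← map_one (toEuclideanCLM (n := Fin D) (𝕜 := ℂ)), operatorTrace_toEuclideanCLM, trace_one,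
      Fintype.card_fin, inv_mul_cancel₀ (NeZero.ne _)]
  faithful x hx := by
    obtain ⟨X, hX⟩ := exists_toEuclideanCLM x.1
    change operatorTrace D (star x.1 * x.1) = 0 at hx
    rw [← hX, operatorTrace_star_mul_self, hsNormSq_eq, Complex.ofReal_eq_zero,
      div_eq_zero_iff, or_iff_left (NeZero.ne _)] at hx
    refine Subtype.ext ?_
    rw [← hX, hsSq_eq_zero hx, map_zero]
    rfl
  tracial x y := by
    obtain ⟨X, hX⟩ := exists_toEuclideanCLM x.1
    obtain ⟨Y, hY⟩ := exists_toEuclideanCLM y.1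
    change operatorTrace D (x.1 * y.1) = operatorTrace D (y.1 * x.1)
    rw [← hX, ← hY, ← map_mul, ← map_mul, operatorTrace_toEuclideanCLM,
      operatorTrace_toEuclideanCLM, trace_mul_comm]

variable {D}

/-- A matrix as an element of the matrix algebra. -/
def toMatrixVN : Matrix (Fin D) (Fin D) ℂ →⋆ₐ[ℂ] (matrixVN D).Elt where
  toFun X := ⟨toEuclideanCLM (n := Fin D) (𝕜 := ℂ) X, mem_commutantOf_iff.2 fun _ h => h.elim⟩
  map_one' := Subtype.ext (map_one (toEuclideanCLM (n := Fin D) (𝕜 := ℂ)))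
  map_mul' X Y := Subtype.ext (map_mul (toEuclideanCLM (n := Fin D) (𝕜 := ℂ)) X Y)
  map_zero' := Subtype.ext (map_zero (toEuclideanCLM (n := Fin D) (𝕜 := ℂ)))
  map_add' X Y := Subtype.ext (map_add (toEuclideanCLM (n := Fin D) (𝕜 := ℂ)) X Y)
  commutes' c := Subtype.ext ((toEuclideanCLM (n := Fin D) (𝕜 := ℂ)).toAlgEquiv.commutes c)
  map_star' X := Subtype.ext (map_star (toEuclideanCLM (n := Fin D) (𝕜 := ℂ)) X)

theorem toMatrixVN_injective : Function.Injective (toMatrixVN (D := D)) := fun _ _ h =>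
  (toEuclideanCLM (n := Fin D) (𝕜 := ℂ)).injective (congrArg Subtype.val h)

theorem toMatrixVN_surjective : Function.Surjective (toMatrixVN (D := D)) := fun x =>
  (exists_toEuclideanCLM x.1).imp fun _ hX => Subtype.ext hX

theorem normSq_toMatrixVN (X : Matrix (Fin D) (Fin D) ℂ) :
    TracialVN.normSq (toMatrixVN X) = hsNormSq X :=
  congrArg Complex.re (operatorTrace_star_mul_self X)

/-- In the presence of a spectral gap, a matrix that almost commutes with a unitary representation
and is nearly a co-isometry is close to a unitary of the commutant. -/
theorem exists_unitary_commute {G : Type v} [Group G] {Q : Finset G} {c : ℝ}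
    (hQ : HasSpectralGap.{0} G fun f => c * ∑ g ∈ Q, f g)
    (π : G →* unitaryGroup (Fin D) ℂ) {X : Matrix (Fin D) (Fin D) ℂ}
    (hX : IsStarProjection (Xᴴ * X)) : ∃ u : unitaryGroup (Fin D) ℂ,
      (∀ g, (π g : Matrix (Fin D) (Fin D) ℂ) * (u : Matrix (Fin D) (Fin D) ℂ) =
        (u : Matrix (Fin D) (Fin D) ℂ) * π g) ∧
      hsNormSq ((u : Matrix (Fin D) (Fin D) ℂ) - X) ≤ 6 * (1 - hsNormSq X +
        c * ∑ g ∈ Q, hsNormSq ((π g : Matrix (Fin D) (Fin D) ℂ) * X -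
          X * (π g : Matrix (Fin D) (Fin D) ℂ))) := by
  let ρ : G →* unitary (matrixVN D).Elt := (Unitary.map (.ofClass (toMatrixVN (D := D)))).toMonoidHom.comp π
  have hnorm : ‖toMatrixVN X‖ ≤ 1 := by
    have h1 : ‖star (toMatrixVN X) * toMatrixVN X‖ ≤ 1 := by
      rw [← map_star, ← map_mul]
      exact (hX.map toMatrixVN).norm_le
    rw [CStarRing.norm_star_mul_self] at h1
    nlinarith [norm_nonneg (toMatrixVN X)]
  -- The general correction lemma applies to matrices, with a finite sum over `Q` in place of the
  -- integral.
  obtain ⟨u, hu⟩ := TracialVN.exists_unitary_relCommutant ρ hQ (toMatrixVN X) hnorm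
  have hρ : ∀ g, (ρ g : (matrixVN D).Elt) = toMatrixVN (π g : Matrix (Fin D) (Fin D) ℂ) := fun _ => rfl
  obtain ⟨U, hU⟩ := toMatrixVN_surjective (TracialVN.relInclusion ρ u)
  have hcomm : ∀ g, (π g : Matrix (Fin D) (Fin D) ℂ) * U = U * π g := fun g => by
    have := TracialVN.commute_relInclusion ρ u g
    rw [hρ, ← hU, ← map_mul, ← map_mul] at this
    exact toMatrixVN_injective this
  refine ⟨⟨U, ?_⟩, hcomm, ?_⟩
  · rw [mem_unitaryGroup_iff']
    apply toMatrixVN_injective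
    rw [map_mul, map_star, hU, map_one, ← map_star, ← map_mul, Unitary.coe_star_mul_self, map_one]
  · rw [← hU, ← map_sub] at hu
    simpa only [hρ, ← map_mul, ← map_sub, normSq_toMatrixVN] using hu

end MatrixAlgebra

/-! ### Estimates for compressions of unitary matrices. -/

section Compressions

open Matrix

variable {d D : ℕ} {W : Matrix (Fin D) (Fin d) ℂ}

theorem hsSq_one_sub_isometry (hW : Wᴴ * W = 1) : hsSq (1 - W * Wᴴ) = (D : ℝ) - d := by
  have h1 : (1 - W * Wᴴ)ᴴ * (1 - W * Wᴴ) = 1 - W * Wᴴ := by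
    have h2 : W * Wᴴ * (W * Wᴴ) = W * Wᴴ := by
      rw [Matrix.mul_assoc, ← Matrix.mul_assoc Wᴴ, hW, Matrix.one_mul]
    rw [conjTranspose_sub, conjTranspose_one, conjTranspose_mul, conjTranspose_conjTranspose,
      Matrix.sub_mul, Matrix.mul_sub, Matrix.mul_sub, h2]
    simp
  rw [hsSq, h1, trace_sub, trace_mul_comm, hW, trace_one, trace_one]
  simp

theorem hsSq_unitary_isometry (hW : Wᴴ * W = 1) {b : Matrix (Fin d) (Fin d) ℂ}
    (hb : b ∈ unitaryGroup (Fin d) ℂ) : hsSq (W * b * Wᴴ) = d := by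
  rw [hsSq_mul_isometry hW, hsSq_isometry_mul hW, hsSq_unitary hb, Fintype.card_fin]

/-- The component outside the range of `W` is bounded by the codimension `D - d`; the component
inside is the compression error. -/
theorem hsSq_intertwine_le (hW : Wᴴ * W = 1) {P : Matrix (Fin D) (Fin D) ℂ}
    (hP : P ∈ unitaryGroup (Fin D) ℂ) (a : Matrix (Fin d) (Fin d) ℂ) :
    hsSq (P * W - W * a) ≤ 2 * ((D : ℝ) - d) + 2 * hsSq (a - Wᴴ * P * W) := by
  have h1 := hsSq_add_le ((1 - W * Wᴴ) * (P * W)) (W * (Wᴴ * P * W - a))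
  have h2 : (1 - W * Wᴴ) * (P * W) + W * (Wᴴ * P * W - a) = P * W - W * a := by
    rw [Matrix.sub_mul, Matrix.mul_sub, Matrix.one_mul]
    simp only [Matrix.mul_assoc]
    abel
  rw [h2, hsSq_isometry_mul hW, hsSq_sub_comm _ a, ← Matrix.mul_assoc] at h1
  have h3 := hsSq_mul_compress_le hW ((1 - W * Wᴴ) * P)
  rw [hsSq_mul_unitary hP, hsSq_one_sub_isometry hW] at h3
  linarith

theorem hsSq_intertwine_conjTranspose {P : Matrix (Fin D) (Fin D) ℂ}
    (hP : P ∈ unitaryGroup (Fin D) ℂ) {a : Matrix (Fin d) (Fin d) ℂ}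
    (ha : a ∈ unitaryGroup (Fin d) ℂ) : hsSq (a * Wᴴ - Wᴴ * P) = hsSq (P * W - W * a) := by
  have hP' := mem_unitaryGroup_iff'.1 hP
  have ha' := mem_unitaryGroup_iff.1 ha
  rw [star_eq_conjTranspose] at hP' ha'
  have h1 : P * (a * Wᴴ - Wᴴ * P)ᴴ * a = P * W - W * a := by
    rw [conjTranspose_sub, conjTranspose_mul, conjTranspose_mul, conjTranspose_conjTranspose,
      Matrix.mul_sub, Matrix.sub_mul, ← Matrix.mul_assoc P Pᴴ, ← star_eq_conjTranspose P,
      mem_unitaryGroup_iff.1 hP, Matrix.one_mul, Matrix.mul_assoc P, Matrix.mul_assoc W,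
      ← star_eq_conjTranspose a, mem_unitaryGroup_iff'.1 ha, Matrix.mul_one]
  rw [← h1, hsSq_mul_unitary ha, hsSq_unitary_mul hP, hsSq_conjTranspose]

/-- `P` is moved across `W b W*` by exchanging `P W` with `W a` on the left and `a W*` with `W* P`
on the right. The two exchange errors are equal, so their weights `2` and `4` add. -/
theorem hsSq_commutator_le (hW : Wᴴ * W = 1) {P : Matrix (Fin D) (Fin D) ℂ}
    (hP : P ∈ unitaryGroup (Fin D) ℂ) {a b : Matrix (Fin d) (Fin d) ℂ}
    (ha : a ∈ unitaryGroup (Fin d) ℂ) (hb : b ∈ unitaryGroup (Fin d) ℂ) :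
    hsSq (P * (W * b * Wᴴ) - W * b * Wᴴ * P) ≤
      12 * (((D : ℝ) - d) + hsSq (a - Wᴴ * P * W)) + 4 * hsSq (a * b - b * a) := by
  have h0 : P * (W * b * Wᴴ) - W * b * Wᴴ * P = (P * W - W * a) * (b * Wᴴ) +
      (W * (a * b - b * a) * Wᴴ + W * (b * (a * Wᴴ - Wᴴ * P))) := by
    simp only [Matrix.sub_mul, Matrix.mul_sub, Matrix.mul_assoc]
    abel
  have h1 := hsSq_add_le ((P * W - W * a) * (b * Wᴴ))
    (W * (a * b - b * a) * Wᴴ + W * (b * (a * Wᴴ - Wᴴ * P)))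
  have h2 := hsSq_add_le (W * (a * b - b * a) * Wᴴ) (W * (b * (a * Wᴴ - Wᴴ * P)))
  rw [← h0, ← Matrix.mul_assoc (P * W - W * a), hsSq_mul_isometry hW, hsSq_mul_unitary hb] at h1
  rw [hsSq_mul_isometry hW, hsSq_isometry_mul hW, hsSq_isometry_mul hW, hsSq_unitary_mul hb,
    hsSq_intertwine_conjTranspose hP ha] at h2
  have h3 := hsSq_intertwine_le hW hP a
  linarith

/-- `W b₁ W* W b₂ W* = W (b₁ b₂) W*`, so the defect of the `u`s is that of the `b`s plus three
approximation errors. -/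
theorem hsSq_multiplicative_le (hW : Wᴴ * W = 1) {u₁ u₂ u₃ : Matrix (Fin D) (Fin D) ℂ}
    (hu₂ : u₂ ∈ unitaryGroup (Fin D) ℂ) {b₁ b₂ b₃ : Matrix (Fin d) (Fin d) ℂ}
    (hb₁ : b₁ ∈ unitaryGroup (Fin d) ℂ) :
    hsSq (u₃ - u₁ * u₂) ≤ 2 * hsSq (u₃ - W * b₃ * Wᴴ) + 4 * hsSq (b₃ - b₁ * b₂) +
      8 * hsSq (u₁ - W * b₁ * Wᴴ) + 8 * hsSq (u₂ - W * b₂ * Wᴴ) := by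
  have h1 := hsSq_sub_le u₃ (W * b₃ * Wᴴ) (u₁ * u₂)
  have h2 := hsSq_sub_le (W * b₃ * Wᴴ) (W * (b₁ * b₂) * Wᴴ) (u₁ * u₂)
  have h3 := hsSq_add_le ((u₁ - W * b₁ * Wᴴ) * u₂) (W * (b₁ * (Wᴴ * (u₂ - W * b₂ * Wᴴ))))
  have h4 : (u₁ - W * b₁ * Wᴴ) * u₂ + W * (b₁ * (Wᴴ * (u₂ - W * b₂ * Wᴴ))) =
      u₁ * u₂ - W * (b₁ * b₂) * Wᴴ := by
    have : Wᴴ * (W * b₂ * Wᴴ) = b₂ * Wᴴ := by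
      rw [← Matrix.mul_assoc, ← Matrix.mul_assoc, hW, Matrix.one_mul]
    rw [Matrix.mul_sub, this]
    simp only [Matrix.sub_mul, Matrix.mul_sub, Matrix.mul_assoc]
    abel
  rw [h4, hsSq_mul_unitary hu₂, hsSq_isometry_mul hW, hsSq_unitary_mul hb₁] at h3
  have h5 := hsSq_compress_le hW (u₂ - W * b₂ * Wᴴ)
  rw [← Matrix.sub_mul, ← Matrix.mul_sub, hsSq_mul_isometry hW, hsSq_isometry_mul hW,
    hsSq_sub_comm (W * (b₁ * b₂) * Wᴴ)] at h2
  linarith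

/-- The estimate for the compression of a product of two commuting unitaries. -/
theorem hsSq_compression_le (hW : Wᴴ * W = 1) {P u s : Matrix (Fin D) (Fin D) ℂ}
    (hP : P ∈ unitaryGroup (Fin D) ℂ) {a b x : Matrix (Fin d) (Fin d) ℂ}
    (hb : b ∈ unitaryGroup (Fin d) ℂ) :
    hsSq (x - Wᴴ * (P * s) * W) ≤ 2 * hsSq (x - a * b) + 4 * hsSq (a - Wᴴ * P * W) +
      8 * hsSq (u - W * b * Wᴴ) + 8 * hsSq (u - s) := by
  have h1 := hsSq_sub_le x (a * b) (Wᴴ * (P * s) * W)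
  have h2 := hsSq_sub_le (a * b) (Wᴴ * P * W * b) (Wᴴ * (P * s) * W)
  rw [← Matrix.sub_mul, hsSq_mul_unitary hb] at h2
  have h3 : Wᴴ * P * W * b - Wᴴ * (P * s) * W = Wᴴ * (P * ((W * b * Wᴴ - s) * W)) := by
    have : W * b * Wᴴ * W = W * b := by rw [Matrix.mul_assoc, hW, Matrix.mul_one]
    rw [Matrix.sub_mul, this]
    simp only [Matrix.mul_sub, Matrix.mul_assoc]
  have h4 : hsSq (Wᴴ * P * W * b - Wᴴ * (P * s) * W) ≤ hsSq (W * b * Wᴴ - s) := by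
    rw [h3]
    refine (hsSq_compress_le hW _).trans ?_
    rw [hsSq_unitary_mul hP]
    exact hsSq_mul_compress_le hW _
  have h5 := hsSq_sub_le (W * b * Wᴴ) u s
  rw [hsSq_sub_comm _ u] at h5
  linarith

/-- In the presence of a spectral gap, a unitary that almost commutes with the compression of a
unitary representation is almost the compression of a unitary of the commutant. -/
theorem exists_unitary_commute_of_isometry {G : Type v} [Group G] {Q : Finset G} {c : ℝ}
    (hc : 0 ≤ c) (hQ : HasSpectralGap.{0} G fun f => c * ∑ g ∈ Q, f g) (hD : 0 < D)
    (hW : Wᴴ * W = 1) (π : G →* unitaryGroup (Fin D) ℂ) (a : G → unitaryGroup (Fin d) ℂ)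
    (b : unitaryGroup (Fin d) ℂ) : ∃ u : unitaryGroup (Fin D) ℂ,
      (∀ g, (π g : Matrix (Fin D) (Fin D) ℂ) * (u : Matrix (Fin D) (Fin D) ℂ) =
        (u : Matrix (Fin D) (Fin D) ℂ) * π g) ∧
      hsSq ((u : Matrix (Fin D) (Fin D) ℂ) - W * (b : Matrix (Fin d) (Fin d) ℂ) * Wᴴ) ≤
        6 * (((D : ℝ) - d) + c * ∑ g ∈ Q, (12 * (((D : ℝ) - d) +
          hsSq ((a g : Matrix (Fin d) (Fin d) ℂ) - Wᴴ * (π g : Matrix (Fin D) (Fin D) ℂ) * W)) +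
          4 * hsSq ((a g : Matrix (Fin d) (Fin d) ℂ) * (b : Matrix (Fin d) (Fin d) ℂ) -
            (b : Matrix (Fin d) (Fin d) ℂ) * (a g : Matrix (Fin d) (Fin d) ℂ)))) := by
  have : NeZero D := ⟨hD.ne'⟩
  have hD0 : (0 : ℝ) < D := by exact_mod_cast hD
  have hWW : (W * (b : Matrix (Fin d) (Fin d) ℂ) * Wᴴ)ᴴ *
      (W * (b : Matrix (Fin d) (Fin d) ℂ) * Wᴴ) = W * Wᴴ := by
    have hb := mem_unitaryGroup_iff'.1 b.2
    rw [star_eq_conjTranspose] at hb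
    simp only [conjTranspose_mul, conjTranspose_conjTranspose, Matrix.mul_assoc]
    rw [← Matrix.mul_assoc Wᴴ W, hW, Matrix.one_mul, ← Matrix.mul_assoc _ _ Wᴴ, hb, Matrix.one_mul]
  obtain ⟨u, hu, hle⟩ := exists_unitary_commute hQ π
    (X := W * (b : Matrix (Fin d) (Fin d) ℂ) * Wᴴ) (by
      rw [hWW]
      refine ⟨?_, ?_⟩
      · rw [IsIdempotentElem, Matrix.mul_assoc, ← Matrix.mul_assoc Wᴴ, hW, Matrix.one_mul]
      · rw [IsSelfAdjoint, star_eq_conjTranspose, conjTranspose_mul, conjTranspose_conjTranspose])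
  refine ⟨u, hu, ?_⟩
  simp only [hsNormSq_eq] at hle
  -- `W b W*` has squared norm `d` in dimension `D`, so after multiplication by `D` the defect `1 -
  -- d / D` becomes `D - d`.
  rw [hsSq_unitary_isometry hW b.2, ← Finset.sum_div, div_le_iff₀ hD0] at hle
  refine hle.trans ?_
  rw [mul_assoc, add_mul, sub_mul, one_mul, div_mul_cancel₀ _ hD0.ne', mul_assoc,
    div_mul_cancel₀ _ hD0.ne']
  gcongr with g hg
  exact hsSq_commutator_le hW (π g).2 (a g).2 b.2

end Compressions

/-! ### Diagonal extraction. -/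

section DiagonalSequences

/-- At stage `n`, choose a witness for the largest level `k ≤ n` that can be satisfied; by
monotonicity it serves every lower level. A fixed level is eventually attainable and below the cap
`n`. -/
theorem exists_seq_of_eventually {α : ℕ → Type*} [∀ n, Nonempty (α n)] {P : ℕ → (n : ℕ) → α n → Prop}
    (hP : ∀ k l n a, k ≤ l → P l n a → P k n a) (h : ∀ k, ∀ᶠ n in atTop, ∃ a, P k n a) :
    ∃ a : (n : ℕ) → α n, ∀ k, ∀ᶠ n in atTop, P k n (a n) := by
  classical
  have h1 : ∀ n, ∃ a : α n, ∀ k ≤ n, (∃ a, P k n a) → P k n a := fun n => by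
    by_cases h0 : ∃ k ≤ n, ∃ a, P k n a
    · obtain ⟨k, hk, hka⟩ := h0
      obtain ⟨a, ha⟩ := Nat.findGreatest_spec (P := fun k => ∃ a, P k n a) hk hka
      exact ⟨a, fun l hl hla => hP _ _ _ _ (Nat.le_findGreatest hl hla) ha⟩
    · push Not at h0
      exact ⟨Classical.arbitrary _, fun k hk ⟨a, ha⟩ => (h0 k hk a ha).elim⟩
  choose a ha using h1
  refine ⟨a, fun k => ?_⟩
  filter_upwards [h k, eventually_ge_atTop k] with n hn hkn
  exact ha n k hkn hn

end DiagonalSequences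

/-! ### Hilbert–Schmidt stability of direct products. -/

section Products

open Matrix

variable {G : Type v} [Group G] {H : Type w} [Group H]

/-- Two commuting unitary representations as a representation of the product. -/
def commutingRep {D : ℕ} (Q : G →* unitaryGroup (Fin D) ℂ) (σ : H →* unitaryGroup (Fin D) ℂ)
    (h : ∀ g h, (Q g : Matrix (Fin D) (Fin D) ℂ) * (σ h : Matrix (Fin D) (Fin D) ℂ) =
      (σ h : Matrix (Fin D) (Fin D) ℂ) * Q g) : G × H →* unitaryGroup (Fin D) ℂ :=
  MonoidHom.noncommCoprod Q σ fun g k => Subtype.ext (h g k)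

theorem FlexiblyHSStable.of_mulEquiv (e : G ≃* H) (hG : FlexiblyHSStable G) :
    FlexiblyHSStable H := by
  intro d hd φ hφ
  obtain ⟨D, π, W, hW, hD, hπ⟩ := hG d hd (fun n g => φ n (e g)) fun g h => by
    simpa only [map_mul] using hφ (e g) (e h)
  refine ⟨D, fun n => (π n).comp e.symm.toMonoidHom, W, hW, hD, fun h => ?_⟩
  simpa using hπ (e.symm h)

/-- Approximation on finite sets, along the sequence, suffices for flexible stability. -/
theorem exists_seq_rep_of_eventually [Countable G] {d : ℕ → ℕ} (hd : ∀ n, 0 < d n)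
    (φ : (n : ℕ) → G → unitaryGroup (Fin (d n)) ℂ)
    (h : ∀ (F : Finset G) (η : ℝ), 0 < η → ∀ᶠ n in atTop,
      ∃ (D : ℕ) (π : G →* unitaryGroup (Fin D) ℂ) (W : Matrix (Fin D) (Fin (d n)) ℂ), Wᴴ * W = 1 ∧
        (D : ℝ) - d n ≤ η * d n ∧ ∀ g ∈ F, hsSq ((φ n g : Matrix (Fin (d n)) (Fin (d n)) ℂ) -
          Wᴴ * (π g : Matrix (Fin D) (Fin D) ℂ) * W) ≤ η * d n) :
    ∃ (D : ℕ → ℕ) (π : (n : ℕ) → G →* unitaryGroup (Fin (D n)) ℂ)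
      (W : (n : ℕ) → Matrix (Fin (D n)) (Fin (d n)) ℂ),
      (∀ n, (W n)ᴴ * W n = 1) ∧ Tendsto (fun n => (D n : ℝ) / d n) atTop (𝓝 1) ∧
      ∀ g, Tendsto (fun n => hsNormSq ((φ n g : Matrix (Fin (d n)) (Fin (d n)) ℂ) -
        (W n)ᴴ * (π n g : Matrix (Fin (D n)) (Fin (D n)) ℂ) * W n)) atTop (𝓝 0) := by
  classical
  obtain ⟨e, he⟩ := exists_surjective_nat G
  let α : ℕ → Type v := fun n => Σ D : ℕ, (G →* unitaryGroup (Fin D) ℂ) ×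
    {W : Matrix (Fin D) (Fin (d n)) ℂ // Wᴴ * W = 1}
  have : ∀ n, Nonempty (α n) := fun n => ⟨⟨d n, 1, 1, by simp⟩⟩
  have hd0 : ∀ n, (0 : ℝ) < d n := fun n => by exact_mod_cast hd n
  obtain ⟨a, ha⟩ := exists_seq_of_eventually (α := α) (P := fun k n a =>
    (a.1 : ℝ) - d n ≤ 1 / ((k : ℝ) + 1) * d n ∧ ∀ i < k,
      hsSq ((φ n (e i) : Matrix (Fin (d n)) (Fin (d n)) ℂ) -
        (a.2.2 : Matrix (Fin a.1) (Fin (d n)) ℂ)ᴴ * (a.2.1 (e i) : Matrix (Fin a.1) (Fin a.1) ℂ) *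
          (a.2.2 : Matrix (Fin a.1) (Fin (d n)) ℂ)) ≤ 1 / ((k : ℝ) + 1) * d n)
    (fun k l n a hkl hl => by
      have hle : 1 / ((l : ℝ) + 1) * d n ≤ 1 / ((k : ℝ) + 1) * d n := by gcongr
      exact ⟨hl.1.trans hle, fun i hi => (hl.2 i (hi.trans_le hkl)).trans hle⟩)
    fun k => by
      filter_upwards [h ((Finset.range k).image e) (1 / ((k : ℝ) + 1)) (by positivity)] with n hn
      obtain ⟨D, π, W, hW, hD, hπ⟩ := hn
      exact ⟨⟨D, π, W, hW⟩, hD, fun i hi =>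
        hπ _ (Finset.mem_image_of_mem e (Finset.mem_range.2 hi))⟩
  have hsmall : ∀ {f : ℕ → ℝ} {l : ℕ}, (∀ n, 0 ≤ f n) →
      (∀ k > l, ∀ᶠ n in atTop, f n ≤ 1 / ((k : ℝ) + 1)) → Tendsto f atTop (𝓝 0) := by
    intro f l hf0 hf
    rw [tendsto_order]
    refine ⟨fun x hx => Eventually.of_forall fun n => hx.trans_le (hf0 n), fun x hx => ?_⟩
    obtain ⟨k, hk, hkl⟩ := ((tendsto_one_div_add_atTop_nhds_zero_nat (𝕜 := ℝ)).eventually_lt_const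
      hx |>.and (eventually_gt_atTop l)).exists
    exact (hf k hkl).mono fun n hn => hn.trans_lt hk
  refine ⟨fun n => (a n).1, fun n => (a n).2.1, fun n => (a n).2.2, fun n => (a n).2.2.2, ?_,
    fun g => ?_⟩
  · have h1 : Tendsto (fun n => (((a n).1 : ℝ) - d n) / d n) atTop (𝓝 0) :=
      hsmall (l := 0) (fun n => div_nonneg
        (hsSq_one_sub_isometry (a n).2.2.2 ▸ hsSq_nonneg _) (hd0 n).le)
        fun k _ => (ha k).mono fun n hn => (div_le_iff₀ (hd0 n)).2 hn.1
    have h2 := h1.add_const 1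
    rw [zero_add] at h2
    refine h2.congr fun n => ?_
    rw [sub_div, div_self (hd0 n).ne', sub_add_cancel]
  · obtain ⟨i, rfl⟩ := he g
    exact hsmall (l := i) (fun n => div_nonneg (hsSq_nonneg _) (hd0 n).le)
      fun k hk => (ha k).mono fun n hn => (div_le_iff₀ (hd0 n)).2 (hn.2 i hk)

/-- Stability of `G` treats the first factor, property (T) replaces the second factor by unitaries
`u n h` commuting exactly with `π n`, and `exists_commuting` makes these multiplicative without
losing the commutation. All errors are measured against `d n`, which is legitimate as `D n / d n →
1`. -/
theorem FlexiblyHSStable.prod [Countable G] [Countable H] (hG : FlexiblyHSStable G)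
    (hT : HasPropertyT G) (hH : FlexiblyHSStable H) : FlexiblyHSStable (G × H) := by
  classical
  intro d hd φ hφ
  have hd0 : ∀ n, (0 : ℝ) < d n := fun n => by exact_mod_cast hd n
  obtain ⟨S, c, hc, hS⟩ := hT.hasSpectralGap
  obtain ⟨D, π, W, hW, hD, hπ⟩ := hG d hd (fun n g => φ n (g, 1)) fun g h => by
    simpa using hφ (g, 1) (h, 1)
  have hdD : ∀ n, (d n : ℝ) ≤ D n := fun n => by
    have := hsSq_one_sub_isometry (hW n) ▸ hsSq_nonneg (1 - W n * (W n)ᴴ)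
    linarith
  have hD0 : ∀ n, 0 < D n := fun n => by exact_mod_cast (hd0 n).trans_le (hdD n)
  choose u hu hle using fun n (h : H) => exists_unitary_commute_of_isometry hc.le hS (hD0 n) (hW n)
    (π n) (fun g => φ n (g, 1)) (φ n (1, h))
  have hdim : Tendsto (fun n => ((D n : ℝ) - d n) / d n) atTop (𝓝 0) := by
    have := hD.sub_const 1
    rw [sub_self] at this
    refine this.congr fun n => ?_
    rw [sub_div, div_self (hd0 n).ne']
  have hmul : ∀ x y : G × H, Tendsto (fun n => hsSq
      ((φ n (x * y) : Matrix (Fin (d n)) (Fin (d n)) ℂ) -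
        (φ n x : Matrix (Fin (d n)) (Fin (d n)) ℂ) *
          (φ n y : Matrix (Fin (d n)) (Fin (d n)) ℂ)) / d n) atTop (𝓝 0) := hφ
  have hcomp : ∀ g, Tendsto (fun n => hsSq ((φ n (g, 1) : Matrix (Fin (d n)) (Fin (d n)) ℂ) -
      (W n)ᴴ * (π n g : Matrix (Fin (D n)) (Fin (D n)) ℂ) * W n) / d n) atTop (𝓝 0) := hπ
  have hcomm : ∀ g h, Tendsto (fun n => hsSq ((φ n (g, 1) : Matrix (Fin (d n)) (Fin (d n)) ℂ) *
      (φ n (1, h) : Matrix (Fin (d n)) (Fin (d n)) ℂ) -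
      (φ n (1, h) : Matrix (Fin (d n)) (Fin (d n)) ℂ) *
      (φ n (g, 1) : Matrix (Fin (d n)) (Fin (d n)) ℂ)) / d n) atTop (𝓝 0) := fun g h => by
    have h1 := ((hmul (g, 1) (1, h)).const_mul 2).add ((hmul (1, h) (g, 1)).const_mul 2)
    rw [mul_zero, add_zero] at h1
    refine squeeze_zero (fun n => div_nonneg (hsSq_nonneg _) (hd0 n).le) (fun n => ?_) h1
    have h2 := hsSq_sub_le ((φ n (g, 1) : Matrix (Fin (d n)) (Fin (d n)) ℂ) *
      (φ n (1, h) : Matrix (Fin (d n)) (Fin (d n)) ℂ)) (φ n (g, h))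
      ((φ n (1, h) : Matrix (Fin (d n)) (Fin (d n)) ℂ) *
      (φ n (g, 1) : Matrix (Fin (d n)) (Fin (d n)) ℂ))
    rw [hsSq_sub_comm _ (φ n (g, h) : Matrix (Fin (d n)) (Fin (d n)) ℂ)] at h2
    rw [← mul_div_assoc, ← mul_div_assoc, ← add_div]
    refine div_le_div_of_nonneg_right ?_ (hd0 n).le
    simpa using h2
  have hu0 : ∀ h, Tendsto (fun n => hsSq ((u n h : Matrix (Fin (D n)) (Fin (D n)) ℂ) -
      W n * (φ n (1, h) : Matrix (Fin (d n)) (Fin (d n)) ℂ) * (W n)ᴴ) / d n) atTop (𝓝 0) :=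
    fun h => by
    have h1 := (hdim.add ((tendsto_finsetSum S fun g _ =>
      ((hdim.add (hcomp g)).const_mul 12).add ((hcomm g h).const_mul 4)).const_mul c)).const_mul 6
    simp only [add_zero, mul_zero, Finset.sum_const_zero] at h1
    refine squeeze_zero (fun n => div_nonneg (hsSq_nonneg _) (hd0 n).le) (fun n => ?_) h1
    rw [div_le_iff₀ (hd0 n)]
    refine (hle n h).trans_eq ?_
    have hn := (hd0 n).ne'
    simp only [← mul_div_assoc, ← add_div, ← Finset.sum_div]
    rw [div_mul_cancel₀ _ hn]
  have humul : ∀ h k, Tendsto (fun n => hsSq ((u n (h * k) : Matrix (Fin (D n)) (Fin (D n)) ℂ) -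
      (u n h : Matrix (Fin (D n)) (Fin (D n)) ℂ) *
        (u n k : Matrix (Fin (D n)) (Fin (D n)) ℂ)) / d n) atTop (𝓝 0) := fun h k => by
    have h1 := ((((hu0 (h * k)).const_mul 2).add ((hmul (1, h) (1, k)).const_mul 4)).add
      ((hu0 h).const_mul 8)).add ((hu0 k).const_mul 8)
    simp only [add_zero, mul_zero] at h1
    refine squeeze_zero (fun n => div_nonneg (hsSq_nonneg _) (hd0 n).le) (fun n => ?_) h1
    simp only [← mul_div_assoc, ← add_div]
    refine div_le_div_of_nonneg_right ?_ (hd0 n).le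
    have h2 := hsSq_multiplicative_le (hW n) (u₁ := (u n h : Matrix (Fin (D n)) (Fin (D n)) ℂ))
      (u₃ := u n (h * k)) (u n k).2 (b₂ := φ n (1, k)) (b₃ := φ n (1, h * k)) (φ n (1, h)).2
    simpa using h2
  refine exists_seq_rep_of_eventually hd φ fun F η hη => ?_
  -- The final error contains `8` times the bound `(η / 32) D + (η / 32) d`, which is at most `3 η d
  -- / 4` once `D ≤ 2 d`; the other terms take the remaining `η d / 4`.
  obtain ⟨E, C, hC, hE⟩ := hH.exists_commuting (F.image Prod.snd) (η := η / 32) (by positivity)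
  have hEsum : Tendsto (fun n => C * ∑ e ∈ E, hsSq ((u n (e.1 * e.2) : Matrix (Fin (D n)) (Fin (D n)) ℂ) -
      (u n e.1 : Matrix (Fin (D n)) (Fin (D n)) ℂ) *
        (u n e.2 : Matrix (Fin (D n)) (Fin (D n)) ℂ)) / d n) atTop (𝓝 0) := by
    have h1 := (tendsto_finsetSum E fun e _ => humul e.1 e.2).const_mul C
    simpa using h1
  have hF : ∀ᶠ n in atTop, ∀ x ∈ F, 2 * (hsSq ((φ n x : Matrix (Fin (d n)) (Fin (d n)) ℂ) -
      (φ n (x.1, 1) : Matrix (Fin (d n)) (Fin (d n)) ℂ) *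
        (φ n (1, x.2) : Matrix (Fin (d n)) (Fin (d n)) ℂ)) / d n) +
      4 * (hsSq ((φ n (x.1, 1) : Matrix (Fin (d n)) (Fin (d n)) ℂ) -
        (W n)ᴴ * (π n x.1 : Matrix (Fin (D n)) (Fin (D n)) ℂ) * W n) / d n) +
      8 * (hsSq ((u n x.2 : Matrix (Fin (D n)) (Fin (D n)) ℂ) -
        W n * (φ n (1, x.2) : Matrix (Fin (d n)) (Fin (d n)) ℂ) * (W n)ᴴ) / d n) < η / 4 := by
    refine (Filter.eventually_all_finset F).2 fun x _ => ?_
    have h1 := (((hmul (x.1, 1) (1, x.2)).const_mul 2).add ((hcomp x.1).const_mul 4)).add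
      ((hu0 x.2).const_mul 8)
    simp only [add_zero, mul_zero, Prod.mk_mul_mk, mul_one, one_mul] at h1
    exact h1.eventually_lt_const (by positivity)
  -- The bound by `1` gives `D n ≤ 2 d n`; the bound by `η / 2` leaves room for the second
  -- enlargement of the dimension.
  filter_upwards [hEsum.eventually_lt_const (by positivity : 0 < η / 32), hF,
    hdim.eventually_lt_const (by positivity : 0 < min 1 (η / 2))] with n h1 h2 h3
  obtain ⟨D', Q, σ, V, hQσ, hV, hQV, hle'⟩ := hE (π n) (u n) fun g h => hu n h g
  rw [← Finset.sum_div, ← mul_div_assoc, div_lt_iff₀ (hd0 n)] at h1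
  rw [lt_min_iff, div_lt_iff₀ (hd0 n), div_lt_iff₀ (hd0 n), one_mul] at h3
  have hDD' : 0 ≤ (D' : ℝ) - D n := hsSq_one_sub_isometry hV ▸ hsSq_nonneg _
  have hsum : 0 ≤ ∑ h ∈ F.image Prod.snd, hsSq ((u n h : Matrix (Fin (D n)) (Fin (D n)) ℂ) -
      Vᴴ * (σ h : Matrix (Fin D') (Fin D') ℂ) * V) := Finset.sum_nonneg fun _ _ => hsSq_nonneg _
  have hηd : 0 < η * d n := mul_pos hη (hd0 n)
  have hηD : η * D n ≤ η * (2 * d n) := by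
    gcongr
    linarith
  refine ⟨D', commutingRep Q σ hQσ, V * W n, ?_, by linarith, fun x hx => ?_⟩
  · rw [conjTranspose_mul, Matrix.mul_assoc, ← Matrix.mul_assoc Vᴴ, hV, Matrix.one_mul, hW]
  · have h4 : (V * W n)ᴴ * (commutingRep Q σ hQσ x : Matrix (Fin D') (Fin D') ℂ) * (V * W n) =
        (W n)ᴴ * ((π n x.1 : Matrix (Fin (D n)) (Fin (D n)) ℂ) *
          (Vᴴ * (σ x.2 : Matrix (Fin D') (Fin D') ℂ) * V)) * W n := by
      change (V * W n)ᴴ * ((Q x.1 : Matrix (Fin D') (Fin D') ℂ) *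
        (σ x.2 : Matrix (Fin D') (Fin D') ℂ)) * (V * W n) = _
      simp only [conjTranspose_mul, ← Matrix.mul_assoc]
      rw [Matrix.mul_assoc (W n)ᴴ Vᴴ, conjTranspose_intertwine (Q x.1).2 (π n x.1).2 (hQV x.1),
        ← Matrix.mul_assoc]
    have h5 := hsSq_compression_le (hW n) (u := (u n x.2 : Matrix (Fin (D n)) (Fin (D n)) ℂ))
      (s := Vᴴ * (σ x.2 : Matrix (Fin D') (Fin D') ℂ) * V) (π n x.1).2
      (a := φ n (x.1, 1)) (x := φ n x) (φ n (1, x.2)).2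
    have h6 := Finset.single_le_sum (f := fun h => hsSq ((u n h : Matrix (Fin (D n)) (Fin (D n)) ℂ) -
      Vᴴ * (σ h : Matrix (Fin D') (Fin D') ℂ) * V)) (fun _ _ => hsSq_nonneg _)
      (Finset.mem_image_of_mem Prod.snd hx)
    have h7 := h2 x hx
    simp only [← mul_div_assoc, ← add_div] at h7
    rw [div_lt_iff₀ (hd0 n)] at h7
    rw [h4]
    linarith

end Products

end

theorem mainTheorem4 :
    (∃ K : ℝ, 0 < K ∧
      ∀ (C : Set TracialVN.{u}), ClosedUnderSubalgebras C → ClosedUnderDilations C →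
      ∀ (G₁ : Type v) [Group G₁] [Countable G₁] [MeasurableSpace G₁] [DiscreteMeasurableSpace G₁]
        (G₂ : Type w) [Group G₂] [Countable G₂] [MeasurableSpace G₂] [DiscreteMeasurableSpace G₂]
        (μ₁ : Measure G₁) [IsProbabilityMeasure μ₁] (μ₂ : Measure G₂) [IsProbabilityMeasure μ₂],
        GeneratingSupport μ₁ → GeneratingSupport μ₂ → spectralGapConst.{u, v} μ₁ ≠ ∞ →
        (IsFlexiblyStable C μ₁ → IsFlexiblyStable C μ₂ →
          IsFlexiblyStable C (averagedMeasure μ₁ μ₂)) ∧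
        (Nontrivial G₁ → ∀ δ₁ δ₂ : ℝ → ℝ,
          IsFlexibleModulus C μ₁ δ₁ → IsFlexibleModulus C μ₂ δ₂ →
          ∃ δ : ℝ → ℝ, IsFlexibleModulus C (averagedMeasure μ₁ μ₂) δ ∧
            ∀ ε ∈ Set.Icc (0 : ℝ) 4,
              δ ε ≤ K * δ₂ (min 4 ((spectralGapConst.{u, v} μ₁).toReal * δ₁ ε)))) ∧
    (∀ (G : Type v) [Group G] [Countable G] (H : Type w) [Group H] [Countable H],
      HasPropertyT G ∨ HasPropertyT H →
      FlexiblyHSStable G → FlexiblyHSStable H → FlexiblyHSStable (G × H)) := by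
  refine ⟨⟨6000000, by norm_num, fun C hsub hdil G₁ _ _ _ _ G₂ _ _ _ _ μ₁ _ μ₂ _ _ _ hκ =>
    ⟨fun h₁ h₂ => ?_, fun _ δ₁ δ₂ h₁ h₂ => ?_⟩⟩, fun G _ _ H _ _ hT hG hH => ?_⟩
  · exact h₁.prod hsub hdil ENNReal.toReal_nonneg
      (HasSpectralGap.of_poincareInequality (poincareInequality_spectralGapConst hκ)) h₂
  · exact ⟨_, h₁.prod hsub hdil (half_le_spectralGapConst hκ)
      (HasSpectralGap.of_poincareInequality (poincareInequality_spectralGapConst hκ)) h₂,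
      fun ε _ => min_le_right _ _⟩
  · rcases hT with hT | hT
    · exact hG.prod hT hH
    -- The correction argument needs the spectral gap on the factor treated first, so the factors
    -- are exchanged.
    · exact (hH.prod hT hG).of_mulEquiv MulEquiv.prodComm
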